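/- Let $N\ge 2$, $p\ge 2$, $s_1\in(0,1)$, $s_p\in\left(\frac{p-1}{p},1\right)$ and $\gamma\in(0,1)$. For a measurable set $A\subseteq\mathbb{R}^N$, $s\in(0,1)$ and $q\ge 1$ put $$[u]_{W^{s,q}(A)}=\Big(\int_A\int_A\frac{|u(x)-u(y)|^q}{|x-y|^{N+sq}}\,dx\,dy\Big)^{1/q},\qquad W^{s,q}(A)=\{u\in L^q(A):[u]_{W^{s,q}(A)}<\infty\},$$ and let $W^{s,q}_{\rm loc}(\Omega)$ be the functions in $W^{s,q}(U)$ for all open $U\subset\subset\Omega$. Let $L^{p-1}_{s_pp}(\mathbb{R}^N)$ be the set of $w\in L^{p-1}_{\rm loc}(\mathbb{R}^N)$ with $\int_{\mathbb{R}^N}\frac{|w(x)|^{p-1}}{(1+|x|)^{N+s_pp}}\,dx<\infty$, and put $$\mathrm{Tail}(u;x_0,R)=\Big(R^{s_pp}\int_{\mathbb{R}^N\setminus B_R(x_0)}\frac{|u(x)|^{p-1}}{|x-x_0|^{N+s_pp}}\,dx\Big)^{\frac1{p-1}},\qquad [w]_{C^{0,\gamma}(A)}=\sup_{x,y\in A,\,x\ne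 y}\frac{|w(x)-w(y)|}{|x-y|^\gamma}.$$ Let $\Omega\subset\mathbb{R}^N$ be a bounded domain. A weak solution of $(-\Delta_1)^{s_1}u+(-\Delta_p)^{s_p}u=0$ in $\Omega$ is a function $u\in W^{s_1,1}_{\rm loc}(\Omega)\cap W^{s_p,p}_{\rm loc}(\Omega)\cap L^{p-1}_{s_pp}(\mathbb{R}^N)$ for which there is $Z\in L^\infty(\mathbb{R}^N\times\mathbb{R}^N)$ with $Z(x,y)\in\mathrm{sgn}(u(x)-u(y))$ for a.e. $(x,y)$, where $\mathrm{sgn}(t)=\{t/|t|\}$ for $t\neq0$ and $\mathrm{sgn}(0)=[-1,1]$, such that $$0=\int_{\mathbb{R}^N}\int_{\mathbb{R}^N}Z(x,y)\frac{\varphi(x)-\varphi(y)}{|x-y|^{N+s_1}}\,dx\,dy+\int_{\mathbb{R}^N}\int_{\mathbb{R}^N}\frac{|u(x)-u(y)|^{p-2}(u(x)-u(y))(\varphi(x)-\varphi(y))}{|x-y|^{N+s_pp}}\,dx\,dy$$ for every $\varphi\in W^{s_1,1}(\mathbb{R}^N)\cap W^{s_p,p}(\mathbb{R}^N)$ with compact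 support in $\Omega$. Then there are constants $C,\kappa>0$ depending only on $N,p,s_1,s_p,\gamma$ such that, for every bounded domain $\Omega\subset\mathbb{R}^N$, every weak solution $u\in L^\infty_{\rm loc}(\Omega)$ of this equation in $\Omega$ belongs, after modification on a null set of $\Omega$, to $C^{0,\gamma}_{\rm loc}(\Omega)$ (that is, $[u]_{C^{0,\gamma}(B)}<\infty$ for every ball $B\subset\subset\Omega$), and for every ball $B_R=B_R(x_0)\subset\subset\Omega$ with $R\in(0,1)$ and every $r\in(0,R)$, with $B_r=B_r(x_0)$, $$[u]_{C^{0,\gamma}(B_r)}\le\frac{C\left(\|u\|_{L^\infty(B_R)}+\mathrm{Tail}(u;x_0,R)+[u]_{W^{s_p,p}(B_R)}+1\right)}{(R-r)^\kappa}.$$ -/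

import Mathlib

open MeasureTheory
open scoped ENNReal

noncomputable section

/-- Euclidean space `ℝ^N`, with the Euclidean norm and Lebesgue measure. -/
abbrev RSpace (N : ℕ) : Type := EuclideanSpace ℝ (Fin N)

/-- The Gagliardo seminorm
`[u]_{W^{s,q}(A)} = (∫_A ∫_A |u(x) - u(y)|^q / |x - y|^{N + s q} dx dy)^{1/q}`,
with values in `[0, ∞]`. -/
def gagliardoSeminorm {N : ℕ} (s q : ℝ) (A : Set (RSpace N)) (u : RSpace N → ℝ) : ℝ≥0∞ :=
  (∫⁻ x in A, ∫⁻ y in A,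
    ENNReal.ofReal (|u x - u y| ^ q / ‖x - y‖ ^ ((N : ℝ) + s * q))) ^ (1 / q)

/-- `u ∈ W^{s,q}(A)`: `u ∈ L^q(A)` and the Gagliardo seminorm on `A` is finite. -/
structure MemFracSobolev {N : ℕ} (s q : ℝ) (A : Set (RSpace N)) (u : RSpace N → ℝ) : Prop where
  memLp : MemLp u (ENNReal.ofReal q) (volume.restrict A)
  seminorm_lt_top : gagliardoSeminorm s q A u < ⊤

/-- `u ∈ W^{s,q}_loc(Ω)`: `u ∈ W^{s,q}(U)` for every open `U ⊂⊂ Ω`. -/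
def MemFracSobolevLoc {N : ℕ} (s q : ℝ) (Ω : Set (RSpace N)) (u : RSpace N → ℝ) : Prop :=
  ∀ U : Set (RSpace N), IsOpen U → IsCompact (closure U) → closure U ⊆ Ω →
    MemFracSobolev s q U u

/-- The tail space `L^q_a(ℝ^N)`: functions in `L^q_loc(ℝ^N)` with
`∫ |w|^q / (1 + |x|)^{N + a} dx < ∞`. -/
structure MemTailSpace {N : ℕ} (q a : ℝ) (w : RSpace N → ℝ) : Prop where
  memLp_loc : ∀ K : Set (RSpace N), IsCompact K → MemLp w (ENNReal.ofReal q) (volume.restrict K)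
  lintegral_lt_top :
    ∫⁻ x, ENNReal.ofReal (|w x| ^ q / (1 + ‖x‖) ^ ((N : ℝ) + a)) < ⊤

/-- `Tail(u; x₀, R) = (R^{s p} ∫_{ℝ^N ∖ B_R(x₀)} |u|^{p-1} / |x - x₀|^{N + s p} dx)^{1/(p-1)}`,
with values in `[0, ∞]`. -/
def nonlocalTail {N : ℕ} (s p : ℝ) (u : RSpace N → ℝ) (x₀ : RSpace N) (R : ℝ) : ℝ≥0∞ :=
  (ENNReal.ofReal (R ^ (s * p)) *
    ∫⁻ x in (Metric.ball x₀ R)ᶜ,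
      ENNReal.ofReal (|u x| ^ (p - 1) / ‖x - x₀‖ ^ ((N : ℝ) + s * p))) ^ (1 / (p - 1))

/-- `‖u‖_{L^∞(A)}`, with values in `[0, ∞]`. -/
def supNormOn {N : ℕ} (A : Set (RSpace N)) (u : RSpace N → ℝ) : ℝ≥0∞ :=
  eLpNorm u ⊤ (volume.restrict A)

/-- `u ∈ L^∞_loc(Ω)`. -/
def LocallyBoundedOn {N : ℕ} (Ω : Set (RSpace N)) (u : RSpace N → ℝ) : Prop :=
  ∀ K : Set (RSpace N), IsCompact K → K ⊆ Ω → supNormOn K u < ⊤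

/-- The set-valued sign: `{1}` on positive numbers, `{-1}` on negative numbers, and
`sgn 0 = [-1, 1]`. -/
def setSign (t : ℝ) : Set ℝ :=
  {z | (0 < t → z = 1) ∧ (t < 0 → z = -1) ∧ (t = 0 → z ∈ Set.Icc (-1) 1)}

/-- Test functions: `φ ∈ W^{s₁,1}(ℝ^N) ∩ W^{s_p,p}(ℝ^N)` whose support is a compact subset
of `Ω`. -/
structure IsTestFunction {N : ℕ} (s₁ sp p : ℝ) (Ω : Set (RSpace N)) (φ : RSpace N → ℝ) :
    Prop where
  mem_one : MemFracSobolev s₁ 1 Set.univ φ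
  mem_p : MemFracSobolev sp p Set.univ φ
  hasCompactSupport : HasCompactSupport φ
  tsupport_subset : tsupport φ ⊆ Ω

/-- Weak solutions of `(-Δ₁)^{s₁} u + (-Δ_p)^{s_p} u = 0` in `Ω`. Both double integrals converge
absolutely for all `u`, `Z`, `φ` that are allowed here, because `φ` has compact support
in `Ω`. -/
structure IsWeakSolution {N : ℕ} (s₁ sp p : ℝ) (Ω : Set (RSpace N)) (u : RSpace N → ℝ) :
    Prop where
  mem_one : MemFracSobolevLoc s₁ 1 Ω u
  mem_p : MemFracSobolevLoc sp p Ω u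
  mem_tail : MemTailSpace (p - 1) (sp * p) u
  equation : ∃ Z : RSpace N × RSpace N → ℝ,
    MemLp Z ⊤ (volume : Measure (RSpace N × RSpace N)) ∧
    (∀ᵐ z : RSpace N × RSpace N, Z z ∈ setSign (u z.1 - u z.2)) ∧
    ∀ φ : RSpace N → ℝ, IsTestFunction s₁ sp p Ω φ →
      0 = (∫ z : RSpace N × RSpace N,
            Z z * (φ z.1 - φ z.2) / ‖z.1 - z.2‖ ^ ((N : ℝ) + s₁)) +
          ∫ z : RSpace N × RSpace N,
            |u z.1 - u z.2| ^ (p - 2) * (u z.1 - u z.2) * (φ z.1 - φ z.2) /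
              ‖z.1 - z.2‖ ^ ((N : ℝ) + sp * p)

/-- The Hölder seminorm `[w]_{C^{0,γ}(A)} = sup_{x ≠ y in A} |w(x) - w(y)| / |x - y|^γ`,
with values in `[0, ∞]`. -/
def holderSeminorm {N : ℕ} (γ : ℝ) (A : Set (RSpace N)) (w : RSpace N → ℝ) : ℝ≥0∞ :=
  ⨆ (x ∈ A) (y ∈ A) (_ : x ≠ y), ENNReal.ofReal (|w x - w y| / ‖x - y‖ ^ γ)

/-- `w ∈ C^{0,γ}_loc(Ω)`: finite Hölder seminorm on every ball `B_R(x₀) ⊂⊂ Ω`. -/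
def MemHolderLoc {N : ℕ} (γ : ℝ) (Ω : Set (RSpace N)) (w : RSpace N → ℝ) : Prop :=
  ∀ (x₀ : RSpace N) (R : ℝ), 0 < R → Metric.closedBall x₀ R ⊆ Ω →
    holderSeminorm γ (Metric.ball x₀ R) w < ⊤

end

/-! The regularity comes from differentiating the equation discretely. Write θ = s_p p, so that the
hypothesis on s_p reads p - 1 < θ < p. The equation is subtracted from its translate by h, and the
difference is tested with `oddPow n (delta h u)` times the square of a cutoff. The order-p part is
strongly monotone and produces a Gagliardo energy of `delta h u` with exponent p + n
(`monotone_energy_lower`). The order-1 part is merely monotone, but this holds for any selection Z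
of the set-valued sign, so no regularisation is needed: it has the good sign up to an error in which
the difference falls on the cutoff (`sign_energy_lower`). That error carries the kernel |x - y|^(1 -
s₁ - N), which is locally integrable. Pairs of distant points are controlled by the tail. The
outcome is `exists_energy_estimate`.

Suppose that the differences of u with step h are of size |h|^γ in L^q. With n = q - p + 1, Hölder's
inequality bounds the right-hand side of the energy estimate by a multiple of |h|^(γ(q - p + 2))
(`exists_energy_bound_of_diffBound`). On the left, a Nikolskii inequality for `delta h u` gains a
factor |h|^θ and yields second differences of u in L^(q+1) (`lintegral_translate_sub_le`). Below
order one, second differences control first differences (`lintegral_sub_le_of_second_difference`).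
Hence `UniformDiffBound.improve` passes from (q, γ) to (q + 1, γ') whenever γ' < 1 and γ'(q + 1) ≤ θ
+ γ(q - p + 2), as long as the kernel exponent 2 - θ + γ(p - 2) is positive.

The iteration starts at (p, θ/p), which is the Gagliardo energy itself. Keeping γ = θ/p fixed, the
condition reads (θ/p)(p - 1) ≤ θ, so q can be raised without limit. With q frozen, each further step
may raise γ by (θ - (p - 1))/(q + 1), a positive increment because θ > p - 1, until any prescribed
order below one is reached (`exists_uniformDiffBound`). A Morrey-type embedding through averages
over dyadic balls (`exists_holder_of_diffBound`) converts this into Hölder continuity of every order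
below one.

To make the constants uniform, all of this is done for the class `NormSol` on the unit ball, with a
coefficient c in [0, 1] before the order-1 part. Replacing u by u(a + r y)/M gives c = r^(θ - s₁)
M^(1 - p) ≤ 1, so small balls and large M are harmless (`IsWeakSolution.exists_normSol`). In
`IsWeakSolution.exists_holder_of_bounds` the estimate is applied on balls of radius (R - r)/2, with
M equal to the total size times a negative power of that radius. The power absorbs the losses in
tail and energy and determines κ. The modification of u is `preciseRep u`, defined without reference
to any ball, so one function serves all balls at once. -/

/-! ### Pointwise inequalities for odd powers. -/

/-- The odd power `|t|^m t`. -/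
noncomputable def oddPow (m t : ℝ) : ℝ := |t| ^ m * t

/-- Twice the right-hand side equals (|a|^m + |b|^m)(a - b)² + (|a|^m - |b|^m)(a² - b²), and the
last product is nonnegative because both factors are ordered like |a| and |b|. -/
lemma oddPow_sub_mul_sub_ge {m : ℝ} (hm : 0 ≤ m) (a b : ℝ) :
    (|a| ^ m + |b| ^ m) * (a - b) ^ 2 / 2 ≤ (oddPow m a - oddPow m b) * (a - b) := by
  have key : 0 ≤ (|a| ^ m - |b| ^ m) * (a ^ 2 - b ^ 2) := by
    rcases le_total |a| |b| with h | h
    · have h1 := Real.rpow_le_rpow (abs_nonneg a) h hm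
      have h2 := sq_le_sq.mpr h
      nlinarith
    · have h1 := Real.rpow_le_rpow (abs_nonneg b) h hm
      have h2 := sq_le_sq.mpr h
      nlinarith
  unfold oddPow
  nlinarith

/-- Bernoulli's inequality for y/x with exponent m + 1 is the tangent-line bound for t^(m+1) at x.
The factor x + y makes this work for all m ≥ 0, including m < 1, where t^m is not Lipschitz near
zero. -/
lemma rpow_sub_mul_add_le {m x y : ℝ} (hm : 0 ≤ m) (hy : 0 ≤ y) (hyx : y ≤ x) :
    (x ^ m - y ^ m) * (x + y) ≤ 2 * (m + 1) * x ^ m * (x - y) := by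
  rcases hy.eq_or_lt with rfl | hy0
  · have h0 : (0 : ℝ) ≤ 0 ^ m := Real.rpow_nonneg le_rfl m
    have hx : 0 ≤ x ^ m * x := mul_nonneg (Real.rpow_nonneg hyx m) hyx
    nlinarith [mul_nonneg h0 hyx, mul_nonneg hm hx]
  · have hx : 0 < x := hy0.trans_le hyx
    have hb := one_add_mul_self_le_rpow_one_add (s := y / x - 1) (p := m + 1)
      (by have := div_nonneg hy hx.le; linarith) (by linarith)
    have h1 : (1 : ℝ) + (y / x - 1) = y / x := by ring
    rw [h1, Real.div_rpow hy hx.le, le_div_iff₀ (Real.rpow_pos_of_pos hx _),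
      Real.rpow_add hx, Real.rpow_add hy0, Real.rpow_one, Real.rpow_one] at hb
    have h2 : (1 + (m + 1) * (y / x - 1)) * (x ^ m * x) = x ^ m * (x + (m + 1) * (y - x)) := by
      field_simp
    rw [h2] at hb
    have hxm : 0 ≤ x ^ m := Real.rpow_nonneg hx.le m
    have hym : y ^ m ≤ x ^ m := Real.rpow_le_rpow hy hyx hm
    have hym0 : 0 ≤ y ^ m := Real.rpow_nonneg hy m
    nlinarith [mul_nonneg hym0 (sub_nonneg.2 hyx)]

/-- Split the difference as half of (|a|^m + |b|^m)(a - b) + (|a|^m - |b|^m)(a + b). Only the second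
product needs work, and `rpow_sub_mul_add_le` applied to |a| and |b| bounds it. -/
lemma abs_oddPow_sub_le {m : ℝ} (hm : 0 ≤ m) (a b : ℝ) :
    |oddPow m a - oddPow m b| ≤ (m + 2) * (|a| ^ m + |b| ^ m) * |a - b| := by
  have ha : 0 ≤ |a| ^ m := Real.rpow_nonneg (abs_nonneg a) m
  have hb : 0 ≤ |b| ^ m := Real.rpow_nonneg (abs_nonneg b) m
  have key : |(|a| ^ m - |b| ^ m) * (a + b)| ≤ 2 * (m + 1) * (|a| ^ m + |b| ^ m) * |a - b| := by
    rw [abs_mul]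
    have hs := abs_add_le a b
    rcases le_total |a| |b| with h | h
    · have h1 := Real.rpow_le_rpow (abs_nonneg a) h hm
      have h2 := rpow_sub_mul_add_le hm (abs_nonneg a) h
      have h3 : |b| - |a| ≤ |a - b| := by rw [abs_sub_comm]; exact abs_sub_abs_le_abs_sub b a
      rw [abs_of_nonpos (by linarith : |a| ^ m - |b| ^ m ≤ 0)]
      calc -(|a| ^ m - |b| ^ m) * |a + b| ≤ (|b| ^ m - |a| ^ m) * (|b| + |a|) := by
            nlinarith
        _ ≤ 2 * (m + 1) * |b| ^ m * (|b| - |a|) := h2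
        _ ≤ 2 * (m + 1) * (|a| ^ m + |b| ^ m) * |a - b| := by
            gcongr
            linarith
    · have h1 := Real.rpow_le_rpow (abs_nonneg b) h hm
      have h2 := rpow_sub_mul_add_le hm (abs_nonneg b) h
      have h3 : |a| - |b| ≤ |a - b| := abs_sub_abs_le_abs_sub a b
      rw [abs_of_nonneg (by linarith : 0 ≤ |a| ^ m - |b| ^ m)]
      calc (|a| ^ m - |b| ^ m) * |a + b| ≤ (|a| ^ m - |b| ^ m) * (|a| + |b|) := by
            nlinarith
        _ ≤ 2 * (m + 1) * |a| ^ m * (|a| - |b|) := h2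
        _ ≤ 2 * (m + 1) * (|a| ^ m + |b| ^ m) * |a - b| := by
            gcongr
            linarith
  have e : oddPow m a - oddPow m b =
      ((|a| ^ m + |b| ^ m) * (a - b) + (|a| ^ m - |b| ^ m) * (a + b)) / 2 := by
    unfold oddPow; ring
  rw [e, abs_div, abs_two]
  have h4 := abs_add_le ((|a| ^ m + |b| ^ m) * (a - b)) ((|a| ^ m - |b| ^ m) * (a + b))
  rw [abs_mul, abs_of_nonneg (add_nonneg ha hb)] at h4
  have h5 : 0 ≤ (|a| ^ m + |b| ^ m) * |a - b| := by positivity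
  linarith

lemma abs_oddPow {m : ℝ} (hm : 0 ≤ m) (t : ℝ) : |oddPow m t| = |t| ^ (m + 1) := by
  unfold oddPow
  rw [abs_mul, abs_of_nonneg (Real.rpow_nonneg (abs_nonneg t) m),
    Real.rpow_add_of_nonneg (abs_nonneg t) hm zero_le_one, Real.rpow_one]

lemma oddPow_monotone {m : ℝ} (hm : 0 ≤ m) : Monotone (oddPow m) := by
  intro a b hab
  have h := oddPow_sub_mul_sub_ge hm b a
  rcases hab.eq_or_lt with rfl | hab
  · exact le_rfl
  · have h0 : 0 ≤ (oddPow m b - oddPow m a) * (b - a) := le_trans (by positivity) h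
    have := nonneg_of_mul_nonneg_left h0 (sub_pos.2 hab)
    linarith

lemma abs_sub_rpow_le {m : ℝ} (hm : 0 ≤ m) (a b : ℝ) :
    |a - b| ^ m ≤ 2 ^ m * (|a| ^ m + |b| ^ m) := by
  have h1 : |a - b| ≤ 2 * max |a| |b| := by
    have := abs_sub a b
    have := le_max_left |a| |b|
    have := le_max_right |a| |b|
    linarith
  have ha : 0 ≤ |a| ^ m := Real.rpow_nonneg (abs_nonneg a) m
  have hb : 0 ≤ |b| ^ m := Real.rpow_nonneg (abs_nonneg b) m
  calc |a - b| ^ m ≤ (2 * max |a| |b|) ^ m := Real.rpow_le_rpow (abs_nonneg _) h1 hm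
    _ = 2 ^ m * (max |a| |b|) ^ m := Real.mul_rpow (by norm_num) (le_max_of_le_left (abs_nonneg a))
    _ ≤ 2 ^ m * (|a| ^ m + |b| ^ m) := by
        gcongr
        rcases max_choice |a| |b| with h | h <;> rw [h] <;> linarith

lemma abs_add_rpow_le {m : ℝ} (hm : 0 ≤ m) (a b : ℝ) :
    |a + b| ^ m ≤ 2 ^ m * (|a| ^ m + |b| ^ m) := by
  simpa using abs_sub_rpow_le hm a (-b)

/-- Lower bound for the monotone operator tested with a localised odd power. -/
lemma monotone_energy_lower {m n : ℝ} (hm : 0 ≤ m) (hn : 0 ≤ n) :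
    ∃ c C : ℝ, 0 < c ∧ 0 ≤ C ∧ ∀ a b A B s t : ℝ, a - b = A - B → 0 ≤ s → 0 ≤ t →
      c * |a - b| ^ (m + n + 2) * (s ^ 2 + t ^ 2) -
        C * (|a| ^ m + |b| ^ m) * (|A| ^ (n + 2) + |B| ^ (n + 2)) * (s - t) ^ 2 ≤
      (oddPow m a - oddPow m b) * (oddPow n A * s ^ 2 - oddPow n B * t ^ 2) := by
  -- The monotone term supplies W G D² (s² + t²)/8. Young's inequality spends at most half of it on
  -- the cross term, and the remaining sixteenth dominates D^(m+n+2) up to the factors 2^m and 2^n.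
  refine ⟨1 / (16 * 2 ^ m * 2 ^ n), 4 * (m + 2) ^ 2, by positivity, by positivity, ?_⟩
  intro a b A B s t hab hs ht
  set W := |a| ^ m + |b| ^ m with hW
  set G := |A| ^ n + |B| ^ n with hG
  set D := |a - b| with hD
  set H := |A| ^ (n + 2) + |B| ^ (n + 2) with hH
  set S := |A| ^ (n + 1) + |B| ^ (n + 1) with hS
  have hD0 : 0 ≤ D := abs_nonneg _
  have hW0 : 0 ≤ W := by positivity
  have hG0 : 0 ≤ G := by positivity
  have hH0 : 0 ≤ H := by positivity
  have hS0 : 0 ≤ S := by positivity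
  have hD2 : D ^ 2 = (a - b) ^ 2 := sq_abs _
  have hDAB : D = |A - B| := by rw [hD, hab]
  -- The exponent n + 1 is the mean of n and n + 2, so this is a Cauchy-Schwarz inequality; it lets
  -- Young's inequality pair G with the good term and H with the error.
  have hSq : S ^ 2 ≤ 2 * (G * H) := by
    have e : ∀ x : ℝ, 0 ≤ x → (x ^ (n + 1)) ^ 2 = x ^ n * x ^ (n + 2) := by
      intro x hx
      rw [← Real.rpow_natCast, ← Real.rpow_mul hx, ← Real.rpow_add_of_nonneg hx hn (by linarith)]
      congr 1; push_cast; ring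
    have e1 := e _ (abs_nonneg A)
    have e2 := e _ (abs_nonneg B)
    have p1 : 0 ≤ |A| ^ n * |B| ^ (n + 2) := by positivity
    have p2 : 0 ≤ |B| ^ n * |A| ^ (n + 2) := by positivity
    rw [hS, hG, hH]
    nlinarith [sq_nonneg (|A| ^ (n + 1) - |B| ^ (n + 1))]
  have hWD : D ^ (m + n + 2) ≤ 2 ^ m * 2 ^ n * (W * G * D ^ 2) := by
    rw [Real.rpow_add_of_nonneg hD0 (by linarith) (by norm_num),
      Real.rpow_add_of_nonneg hD0 hm hn]
    have i1 : D ^ m ≤ 2 ^ m * W := abs_sub_rpow_le hm a b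
    have i2 : D ^ n ≤ 2 ^ n * G := by rw [hDAB]; exact abs_sub_rpow_le hn A B
    have : D ^ (2 : ℝ) = D ^ 2 := Real.rpow_two D
    rw [this]
    calc D ^ m * D ^ n * D ^ 2 ≤ (2 ^ m * W) * (2 ^ n * G) * D ^ 2 := by gcongr
      _ = _ := by ring
  have hJ := oddPow_sub_mul_sub_ge hm a b
  have hg := oddPow_sub_mul_sub_ge hn A B
  have hJu := abs_oddPow_sub_le hm a b
  rw [← hab] at hg
  rw [← hW, ← hD2] at hJ
  rw [← hG, ← hD2] at hg
  rw [← hW, ← hD] at hJu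
  set j := oddPow m a - oddPow m b with hj
  set k := oddPow n A - oddPow n B with hk
  -- Since a - b = A - B, the two monotonicity bounds share the factor a - b; multiply them and
  -- cancel D².
  have hjk : W * G * D ^ 2 / 4 ≤ j * k := by
    rcases hD0.eq_or_lt with h0 | h0
    · have hab0 : a = b := by
        have : |a - b| = 0 := h0.symm
        linarith [abs_eq_zero.1 this]
      have : j = 0 := by rw [hj, hab0, sub_self]
      rw [this, ← h0]; simp
    · have hp := mul_le_mul hJ hg (by positivity) (le_trans (by positivity) hJ)
      have e1 : j * (a - b) * (k * (a - b)) = j * k * D ^ 2 := by rw [hD2]; ring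
      have e2 : W * D ^ 2 / 2 * (G * D ^ 2 / 2) = W * G * D ^ 2 / 4 * D ^ 2 := by ring
      rw [e1, e2] at hp
      exact le_of_mul_le_mul_right hp (by positivity)
  have hsum : |oddPow n A + oddPow n B| ≤ S := by
    refine (abs_add_le _ _).trans ?_
    rw [abs_oddPow hn, abs_oddPow hn]
  -- Symmetrisation: the half-sum of the cutoffs multiplies a term with a sign, and the
  -- half-difference carries all the localisation error.
  have hid : j * (oddPow n A * s ^ 2 - oddPow n B * t ^ 2) =
      j * k * ((s ^ 2 + t ^ 2) / 2) + j * (oddPow n A + oddPow n B) * ((s ^ 2 - t ^ 2) / 2) := by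
    rw [hk]; ring
  have hst : |s ^ 2 - t ^ 2| = (s + t) * |s - t| := by
    rw [show s ^ 2 - t ^ 2 = (s + t) * (s - t) by ring, abs_mul, abs_of_nonneg (add_nonneg hs ht)]
  set e := |s - t| with he
  have he0 : 0 ≤ e := abs_nonneg _
  have he2 : e ^ 2 = (s - t) ^ 2 := sq_abs _
  have hcross : |j * (oddPow n A + oddPow n B) * ((s ^ 2 - t ^ 2) / 2)| ≤
      (m + 2) * W * D * S * ((s + t) * e / 2) := by
    rw [abs_mul, abs_mul, abs_div, hst, abs_two]
    gcongr
  have hyoung : (m + 2) * D * S * ((s + t) * e / 2) ≤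
      G * D ^ 2 * (s + t) ^ 2 / 32 + 4 * (m + 2) ^ 2 * H * e ^ 2 := by
    apply abs_le_of_sq_le_sq' _ (by positivity) |>.2
    have : ((m + 2) * D * S * ((s + t) * e / 2)) ^ 2 =
      (m + 2) ^ 2 * D ^ 2 * (s + t) ^ 2 * e ^ 2 / 4 * S ^ 2 := by ring
    rw [this]
    calc (m + 2) ^ 2 * D ^ 2 * (s + t) ^ 2 * e ^ 2 / 4 * S ^ 2
        ≤ (m + 2) ^ 2 * D ^ 2 * (s + t) ^ 2 * e ^ 2 / 4 * (2 * (G * H)) := by gcongr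
      _ = 4 * (G * D ^ 2 * (s + t) ^ 2 / 32) * (4 * (m + 2) ^ 2 * H * e ^ 2) := by ring
      _ ≤ _ := four_mul_le_sq_add _ _
  have hst2 : (s + t) ^ 2 ≤ 2 * (s ^ 2 + t ^ 2) := add_sq_le
  have hlow : 1 / (16 * 2 ^ m * 2 ^ n) * D ^ (m + n + 2) * (s ^ 2 + t ^ 2) ≤
      W * G * D ^ 2 * (s ^ 2 + t ^ 2) / 16 := by
    have : 1 / (16 * 2 ^ m * 2 ^ n) * D ^ (m + n + 2) ≤ W * G * D ^ 2 / 16 := by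
      rw [div_mul_eq_mul_div, one_mul, div_le_div_iff₀ (by positivity) (by norm_num)]
      linarith
    calc _ ≤ W * G * D ^ 2 / 16 * (s ^ 2 + t ^ 2) := by gcongr
      _ = _ := by ring
  have h1 : W * G * D ^ 2 / 4 * ((s ^ 2 + t ^ 2) / 2) ≤ j * k * ((s ^ 2 + t ^ 2) / 2) := by gcongr
  have h2 : W * ((m + 2) * D * S * ((s + t) * e / 2)) ≤
      W * (G * D ^ 2 * (s + t) ^ 2 / 32 + 4 * (m + 2) ^ 2 * H * e ^ 2) := by gcongr
  have h3 : W * G * D ^ 2 * (s + t) ^ 2 ≤ W * G * D ^ 2 * (2 * (s ^ 2 + t ^ 2)) := by gcongr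
  have h4 := (abs_le.1 hcross).1
  rw [hid, ← he2]
  linarith

/-! ### Monotonicity of the set-valued sign. -/

lemma setSign_mono {a b z w : ℝ} (hz : z ∈ setSign a) (hw : w ∈ setSign b) (hab : b < a) :
    w ≤ z := by
  obtain ⟨z1, z2, z3⟩ := hz
  obtain ⟨w1, w2, w3⟩ := hw
  rcases lt_trichotomy a 0 with ha | ha | ha
  · rw [z2 ha, w2 (hab.trans ha)]
  · rw [w2 (ha ▸ hab)]; exact (z3 ha).1
  · rw [z1 ha]
    rcases lt_trichotomy b 0 with hb | hb | hb
    · rw [w2 hb]; norm_num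
    · exact (w3 hb).2
    · rw [w1 hb]

lemma abs_le_one_of_mem_setSign {a z : ℝ} (hz : z ∈ setSign a) : |z| ≤ 1 := by
  obtain ⟨z1, z2, z3⟩ := hz
  rcases lt_trichotomy a 0 with ha | ha | ha
  · rw [z2 ha]; norm_num
  · exact abs_le.2 (z3 ha)
  · rw [z1 ha]; norm_num

/-- Lower bound for the sign part of the operator tested with a localised odd power. -/
lemma sign_energy_lower {n : ℝ} (hn : 0 ≤ n) {a b A B s t z w : ℝ} (hz : z ∈ setSign a)
    (hw : w ∈ setSign b) (hab : a - b = A - B) (hs : 0 ≤ s) (ht : 0 ≤ t) :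
    -((|A| ^ (n + 1) + |B| ^ (n + 1)) * |s - t|) ≤
      (z - w) * (oddPow n A * s - oddPow n B * t) := by
  have hmono : 0 ≤ (z - w) * (oddPow n A - oddPow n B) := by
    rcases lt_trichotomy a b with h | h | h
    · have h1 := setSign_mono hw hz h
      have h2 := oddPow_monotone hn (by linarith : A ≤ B)
      nlinarith
    -- When a = b = 0 the selections z and w may be different points of [-1, 1] in either order, but
    -- then the other factor vanishes.
    · have : A = B := by linarith
      rw [this]; simp
    · have h1 := setSign_mono hz hw h
      have h2 := oddPow_monotone hn (by linarith : B ≤ A)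
      nlinarith
  have hzw : |z - w| ≤ 2 := by
    have := abs_sub z w
    have := abs_le_one_of_mem_setSign hz
    have := abs_le_one_of_mem_setSign hw
    linarith
  have hsum : |oddPow n A + oddPow n B| ≤ |A| ^ (n + 1) + |B| ^ (n + 1) := by
    refine (abs_add_le _ _).trans ?_
    rw [abs_oddPow hn, abs_oddPow hn]
  have hid : (z - w) * (oddPow n A * s - oddPow n B * t) =
      (z - w) * (oddPow n A - oddPow n B) * ((s + t) / 2) +
      (z - w) * (oddPow n A + oddPow n B) * ((s - t) / 2) := by ring
  have hcross : |(z - w) * (oddPow n A + oddPow n B) * ((s - t) / 2)| ≤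
      2 * (|A| ^ (n + 1) + |B| ^ (n + 1)) * (|s - t| / 2) := by
    rw [abs_mul, abs_mul, abs_div, abs_two]
    gcongr
  have h4 := (abs_le.1 hcross).1
  have h5 : 0 ≤ (z - w) * (oddPow n A - oddPow n B) * ((s + t) / 2) := by positivity
  rw [hid]
  linarith

/-! ### Integral inequalities and finite differences. -/

lemma ofReal_abs_rpow {q : ℝ} (hq : 0 ≤ q) (t : ℝ) : ENNReal.ofReal (|t| ^ q) = ‖t‖ₑ ^ q := by
  rw [Real.enorm_eq_ofReal_abs, ENNReal.ofReal_rpow_of_nonneg (abs_nonneg t) hq]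

lemma lintegral_ball_norm_rpow_lt_top {N : ℕ} (hN : 1 ≤ N) {ε : ℝ} (hε : 0 < ε) (R : ℝ) :
    ∫⁻ z in Metric.ball (0 : RSpace N) R, ENNReal.ofReal (‖z‖ ^ (ε - N)) < ⊤ := by
  have h : IntegrableOn (fun z : RSpace N => ‖z‖ ^ (ε - N)) (Metric.ball 0 R) := by
    refine integrableOn_ball_of_norm_le_rpow (C := 1) (α := N - ε) (by simpa using hN)
      (by simpa using hε) (ae_of_all _ fun x => ?_) 
      (Measurable.aestronglyMeasurable (by fun_prop))
    rw [one_mul, neg_sub, Real.norm_of_nonneg (by positivity)]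
  exact h.lintegral_lt_top

/-- The positive and negative parts of Ψ have equal finite integrals. Adding them to the two sides
of the pointwise bound and cancelling avoids any integrability assumption on P or Q, so the energy P
need not be known to be finite beforehand. -/
lemma lintegral_le_of_integral_eq_zero {α : Type*} [MeasurableSpace α] {μ : Measure α}
    {Ψ P Q : α → ℝ} (hΨ : Integrable Ψ μ) (h0 : ∫ x, Ψ x ∂μ = 0)
    (hQ : Measurable Q) (hP0 : ∀ x, 0 ≤ P x) (hQ0 : ∀ x, 0 ≤ Q x)
    (hle : ∀ᵐ x ∂μ, P x - Q x ≤ Ψ x) :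
    ∫⁻ x, ENNReal.ofReal (P x) ∂μ ≤ ∫⁻ x, ENNReal.ofReal (Q x) ∂μ := by
  have e := integral_eq_lintegral_pos_part_sub_lintegral_neg_part hΨ
  rw [h0] at e
  have f1 : ∫⁻ x, ENNReal.ofReal (Ψ x) ∂μ ≠ ⊤ := hΨ.lintegral_lt_top.ne
  have f2 : ∫⁻ x, ENNReal.ofReal (-Ψ x) ∂μ ≠ ⊤ := hΨ.neg.lintegral_lt_top.ne
  have e2 : ∫⁻ x, ENNReal.ofReal (Ψ x) ∂μ = ∫⁻ x, ENNReal.ofReal (-Ψ x) ∂μ :=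
    (ENNReal.toReal_eq_toReal_iff' f1 f2).1 (sub_eq_zero.1 e.symm)
  have h : ∀ᵐ x ∂μ, ENNReal.ofReal (P x) + ENNReal.ofReal (-Ψ x) ≤
      ENNReal.ofReal (Ψ x) + ENNReal.ofReal (Q x) := by
    filter_upwards [hle] with x hx
    rcases le_total 0 (Ψ x) with h | h
    · rw [ENNReal.ofReal_of_nonpos (neg_nonpos.2 h), add_zero, ← ENNReal.ofReal_add h (hQ0 x)]
      exact ENNReal.ofReal_le_ofReal (by linarith)
    · rw [ENNReal.ofReal_of_nonpos h, zero_add, ← ENNReal.ofReal_add (hP0 x) (by linarith)]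
      exact ENNReal.ofReal_le_ofReal (by linarith)
  have h3 := lintegral_mono_ae h
  have hm : AEMeasurable (fun x => ENNReal.ofReal (-Ψ x)) μ :=
    hΨ.aestronglyMeasurable.aemeasurable.neg.ennreal_ofReal
  rw [lintegral_add_right' _ hm,
    lintegral_add_right _ hQ.ennreal_ofReal, e2, add_comm] at h3
  exact (ENNReal.add_le_add_iff_left f2).1 h3

lemma lintegral_comp_add_le {N : ℕ} {A B : Set (RSpace N)} (hA : MeasurableSet A)
    (hB : MeasurableSet B) (k : RSpace N) (hAB : ∀ x ∈ A, x + k ∈ B) (G : RSpace N → ℝ≥0∞) :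
    ∫⁻ x in A, G (x + k) ≤ ∫⁻ x in B, G x := by
  rw [← lintegral_indicator hA, ← lintegral_indicator hB,
    ← lintegral_add_right_eq_self (B.indicator G) k]
  refine lintegral_mono fun x => ?_
  by_cases hx : x ∈ A
  · rw [Set.indicator_of_mem hx, Set.indicator_of_mem (hAB x hx)]
  · rw [Set.indicator_of_notMem hx]; exact zero_le

/-- Finite differences of a function are controlled by its Gagliardo energy. -/
lemma lintegral_translate_sub_le {N : ℕ} {q θ : ℝ} (hq : 0 < q) (hθ : 0 ≤ θ) :
    ∃ C : ℝ, 0 ≤ C ∧ ∀ f : RSpace N → ℝ, Measurable f → ∀ (r r' : ℝ) (k : RSpace N),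
      r' + 2 * ‖k‖ ≤ r →
      ∫⁻ x in Metric.ball 0 r', ‖f (x + k) - f x‖ₑ ^ q ≤ ENNReal.ofReal (C * ‖k‖ ^ θ) *
        ∫⁻ x in Metric.ball 0 r, ∫⁻ y in Metric.ball 0 r,
          ENNReal.ofReal (|f x - f y| ^ q / ‖x - y‖ ^ ((N : ℝ) + θ)) := by
  set ω : ℝ≥0∞ := volume (Metric.ball (0 : RSpace N) 1) with hω
  have hω0 : ω ≠ 0 := (Metric.measure_ball_pos volume 0 one_pos).ne'
  have hωt : ω ≠ ⊤ := measure_ball_lt_top.ne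
  have hωr : 0 < ω.toReal := ENNReal.toReal_pos hω0 hωt
  refine ⟨2 * 2 ^ q * 2 ^ ((N : ℝ) + θ) / ω.toReal, by positivity, ?_⟩
  intro f hf r r' k hk
  set F : RSpace N → RSpace N → ℝ≥0∞ := fun x y =>
    ENNReal.ofReal (|f x - f y| ^ q / ‖x - y‖ ^ ((N : ℝ) + θ)) with hF
  have hFm : Measurable (Function.uncurry F) := by
    simp only [hF, Function.uncurry_def]; fun_prop
  rcases eq_or_ne k 0 with rfl | hk0
  · simp [ENNReal.zero_rpow_of_pos hq]
  set ρ := ‖k‖ with hρ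
  have hρ0 : 0 < ρ := norm_pos_iff.2 hk0
  set I := ∫⁻ x in Metric.ball 0 r, ∫⁻ y in Metric.ball 0 r, F x y with hI
  have hnear : ∀ x z : RSpace N, ‖x - z‖ ≤ 2 * ρ →
      ‖f x - f z‖ₑ ^ q ≤ ENNReal.ofReal ((2 * ρ) ^ ((N : ℝ) + θ)) * F x z := by
    intro x z hxz
    rw [← ofReal_abs_rpow hq.le, hF, ← ENNReal.ofReal_mul (by positivity)]
    apply ENNReal.ofReal_le_ofReal
    rcases eq_or_ne x z with rfl | hne
    · rw [sub_self, abs_zero, Real.zero_rpow hq.ne']; positivity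
    · have h1 : 0 < ‖x - z‖ := norm_pos_iff.2 (sub_ne_zero.2 hne)
      rw [mul_div_assoc', le_div_iff₀ (by positivity), mul_comm ((2 * ρ) ^ _)]
      gcongr
  -- A point z within ρ = |k| of x is within 2ρ of both x and x + k. Comparing through z and
  -- averaging over all such z brings the Gagliardo kernel in; the volume ρ^N then cancels the N in
  -- the kernel exponent and leaves ρ^θ.
  have hpt : ∀ x ∈ Metric.ball (0 : RSpace N) r', ∀ z ∈ Metric.ball x ρ,
      ‖f (x + k) - f x‖ₑ ^ q ≤
        ENNReal.ofReal (2 ^ q * (2 * ρ) ^ ((N : ℝ) + θ)) * (F (x + k) z + F x z) := by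
    intro x hx z hz
    rw [Metric.mem_ball, dist_comm, dist_eq_norm] at hz
    have h1 := hnear x z (by linarith)
    have h2 := hnear (x + k) z (by
      have : x + k - z = (x - z) + k := by abel
      rw [this]; exact (norm_add_le _ _).trans (by linarith))
    have h3 : ‖f (x + k) - f x‖ₑ ^ q ≤
        ENNReal.ofReal (2 ^ q) * (‖f (x + k) - f z‖ₑ ^ q + ‖f x - f z‖ₑ ^ q) := by
      rw [← ofReal_abs_rpow hq.le, ← ofReal_abs_rpow hq.le, ← ofReal_abs_rpow hq.le,
        ← ENNReal.ofReal_add (by positivity) (by positivity), ← ENNReal.ofReal_mul (by positivity)]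
      apply ENNReal.ofReal_le_ofReal
      have := abs_sub_rpow_le hq.le (f (x + k) - f z) (f x - f z)
      simpa using this
    refine h3.trans ?_
    rw [ENNReal.ofReal_mul (by positivity), mul_assoc]
    refine mul_le_mul_right ?_ _
    rw [mul_add]
    exact add_le_add h2 h1
  have hsub : ∀ x ∈ Metric.ball (0 : RSpace N) r', Metric.ball x ρ ⊆ Metric.ball 0 r := by
    intro x hx z hz
    rw [Metric.mem_ball] at hx hz ⊢
    have := dist_triangle z x 0
    linarith
  have hvol : ∀ x : RSpace N, volume (Metric.ball x ρ) = ENNReal.ofReal (ρ ^ N) * ω := by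
    intro x
    rw [Measure.addHaar_ball_of_pos volume x hρ0]; simp [hω]
  have hpt2 : ∀ x ∈ Metric.ball (0 : RSpace N) r',
      (ENNReal.ofReal (ρ ^ N) * ω) * ‖f (x + k) - f x‖ₑ ^ q ≤
        ENNReal.ofReal (2 ^ q * (2 * ρ) ^ ((N : ℝ) + θ)) *
          ((∫⁻ z in Metric.ball 0 r, F (x + k) z) + ∫⁻ z in Metric.ball 0 r, F x z) := by
    intro x hx
    calc (ENNReal.ofReal (ρ ^ N) * ω) * ‖f (x + k) - f x‖ₑ ^ q
        = ∫⁻ _ in Metric.ball x ρ, ‖f (x + k) - f x‖ₑ ^ q := by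
          rw [setLIntegral_const, hvol, mul_comm]
      _ ≤ ∫⁻ z in Metric.ball x ρ, ENNReal.ofReal (2 ^ q * (2 * ρ) ^ ((N : ℝ) + θ)) *
            (F (x + k) z + F x z) := setLIntegral_mono' measurableSet_ball (hpt x hx)
      _ ≤ ∫⁻ z in Metric.ball 0 r, ENNReal.ofReal (2 ^ q * (2 * ρ) ^ ((N : ℝ) + θ)) *
            (F (x + k) z + F x z) := lintegral_mono_set (hsub x hx)
      _ = _ := by
          rw [lintegral_const_mul _ (by fun_prop), lintegral_add_left (by fun_prop)]
  set G : RSpace N → ℝ≥0∞ := fun x => ∫⁻ z in Metric.ball 0 r, F x z with hG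
  have hGm : Measurable G := hFm.lintegral_prod_right'
  have hr' : ∀ x ∈ Metric.ball (0 : RSpace N) r', x + k ∈ Metric.ball (0 : RSpace N) r := by
    intro x hx
    rw [mem_ball_zero_iff] at hx ⊢
    exact (norm_add_le _ _).trans_lt (by linarith)
  have hmain : (ENNReal.ofReal (ρ ^ N) * ω) * ∫⁻ x in Metric.ball 0 r', ‖f (x + k) - f x‖ₑ ^ q ≤
      ENNReal.ofReal (2 ^ q * (2 * ρ) ^ ((N : ℝ) + θ)) * (I + I) := by
    rw [← lintegral_const_mul _ (by fun_prop)]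
    calc _ ≤ ∫⁻ x in Metric.ball 0 r', ENNReal.ofReal (2 ^ q * (2 * ρ) ^ ((N : ℝ) + θ)) *
          (G (x + k) + G x) := setLIntegral_mono' measurableSet_ball hpt2
      _ = ENNReal.ofReal (2 ^ q * (2 * ρ) ^ ((N : ℝ) + θ)) *
          ((∫⁻ x in Metric.ball 0 r', G (x + k)) + ∫⁻ x in Metric.ball 0 r', G x) := by
          rw [lintegral_const_mul _ (by fun_prop), lintegral_add_left (by fun_prop)]
      _ ≤ _ := by
          gcongr
          · exact lintegral_comp_add_le measurableSet_ball measurableSet_ball k hr' G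
          · exact lintegral_mono_set (Metric.ball_subset_ball (by linarith))
  have hρN : ENNReal.ofReal (ρ ^ N) ≠ 0 := by
    rw [Ne, ENNReal.ofReal_eq_zero, not_le]; positivity
  have hc0 : ENNReal.ofReal (ρ ^ N) * ω ≠ 0 := mul_ne_zero hρN hω0
  have hct : ENNReal.ofReal (ρ ^ N) * ω ≠ ⊤ := ENNReal.mul_ne_top ENNReal.ofReal_ne_top hωt
  refine (ENNReal.mul_le_mul_iff_right hc0 hct).1 (hmain.trans_eq ?_)
  rw [← two_mul, ← mul_assoc, ← mul_assoc]
  congr 1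
  have hωe : ω = ENNReal.ofReal ω.toReal := (ENNReal.ofReal_toReal hωt).symm
  have h2 : (2 : ℝ≥0∞) = ENNReal.ofReal 2 := by simp
  rw [hωe, h2, ← ENNReal.ofReal_mul (by positivity), ← ENNReal.ofReal_mul (by positivity),
    ← ENNReal.ofReal_mul (by positivity)]
  rw [ENNReal.toReal_ofReal hωr.le]
  congr 1
  rw [Real.mul_rpow (by norm_num) hρ0.le, Real.rpow_add hρ0, Real.rpow_natCast]
  field_simp

/-- First differences are controlled by second differences for exponents below one. -/
lemma lintegral_sub_le_of_second_difference {N : ℕ} {q γ d A M : ℝ} (hq : 1 ≤ q) (hγ : γ < 1)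
    (hd : 0 < d) (hA : 0 ≤ A) (hM : 0 ≤ M) (hγ0 : 0 ≤ γ) :
    ∃ K : ℝ, 0 ≤ K ∧ ∀ (f : RSpace N → ℝ) (S : Set (RSpace N)), Measurable f →
      (∀ h : RSpace N, ‖h‖ < d →
        ∫⁻ x in S, ‖f (x + h + h) - f (x + h) - (f (x + h) - f x)‖ₑ ^ q ≤
          ENNReal.ofReal (A * ‖h‖ ^ (γ * q))) →
      (∀ h : RSpace N, ‖h‖ < d → ∫⁻ x in S, ‖f (x + h) - f x‖ₑ ^ q ≤ ENNReal.ofReal M) →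
      ∀ h : RSpace N, ‖h‖ < d →
        ∫⁻ x in S, ‖f (x + h) - f x‖ₑ ^ q ≤ ENNReal.ofReal (K * ‖h‖ ^ (γ * q)) := by
  have hq0 : 0 < q := by linarith
  set τ : ℝ := 2 ^ (γ - 1) with hτ
  have hτ1 : τ < 1 := Real.rpow_lt_one_of_one_lt_of_neg (by norm_num) (by linarith)
  have hτ0 : 0 < τ := by positivity
  -- The first entry makes L stable under the recursion L ↦ τ L + A^(1/q)/2, a contraction because γ
  -- < 1; the second covers steps of length at least d/2, where the crude bound M starts the
  -- induction.
  set L : ℝ := max (A ^ (1 / q) / 2 / (1 - τ)) (M ^ (1 / q) / (d / 2) ^ γ) with hL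
  have hL0 : 0 ≤ L := le_max_of_le_right (by positivity)
  have hL1 : τ * L + A ^ (1 / q) / 2 ≤ L := by
    have := (div_le_iff₀ (by linarith)).1 (le_max_left (A ^ (1 / q) / 2 / (1 - τ))
      (M ^ (1 / q) / (d / 2) ^ γ))
    rw [← hL] at this
    linarith
  have hL2 : M ^ (1 / q) ≤ L * (d / 2) ^ γ :=
    (div_le_iff₀ (by positivity)).1 (le_max_right _ _)
  refine ⟨L ^ q, by positivity, ?_⟩
  intro f S hf h2 h1
  -- Here n bounds the number of doublings that bring h to length at least d/2.
  have key : ∀ n : ℕ, ∀ h : RSpace N, ‖h‖ < d → d ≤ 2 ^ (n + 1) * ‖h‖ →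
      (∫⁻ x in S, ‖f (x + h) - f x‖ₑ ^ q) ^ (1 / q) ≤ ENNReal.ofReal (L * ‖h‖ ^ γ) := by
    intro n
    induction n with
    | zero =>
      intro h hh hh2
      have hle : d / 2 ≤ ‖h‖ := by norm_num at hh2; linarith
      calc _ ≤ (ENNReal.ofReal M) ^ (1 / q) := by gcongr; exact h1 h hh
        _ = ENNReal.ofReal (M ^ (1 / q)) := ENNReal.ofReal_rpow_of_nonneg hM (by positivity)
        _ ≤ _ := by
          apply ENNReal.ofReal_le_ofReal
          refine hL2.trans ?_
          gcongr
    | succ n ih =>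
      intro h hh hh2
      rcases le_or_gt d (2 * ‖h‖) with hc | hc
      · have hle : d / 2 ≤ ‖h‖ := by linarith
        calc _ ≤ (ENNReal.ofReal M) ^ (1 / q) := by gcongr; exact h1 h hh
          _ = ENNReal.ofReal (M ^ (1 / q)) := ENNReal.ofReal_rpow_of_nonneg hM (by positivity)
          _ ≤ _ := by
            apply ENNReal.ofReal_le_ofReal
            refine hL2.trans ?_
            gcongr
      · have hn : ‖h + h‖ = 2 * ‖h‖ := by
          rw [← two_smul ℝ h, norm_smul]; norm_num
        have ih' := ih (h + h) (by rw [hn]; exact hc) (by rw [hn]; rw [pow_succ] at hh2; linarith)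
        have hpt : ∀ x, ‖f (x + h) - f x‖ₑ ≤ (2⁻¹ : ℝ≥0∞) * ‖f (x + (h + h)) - f x‖ₑ +
            2⁻¹ * ‖f (x + h + h) - f (x + h) - (f (x + h) - f x)‖ₑ := by
          intro x
          have h2e : (2⁻¹ : ℝ≥0∞) = ‖(2⁻¹ : ℝ)‖ₑ := by
            rw [Real.enorm_eq_ofReal (by norm_num), ENNReal.ofReal_inv_of_pos (by norm_num)]; simp
          rw [h2e, ← enorm_mul, ← enorm_mul]
          -- The first difference with step h is half the one with step 2h minus half the second
          -- difference. The factor 1/2 against |2h|^γ leaves τ = 2^(γ - 1).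
          have : f (x + h) - f x = 2⁻¹ * (f (x + (h + h)) - f x) -
            2⁻¹ * (f (x + h + h) - f (x + h) - (f (x + h) - f x)) := by
            rw [← add_assoc]; ring
          conv_lhs => rw [this]
          exact enorm_sub_le
        have hmul : ∀ g : RSpace N → ℝ, Measurable g →
            (∫⁻ x in S, ((2⁻¹ : ℝ≥0∞) * ‖g x‖ₑ) ^ q) ^ (1 / q) =
              2⁻¹ * (∫⁻ x in S, ‖g x‖ₑ ^ q) ^ (1 / q) := by
          intro g hg
          simp_rw [ENNReal.mul_rpow_of_nonneg _ _ hq0.le]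
          rw [lintegral_const_mul _ (by fun_prop), ENNReal.mul_rpow_of_nonneg _ _ (by positivity),
            ← ENNReal.rpow_mul, mul_one_div_cancel hq0.ne', ENNReal.rpow_one]
        calc (∫⁻ x in S, ‖f (x + h) - f x‖ₑ ^ q) ^ (1 / q)
            ≤ (∫⁻ x in S, ((fun x => (2⁻¹ : ℝ≥0∞) * ‖f (x + (h + h)) - f x‖ₑ) +
                fun x => 2⁻¹ * ‖f (x + h + h) - f (x + h) - (f (x + h) - f x)‖ₑ) x ^ q) ^
                (1 / q) := by
              gcongr with x; exact hpt x
          _ ≤ (∫⁻ x in S, ((2⁻¹ : ℝ≥0∞) * ‖f (x + (h + h)) - f x‖ₑ) ^ q) ^ (1 / q) +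
              (∫⁻ x in S, ((2⁻¹ : ℝ≥0∞) *
                ‖f (x + h + h) - f (x + h) - (f (x + h) - f x)‖ₑ) ^ q) ^ (1 / q) :=
              ENNReal.lintegral_Lp_add_le (by fun_prop) (by fun_prop) hq
          _ = 2⁻¹ * (∫⁻ x in S, ‖f (x + (h + h)) - f x‖ₑ ^ q) ^ (1 / q) +
              2⁻¹ * (∫⁻ x in S, ‖f (x + h + h) - f (x + h) - (f (x + h) - f x)‖ₑ ^ q) ^
                (1 / q) := by
              rw [hmul _ (by fun_prop), hmul _ (by fun_prop)]
          _ ≤ 2⁻¹ * ENNReal.ofReal (L * ‖h + h‖ ^ γ) +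
              2⁻¹ * (ENNReal.ofReal (A * ‖h‖ ^ (γ * q))) ^ (1 / q) := by
              gcongr
              exact h2 h hh
          _ = ENNReal.ofReal ((τ * L + A ^ (1 / q) / 2) * ‖h‖ ^ γ) := by
              have h2e : (2⁻¹ : ℝ≥0∞) = ENNReal.ofReal 2⁻¹ := by
                rw [ENNReal.ofReal_inv_of_pos (by norm_num)]; simp
              rw [ENNReal.ofReal_rpow_of_nonneg (by positivity) (by positivity), h2e,
                ← ENNReal.ofReal_mul (by positivity), ← ENNReal.ofReal_mul (by positivity),
                ← ENNReal.ofReal_add (by positivity) (by positivity), hn]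
              congr 1
              rw [Real.mul_rpow (by norm_num) (norm_nonneg h), Real.mul_rpow hA (by positivity),
                ← Real.rpow_mul (norm_nonneg h), mul_assoc γ, mul_one_div_cancel hq0.ne', mul_one,
                hτ, Real.rpow_sub (by norm_num), Real.rpow_one]
              ring
          _ ≤ _ := by
              apply ENNReal.ofReal_le_ofReal
              gcongr
  intro h hh
  rcases eq_or_ne h 0 with rfl | h0
  · simp [ENNReal.zero_rpow_of_pos hq0]
  · have hpos : 0 < ‖h‖ := norm_pos_iff.2 h0
    obtain ⟨n, hn⟩ := pow_unbounded_of_one_lt (d / ‖h‖) (one_lt_two)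
    rw [div_lt_iff₀ hpos] at hn
    have hk := key n h hh (by rw [pow_succ]; nlinarith)
    have := ENNReal.rpow_le_rpow hk hq0.le
    rw [← ENNReal.rpow_mul, one_div_mul_cancel hq0.ne', ENNReal.rpow_one,
      ENNReal.ofReal_rpow_of_nonneg (by positivity) hq0.le, Real.mul_rpow hL0 (by positivity),
      ← Real.rpow_mul hpos.le] at this
    exact this

/-! ### Averages over balls, the precise representative and Morrey's embedding. -/

lemma lintegral_lintegral_eq_translate {N : ℕ} {F : RSpace N → RSpace N → ℝ≥0∞}
    (hF : Measurable (Function.uncurry F)) :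
    ∫⁻ x, ∫⁻ y, F x y = ∫⁻ z, ∫⁻ x, F x (x + z) := by
  have h1 : ∀ x, ∫⁻ y, F x y = ∫⁻ z, F x (x + z) := fun x =>
    (lintegral_add_left_eq_self (F x) x).symm
  simp_rw [h1]
  refine lintegral_lintegral_swap (Measurable.aemeasurable ?_)
  exact hF.comp (measurable_fst.prodMk (measurable_fst.add measurable_snd))

/-- Bound on the `L^q` norms of all finite differences inside a ball. -/
def DiffBound {N : ℕ} (q γ ρ K : ℝ) (f : RSpace N → ℝ) : Prop :=
  ∀ z : RSpace N, ∫⁻ x in {x | x ∈ Metric.ball (0 : RSpace N) ρ ∧ x + z ∈ Metric.ball 0 ρ},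
    ‖f (x + z) - f x‖ₑ ^ q ≤ ENNReal.ofReal (K * ‖z‖ ^ (γ * q))

lemma measurableSet_inter_translate {N : ℕ} (ρ : ℝ) (z : RSpace N) :
    MeasurableSet {x | x ∈ Metric.ball (0 : RSpace N) ρ ∧ x + z ∈ Metric.ball 0 ρ} :=
  MeasurableSet.inter (s₁ := Metric.ball (0 : RSpace N) ρ)
    (s₂ := (fun x => x + z) ⁻¹' Metric.ball 0 ρ) measurableSet_ball
    (measurableSet_preimage (measurable_add_const z) measurableSet_ball)

/-- Jensen's inequality, obtained from Hölder's inequality against the constant one. -/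
lemma lintegral_rpow_le_of_isProbabilityMeasure {α : Type*} [MeasurableSpace α] {μ : Measure α}
    [IsProbabilityMeasure μ] {g : α → ℝ≥0∞} (hg : AEMeasurable g μ) {q : ℝ} (hq : 1 ≤ q) :
    (∫⁻ x, g x ∂μ) ^ q ≤ ∫⁻ x, g x ^ q ∂μ := by
  have hq0 : 0 < q := by linarith
  have h := ENNReal.lintegral_mul_norm_pow_le (μ := μ) (hg.pow_const q)
    (aemeasurable_const (b := (1 : ℝ≥0∞))) (p := 1 / q) (q := 1 - 1 / q) (by positivity)
    (by rw [sub_nonneg, div_le_one hq0]; exact hq) (by ring)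
  simp only [← ENNReal.rpow_mul, mul_one_div_cancel hq0.ne', ENNReal.rpow_one, ENNReal.one_rpow,
    mul_one, lintegral_const, measure_univ] at h
  have := ENNReal.rpow_le_rpow h hq0.le
  rwa [← ENNReal.rpow_mul, one_div_mul_cancel hq0.ne', ENNReal.rpow_one] at this

lemma enorm_average_sub_rpow_le {N : ℕ} {S : Set (RSpace N)} {f : RSpace N → ℝ}
    (hf : IntegrableOn f S) (hS0 : volume S ≠ 0) (hSt : volume S ≠ ⊤) (c : ℝ) {q : ℝ}
    (hq : 1 ≤ q) :
    ‖(⨍ x in S, f x) - c‖ₑ ^ q ≤ (volume S)⁻¹ * ∫⁻ x in S, ‖f x - c‖ₑ ^ q := by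
  set ν : Measure (RSpace N) := (volume S)⁻¹ • volume.restrict S with hν
  have : IsProbabilityMeasure ν := ⟨by
    rw [hν, Measure.smul_apply, Measure.restrict_apply_univ, smul_eq_mul,
      ENNReal.inv_mul_cancel hS0 hSt]⟩
  have hfν : Integrable f ν := hf.smul_measure (ENNReal.inv_ne_top.2 hS0)
  have e : (⨍ x in S, f x) - c = ∫ x, (f x - c) ∂ν := by
    rw [integral_sub hfν (integrable_const c), setAverage_eq', integral_const]
    simp [hν]
  rw [e]
  calc ‖∫ x, (f x - c) ∂ν‖ₑ ^ q ≤ (∫⁻ x, ‖f x - c‖ₑ ∂ν) ^ q := by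
        gcongr; exact enorm_integral_le_lintegral_enorm _
    _ ≤ ∫⁻ x, ‖f x - c‖ₑ ^ q ∂ν := lintegral_rpow_le_of_isProbabilityMeasure
        (hfν.aestronglyMeasurable.sub aestronglyMeasurable_const).enorm hq
    _ = _ := by rw [hν, lintegral_smul_measure, smul_eq_mul]

/-- The precise representative: the limit of averages over balls of dyadic radii. -/
noncomputable def preciseRep {N : ℕ} (u : RSpace N → ℝ) (x : RSpace N) : ℝ :=
  Filter.limUnder Filter.atTop fun k : ℕ => ⨍ y in Metric.closedBall x ((1 / 2 : ℝ) ^ k), u y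

lemma tendsto_half_pow_nhdsGT :
    Filter.Tendsto (fun k : ℕ => (1 / 2 : ℝ) ^ k) Filter.atTop (nhdsWithin 0 (Set.Ioi 0)) :=
  tendsto_nhdsWithin_iff.2 ⟨tendsto_pow_atTop_nhds_zero_of_lt_one (by norm_num) (by norm_num),
    Filter.Eventually.of_forall fun k => by simp⟩

lemma preciseRep_ae_eq {N : ℕ} {u : RSpace N → ℝ} (hu : LocallyIntegrable u) :
    preciseRep u =ᵐ[volume] u := by
  filter_upwards [IsUnifLocDoublingMeasure.ae_tendsto_average volume hu 1] with x hx
  refine (hx (fun _ : ℕ => x) (fun k => (1 / 2 : ℝ) ^ k) tendsto_half_pow_nhdsGT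
    (Filter.Eventually.of_forall fun k => ?_)).limUnder_eq
  exact Metric.mem_closedBall_self (by positivity)

/-- Averages over small balls see only the almost-everywhere class and converge to the value at a
point of continuity. This glues the local estimates: every local continuous representative is the
restriction of the same global function. -/
lemma preciseRep_eq_of_continuousOn {N : ℕ} {u w : RSpace N → ℝ} {B : Set (RSpace N)}
    (hB : IsOpen B) (huw : u =ᵐ[volume.restrict B] w) (hw : ContinuousOn w B) {x : RSpace N}
    (hx : x ∈ B) : preciseRep u x = w x := by
  apply Filter.Tendsto.limUnder_eq
  rw [Metric.tendsto_atTop]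
  intro ε hε
  have hc : ContinuousAt w x := hw.continuousAt (hB.mem_nhds hx)
  obtain ⟨δ, hδ, hδw⟩ := Metric.continuousAt_iff.1 hc (ε / 2) (by positivity)
  obtain ⟨δ', hδ', hδB⟩ := Metric.isOpen_iff.1 hB x hx
  obtain ⟨n, hn⟩ := exists_pow_lt_of_lt_one (lt_min hδ hδ') (by norm_num : (1 / 2 : ℝ) < 1)
  refine ⟨n, fun k hk => ?_⟩
  set S := Metric.closedBall x ((1 / 2 : ℝ) ^ k) with hS
  have hkn : (1 / 2 : ℝ) ^ k < min δ δ' :=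
    (pow_le_pow_of_le_one (by norm_num) (by norm_num) hk).trans_lt hn
  have hSB : S ⊆ B := fun y hy => hδB (lt_of_le_of_lt hy (hkn.trans_le (min_le_right _ _)))
  have hS0 : volume S ≠ 0 := (Metric.measure_closedBall_pos volume x (by positivity)).ne'
  have hSt : volume S ≠ ⊤ := measure_closedBall_lt_top.ne
  have hSe : (⨍ y in S, u y) = ⨍ y in S, w y :=
    average_congr (ae_restrict_of_ae_restrict_of_subset hSB huw)
  have hint : IntegrableOn w S :=
    (hw.mono hSB).integrableOn_compact (isCompact_closedBall x _)
  have h := enorm_average_sub_rpow_le hint hS0 hSt (w x) le_rfl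
  simp only [ENNReal.rpow_one] at h
  rw [Real.dist_eq, hSe]
  have h2 : ∫⁻ y in S, ‖w y - w x‖ₑ ≤ ENNReal.ofReal (ε / 2) * volume S := by
    rw [← setLIntegral_const]
    refine setLIntegral_mono' measurableSet_closedBall fun y hy => ?_
    rw [Real.enorm_eq_ofReal_abs]
    apply ENNReal.ofReal_le_ofReal
    rw [← Real.dist_eq]
    exact (hδw (lt_of_le_of_lt hy (hkn.trans_le (min_le_left _ _)))).le
  have h3 : ‖(⨍ y in S, w y) - w x‖ₑ ≤ ENNReal.ofReal (ε / 2) := by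
    refine h.trans ?_
    calc _ ≤ (volume S)⁻¹ * (ENNReal.ofReal (ε / 2) * volume S) := by gcongr
      _ = _ := by
        rw [mul_comm, mul_assoc, ENNReal.mul_inv_cancel hS0 hSt, mul_one]
  rw [Real.enorm_eq_ofReal_abs, ENNReal.ofReal_le_ofReal_iff (by positivity)] at h3
  linarith

lemma abs_le_of_enorm_rpow_le {q a t : ℝ} (hq : 0 < q) (ha : 0 ≤ a)
    (h : ‖t‖ₑ ^ q ≤ ENNReal.ofReal (a ^ q)) : |t| ≤ a := by
  rw [← ofReal_abs_rpow hq.le, ENNReal.ofReal_le_ofReal_iff (by positivity)] at h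
  exact (Real.rpow_le_rpow_iff (abs_nonneg t) ha hq).1 h

/-- Averages over comparable nearby balls are close if all finite differences are small. -/
lemma abs_average_sub_average_le {N : ℕ} {q γ ρ K : ℝ} (hq : 1 ≤ q) (hK : 0 ≤ K) (hγ : 0 ≤ γ) :
    ∃ C : ℝ, 0 ≤ C ∧ ∀ f : RSpace N → ℝ, Measurable f → IntegrableOn f (Metric.ball 0 ρ) →
      DiffBound q γ ρ K f → ∀ (x x' : RSpace N) (r r' : ℝ), 0 < r → r / 2 ≤ r' → r' ≤ r →
        ‖x - x'‖ ≤ r → Metric.closedBall x r ⊆ Metric.ball 0 ρ →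
        Metric.closedBall x' r' ⊆ Metric.ball 0 ρ →
        |(⨍ y in Metric.closedBall x r, f y) - ⨍ y in Metric.closedBall x' r', f y| ≤
          C * r ^ (γ - N / q) := by
  have hq0 : 0 < q := by linarith
  set ω : ℝ≥0∞ := volume (Metric.closedBall (0 : RSpace N) 1) with hω
  have hω0 : ω ≠ 0 := (Metric.measure_closedBall_pos volume 0 one_pos).ne'
  have hωt : ω ≠ ⊤ := measure_closedBall_lt_top.ne
  have hωr : 0 < ω.toReal := ENNReal.toReal_pos hω0 hωt
  refine ⟨(ω.toReal⁻¹ * 2 ^ N * 3 ^ N * K * 3 ^ (γ * q)) ^ (1 / q), by positivity, ?_⟩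
  intro f hf hfi hD x x' r r' hr hr1 hr2 hxx hB hB'
  set B := Metric.closedBall x r with hBdef
  set B' := Metric.closedBall x' r' with hBdef'
  have hr'0 : 0 < r' := by linarith
  have hvol : ∀ (y : RSpace N) (s : ℝ), 0 < s →
      volume (Metric.closedBall y s) = ENNReal.ofReal (s ^ N) * ω := by
    intro y s hs
    rw [Measure.addHaar_closedBall' volume y hs.le]; simp [hω]
  have hB0 : volume B ≠ 0 := (Metric.measure_closedBall_pos volume x hr).ne'
  have hBt : volume B ≠ ⊤ := measure_closedBall_lt_top.ne
  have hB0' : volume B' ≠ 0 := (Metric.measure_closedBall_pos volume x' hr'0).ne'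
  have hBt' : volume B' ≠ ⊤ := measure_closedBall_lt_top.ne
  -- Sort the pairs by their difference z = b - a, which has length at most 3r, and apply the
  -- difference bound on each slice. After division by |B| |B'| the size is r^(γq - N), whose q-th
  -- root is the claimed power.
  have hdouble : ∫⁻ a in B, ∫⁻ b in B', ‖f b - f a‖ₑ ^ q ≤
      ENNReal.ofReal (K * (3 * r) ^ (γ * q)) * volume (Metric.closedBall (0 : RSpace N) (3 * r)) := by
    set F : RSpace N → RSpace N → ℝ≥0∞ := fun a b =>
      (B ×ˢ B').indicator (fun p : RSpace N × RSpace N => ‖f p.2 - f p.1‖ₑ ^ q) (a, b) with hF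
    have hFm : Measurable (Function.uncurry F) := by
      have : Function.uncurry F =
          (B ×ˢ B').indicator (fun p : RSpace N × RSpace N => ‖f p.2 - f p.1‖ₑ ^ q) := by
        ext p; rfl
      rw [this]
      exact Measurable.indicator (by fun_prop)
        (measurableSet_closedBall.prod measurableSet_closedBall)
    have e1 : ∫⁻ a in B, ∫⁻ b in B', ‖f b - f a‖ₑ ^ q = ∫⁻ a, ∫⁻ b, F a b := by
      rw [← lintegral_indicator measurableSet_closedBall]
      congr 1; ext a
      by_cases ha : a ∈ B
      · rw [Set.indicator_of_mem ha, ← lintegral_indicator measurableSet_closedBall]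
        congr 1; ext b
        by_cases hb : b ∈ B'
        · rw [Set.indicator_of_mem hb, hF]; simp [ha, hb]
        · rw [Set.indicator_of_notMem hb, hF]; simp [hb]
      · rw [Set.indicator_of_notMem ha, hF]; simp [ha]
    rw [e1, lintegral_lintegral_eq_translate hFm, ← setLIntegral_const,
      ← lintegral_indicator measurableSet_closedBall]
    refine lintegral_mono fun z => ?_
    by_cases hz : z ∈ Metric.closedBall (0 : RSpace N) (3 * r)
    · rw [Set.indicator_of_mem hz]
      rw [mem_closedBall_zero_iff] at hz
      calc ∫⁻ a, F a (a + z) ≤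
            ∫⁻ a in {x | x ∈ Metric.ball (0 : RSpace N) ρ ∧ x + z ∈ Metric.ball 0 ρ},
              ‖f (a + z) - f a‖ₑ ^ q := by
            rw [← lintegral_indicator (measurableSet_inter_translate ρ z)]
            refine lintegral_mono fun a => ?_
            by_cases h : a ∈ B ∧ a + z ∈ B'
            · rw [Set.indicator_of_mem (show a ∈ {x | x ∈ Metric.ball (0 : RSpace N) ρ ∧
                x + z ∈ Metric.ball 0 ρ} from ⟨hB h.1, hB' h.2⟩), hF]
              simp [h]
            · rw [hF]; simp [h]
        _ ≤ ENNReal.ofReal (K * ‖z‖ ^ (γ * q)) := hD z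
        _ ≤ _ := by
            apply ENNReal.ofReal_le_ofReal
            gcongr
    · rw [Set.indicator_of_notMem hz, nonpos_iff_eq_zero]
      have : ∀ a, F a (a + z) = 0 := by
        intro a
        rw [hF]
        refine Set.indicator_of_notMem (fun h => hz ?_) _
        obtain ⟨h1, h2⟩ := h
        simp only [hBdef, hBdef', Metric.mem_closedBall, dist_eq_norm] at h1 h2
        rw [mem_closedBall_zero_iff]
        have : z = (a + z - x') - (a - x) - (x - x') := by abel
        rw [this]
        have n1 := norm_sub_le (a + z - x' - (a - x)) (x - x')
        have n2 := norm_sub_le (a + z - x') (a - x)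
        linarith
      simp [this]
  have hfB : IntegrableOn f B := hfi.mono_set hB
  have hfB' : IntegrableOn f B' := hfi.mono_set hB'
  have hmain : ‖(⨍ y in B, f y) - ⨍ y in B', f y‖ₑ ^ q ≤ (volume B)⁻¹ * ((volume B')⁻¹ *
      (ENNReal.ofReal (K * (3 * r) ^ (γ * q)) *
        volume (Metric.closedBall (0 : RSpace N) (3 * r)))) := by
    refine (enorm_average_sub_rpow_le hfB hB0 hBt _ hq).trans ?_
    refine mul_le_mul_right ?_ _
    calc ∫⁻ a in B, ‖f a - ⨍ y in B', f y‖ₑ ^ q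
        ≤ ∫⁻ a in B, (volume B')⁻¹ * ∫⁻ b in B', ‖f b - f a‖ₑ ^ q := by
          refine lintegral_mono fun a => ?_
          have := enorm_average_sub_rpow_le hfB' hB0' hBt' (f a) hq
          rwa [enorm_sub_rev] at this
      _ = (volume B')⁻¹ * ∫⁻ a in B, ∫⁻ b in B', ‖f b - f a‖ₑ ^ q := by
          rw [lintegral_const_mul' _ _ (ENNReal.inv_ne_top.2 hB0')]
      _ ≤ _ := by gcongr
  refine abs_le_of_enorm_rpow_le hq0 (by positivity) (hmain.trans ?_)
  have hωe : ω = ENNReal.ofReal ω.toReal := (ENNReal.ofReal_toReal hωt).symm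
  rw [hBdef, hBdef', hvol x r hr, hvol x' r' hr'0, hvol 0 (3 * r) (by positivity), hωe,
    ← ENNReal.ofReal_mul (by positivity), ← ENNReal.ofReal_mul (by positivity),
    ← ENNReal.ofReal_mul (by positivity), ← ENNReal.ofReal_inv_of_pos (by positivity),
    ← ENNReal.ofReal_inv_of_pos (by positivity), ← ENNReal.ofReal_mul (by positivity),
    ← ENNReal.ofReal_mul (by positivity), ← ENNReal.ofReal_mul (by positivity)]
  apply ENNReal.ofReal_le_ofReal
  have hrpow : (r ^ (γ - N / q)) ^ q = r ^ (γ * q) / r ^ N := by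
    rw [← Real.rpow_mul hr.le, sub_mul, div_mul_cancel₀ _ hq0.ne', Real.rpow_sub hr,
      Real.rpow_natCast]
  rw [ENNReal.toReal_ofReal hωr.le, Real.mul_rpow (x := (_ : ℝ) ^ (1 / q)) (by positivity) (by positivity),
    ← Real.rpow_mul (by positivity), one_div_mul_cancel hq0.ne', Real.rpow_one, hrpow,
    Real.mul_rpow (by norm_num) hr.le]
  have h1 : (r' ^ N)⁻¹ ≤ 2 ^ N * (r ^ N)⁻¹ := by
    have : (r / 2) ^ N ≤ r' ^ N := by gcongr
    rw [div_pow] at this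
    calc (r' ^ N)⁻¹ ≤ (r ^ N / 2 ^ N)⁻¹ := by gcongr
      _ = _ := by rw [inv_div]; ring
  set t := ω.toReal
  calc (r ^ N * t)⁻¹ * ((r' ^ N * t)⁻¹ * (K * (3 ^ (γ * q) * r ^ (γ * q)) * ((3 * r) ^ N * t)))
      = (r ^ N)⁻¹ * t⁻¹ * (r' ^ N)⁻¹ * (K * (3 ^ (γ * q) * r ^ (γ * q)) * (3 ^ N * r ^ N)) := by
        rw [mul_pow]; field_simp
    _ ≤ (r ^ N)⁻¹ * t⁻¹ * (2 ^ N * (r ^ N)⁻¹) *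
          (K * (3 ^ (γ * q) * r ^ (γ * q)) * (3 ^ N * r ^ N)) := by gcongr
    _ = _ := by field_simp

/-- Morrey's embedding for functions with small finite differences. -/
lemma exists_holder_of_diffBound {N : ℕ} {q γ K : ℝ} (hq : 1 ≤ q) (hK : 0 ≤ K)
    (hα : 0 < γ - N / q) :
    ∃ C : ℝ, 0 ≤ C ∧ ∀ f : RSpace N → ℝ, Measurable f →
      (∀ x ∈ Metric.ball (0 : RSpace N) 1, |f x| ≤ 1) → DiffBound q γ (3 / 4) K f →
      ∃ w : RSpace N → ℝ, w =ᵐ[volume.restrict (Metric.ball 0 (1 / 2))] f ∧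
        ∀ x ∈ Metric.ball (0 : RSpace N) (1 / 2), ∀ y ∈ Metric.ball (0 : RSpace N) (1 / 2),
          |w x - w y| ≤ C * ‖x - y‖ ^ (γ - N / q) := by
  have hγ : 0 ≤ γ := by
    have : 0 ≤ (N : ℝ) / q := by positivity
    linarith
  obtain ⟨C, hC, hav⟩ := abs_average_sub_average_le (N := N) (ρ := 3 / 4) hq hK hγ
  set α := γ - N / q with hαdef
  set τ : ℝ := (1 / 2) ^ α with hτ
  have hτ0 : 0 < τ := by positivity
  have hτ1 : τ < 1 := Real.rpow_lt_one (by norm_num) (by norm_num) hα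
  have hτk : ∀ k : ℕ, ((1 / 2 : ℝ) ^ k) ^ α = τ ^ k := by
    intro k
    rw [hτ, ← Real.rpow_natCast, ← Real.rpow_mul (by norm_num), mul_comm, Real.rpow_mul (by norm_num),
      Real.rpow_natCast]
  set L := C / (1 - τ) with hL
  have hL0 : 0 ≤ L := div_nonneg hC (by linarith)
  -- The first constant serves pairs at distance at most 1/8, by telescoping over dyadic scales; the
  -- second serves distant pairs, by the sup bound.
  refine ⟨max ((2 * L + C) / τ) ((2 * L + 2) / (1 / 8) ^ α), le_max_of_le_right (by positivity), ?_⟩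
  intro f hf hf1 hD
  have hfi1 : IntegrableOn f (Metric.ball 0 1) := by
    refine Measure.integrableOn_of_bounded (M := 1) measure_ball_lt_top.ne
      hf.aestronglyMeasurable ?_
    filter_upwards [ae_restrict_mem measurableSet_ball] with x hx
    rw [Real.norm_eq_abs]; exact hf1 x hx
  have hfi : IntegrableOn f (Metric.ball 0 (3 / 4)) :=
    hfi1.mono_set (Metric.ball_subset_ball (by norm_num))
  -- Truncation makes the function locally integrable on the whole space, as Lebesgue
  -- differentiation is stated globally, without changing the averages used below.
  set g : RSpace N → ℝ := (Metric.ball (0 : RSpace N) 1).indicator f with hg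
  have hgi : LocallyIntegrable g :=
    ((integrable_indicator_iff measurableSet_ball).2 hfi1).locallyIntegrable
  set a : ℕ → RSpace N → ℝ := fun k x => ⨍ y in Metric.closedBall x ((1 / 2 : ℝ) ^ k), f y with ha
  -- Scales start at k = 3 because 1/2 + 1/8 < 3/4.
  have hsub : ∀ x ∈ Metric.ball (0 : RSpace N) (1 / 2), ∀ k : ℕ, 3 ≤ k →
      Metric.closedBall x ((1 / 2 : ℝ) ^ k) ⊆ Metric.ball 0 (3 / 4) := by
    intro x hx k hk y hy
    rw [Metric.mem_ball] at hx ⊢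
    rw [Metric.mem_closedBall] at hy
    have h1 := dist_triangle y x 0
    have h2 : (1 / 2 : ℝ) ^ k ≤ (1 / 2) ^ 3 := pow_le_pow_of_le_one (by norm_num) (by norm_num) hk
    norm_num at h2
    linarith
  have hstep : ∀ x ∈ Metric.ball (0 : RSpace N) (1 / 2), ∀ k : ℕ, 3 ≤ k →
      |a k x - a (k + 1) x| ≤ C * τ ^ k := by
    intro x hx k hk
    rw [← hτk]
    refine hav f hf hfi hD x x _ _ (by positivity) ?_ ?_ (by simp) (hsub x hx k hk)
      (hsub x hx (k + 1) (by omega))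
    · rw [pow_succ]; linarith
    · exact pow_le_pow_of_le_one (by norm_num) (by norm_num) (by omega)
  have hag : ∀ x ∈ Metric.ball (0 : RSpace N) (1 / 2), ∀ k : ℕ, 3 ≤ k →
      (⨍ y in Metric.closedBall x ((1 / 2 : ℝ) ^ k), g y) = a k x := by
    intro x hx k hk
    refine setAverage_congr_fun measurableSet_closedBall (ae_of_all _ fun y hy => ?_)
    exact Set.indicator_of_mem (Metric.ball_subset_ball (by norm_num) (hsub x hx k hk hy)) f
  have hdist : ∀ x ∈ Metric.ball (0 : RSpace N) (1 / 2), ∀ k : ℕ, 3 ≤ k → ∀ n,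
      dist (a (k + n) x) (a (k + (n + 1)) x) ≤ C * τ ^ k * τ ^ n := by
    intro x hx k hk n
    rw [Real.dist_eq]
    have h1 := hstep x hx (k + n) (by omega)
    rwa [pow_add, ← mul_assoc] at h1
  have hlim : ∀ x ∈ Metric.ball (0 : RSpace N) (1 / 2), ∀ k : ℕ, 3 ≤ k →
      |a k x - preciseRep g x| ≤ L * τ ^ k := by
    intro x hx k hk
    have hc := cauchySeq_of_le_geometric τ _ hτ1 (hdist x hx 3 le_rfl)
    obtain ⟨l, hl⟩ := cauchySeq_tendsto_of_complete hc
    have hl' : Filter.Tendsto (fun n => a n x) Filter.atTop (nhds l) := by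
      rw [← Filter.tendsto_add_atTop_iff_nat 3]
      simpa [add_comm] using hl
    have hrep : preciseRep g x = l := by
      refine Filter.Tendsto.limUnder_eq (hl'.congr' ?_)
      filter_upwards [Filter.eventually_ge_atTop 3] with n hn using (hag x hx n hn).symm
    have h4 := dist_le_of_le_geometric_of_tendsto₀ τ (C * τ ^ k) hτ1 (hdist x hx k hk) (a := l) (by
      have := (Filter.tendsto_add_atTop_iff_nat (f := fun n => a n x) k).2 hl'
      simpa [add_comm] using this)
    rw [hrep]
    rw [Real.dist_eq] at h4
    calc _ ≤ _ := h4
      _ = _ := by rw [hL]; ring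
  refine ⟨preciseRep g, ?_, ?_⟩
  · have h1 := ae_restrict_of_ae (s := Metric.ball (0 : RSpace N) (1 / 2)) (preciseRep_ae_eq hgi)
    filter_upwards [h1, ae_restrict_mem measurableSet_ball] with x hx hxb
    rw [hx]
    exact Set.indicator_of_mem (Metric.ball_subset_ball (by norm_num) hxb) f
  · intro x hx y hy
    rcases eq_or_ne x y with rfl | hxy
    · rw [sub_self, abs_zero]
      exact mul_nonneg (le_max_of_le_right (by positivity)) (by positivity)
    have hpos : 0 < ‖x - y‖ := norm_pos_iff.2 (sub_ne_zero.2 hxy)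
    rcases le_or_gt ‖x - y‖ (1 / 8) with hs | hs
    -- Choose the dyadic scale comparable with |x - y|: the averages at x and y on that scale are
    -- close, and each is close to its own limit.
    · obtain ⟨k, hk1, hk2⟩ := exists_nat_pow_near_of_lt_one hpos (by linarith)
        (by norm_num : (0 : ℝ) < 1 / 2) (by norm_num)
      have hk : 3 ≤ k := by
        by_contra hlt
        have : (1 / 2 : ℝ) ^ 3 ≤ (1 / 2) ^ (k + 1) :=
          pow_le_pow_of_le_one (by norm_num) (by norm_num) (by omega)
        norm_num at this hs hk1
        linarith
      have h1 := hlim x hx k hk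
      have h2 := hlim y hy k hk
      have h3 : |a k x - a k y| ≤ C * τ ^ k := by
        rw [← hτk]
        exact hav f hf hfi hD x y _ _ (by positivity) (by
          have : (0 : ℝ) < (1 / 2) ^ k := by positivity
          linarith) le_rfl hk2 (hsub x hx k hk) (hsub y hy k hk)
      have h4 : τ ^ k ≤ ‖x - y‖ ^ α / τ := by
        rw [le_div_iff₀ hτ0, ← pow_succ, ← hτk]
        exact Real.rpow_le_rpow (by positivity) hk1.le hα.le
      have h5 : |preciseRep g x - preciseRep g y| ≤ (2 * L + C) * τ ^ k := by
        have e : preciseRep g x - preciseRep g y = -(a k x - preciseRep g x) + (a k x - a k y) +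
          (a k y - preciseRep g y) := by ring
        rw [e]
        refine (abs_add_three _ _ _).trans ?_
        rw [abs_neg]
        linarith
      calc _ ≤ (2 * L + C) * τ ^ k := h5
        _ ≤ (2 * L + C) * (‖x - y‖ ^ α / τ) := by gcongr
        _ = (2 * L + C) / τ * ‖x - y‖ ^ α := by ring
        _ ≤ _ := by gcongr; exact le_max_left _ _
    · have hb : ∀ x ∈ Metric.ball (0 : RSpace N) (1 / 2), |preciseRep g x| ≤ L + 1 := by
        intro x hx
        have h1 := hlim x hx 3 le_rfl
        have h2 : |a 3 x| ≤ 1 := by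
          have hS0 : volume (Metric.closedBall x ((1 / 2 : ℝ) ^ 3)) ≠ 0 :=
            (Metric.measure_closedBall_pos volume x (by positivity)).ne'
          have hSt : volume (Metric.closedBall x ((1 / 2 : ℝ) ^ 3)) ≠ ⊤ :=
            measure_closedBall_lt_top.ne
          have h := enorm_average_sub_rpow_le (hfi.mono_set (hsub x hx 3 le_rfl)) hS0 hSt 0 le_rfl
          simp only [ENNReal.rpow_one, sub_zero] at h
          have h' : ∫⁻ y in Metric.closedBall x ((1 / 2 : ℝ) ^ 3), ‖f y‖ₑ ≤
              1 * volume (Metric.closedBall x ((1 / 2 : ℝ) ^ 3)) := by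
            rw [← setLIntegral_const]
            refine setLIntegral_mono' measurableSet_closedBall fun y hy => ?_
            rw [Real.enorm_eq_ofReal_abs, ENNReal.ofReal_le_one]
            exact hf1 y (Metric.ball_subset_ball (by norm_num) (hsub x hx 3 le_rfl hy))
          have h'' : ‖a 3 x‖ₑ ≤ 1 := by
            refine h.trans ?_
            calc _ ≤ (volume (Metric.closedBall x ((1 / 2 : ℝ) ^ 3)))⁻¹ *
                (1 * volume (Metric.closedBall x ((1 / 2 : ℝ) ^ 3))) := by gcongr
              _ = 1 := by rw [one_mul, ENNReal.inv_mul_cancel hS0 hSt]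
          rwa [Real.enorm_eq_ofReal_abs, ENNReal.ofReal_le_one] at h''
        have h3 : τ ^ 3 ≤ 1 := pow_le_one₀ hτ0.le hτ1.le
        have e : preciseRep g x = a 3 x - (a 3 x - preciseRep g x) := by ring
        rw [e]
        refine (abs_sub _ _).trans ?_
        nlinarith
      have h1 := hb x hx
      have h2 := hb y hy
      have h3 : (1 / 8 : ℝ) ^ α ≤ ‖x - y‖ ^ α := Real.rpow_le_rpow (by norm_num) hs.le hα.le
      calc |preciseRep g x - preciseRep g y| ≤ 2 * L + 2 := by
            refine (abs_sub _ _).trans ?_; linarith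
        _ = (2 * L + 2) / (1 / 8) ^ α * (1 / 8) ^ α := by field_simp
        _ ≤ (2 * L + 2) / (1 / 8) ^ α * ‖x - y‖ ^ α := by gcongr
        _ ≤ _ := by gcongr; exact le_max_right _ _

/-! ### Normalised solutions, their test functions, and far interactions. -/

/-- Bounded test functions of finite energy supported inside the open unit ball. -/
structure BallTest {N : ℕ} (s₁ θ p : ℝ) (φ : RSpace N → ℝ) : Prop where
  measurable : Measurable φ
  bounded : ∃ B : ℝ, ∀ x, |φ x| ≤ B
  support : ∃ r : ℝ, 0 < r ∧ r < 1 ∧ ∀ x, r ≤ ‖x‖ → φ x = 0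
  energy_one : ∫⁻ z : RSpace N × RSpace N,
    ENNReal.ofReal (|φ z.1 - φ z.2| ^ (1 : ℝ) / ‖z.1 - z.2‖ ^ ((N : ℝ) + s₁)) < ⊤
  energy_p : ∫⁻ z : RSpace N × RSpace N,
    ENNReal.ofReal (|φ z.1 - φ z.2| ^ p / ‖z.1 - z.2‖ ^ ((N : ℝ) + θ)) < ⊤

/-- Normalised solutions on the unit ball of `c (-Δ₁)^{s₁} u + (-Δ_p)^{θ/p} u = 0`. -/
structure NormSol {N : ℕ} (s₁ θ p T c : ℝ) (u : RSpace N → ℝ) (Z : RSpace N × RSpace N → ℝ) :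
    Prop where
  coeff_nonneg : 0 ≤ c
  coeff_le_one : c ≤ 1
  measurable : Measurable u
  measurable_sign : Measurable Z
  bound : ∀ x ∈ Metric.ball (0 : RSpace N) 1, |u x| ≤ 1
  tail : ∫⁻ x, ENNReal.ofReal (|u x| ^ (p - 1) / (1 + ‖x‖) ^ ((N : ℝ) + θ)) ≤ ENNReal.ofReal T
  energy_one : ∫⁻ x in Metric.ball 0 1, ∫⁻ y in Metric.ball 0 1,
    ENNReal.ofReal (|u x - u y| ^ (1 : ℝ) / ‖x - y‖ ^ ((N : ℝ) + s₁)) < ⊤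
  energy_p : ∫⁻ x in Metric.ball 0 1, ∫⁻ y in Metric.ball 0 1,
    ENNReal.ofReal (|u x - u y| ^ p / ‖x - y‖ ^ ((N : ℝ) + θ)) ≤ 1
  sign : ∀ᵐ z : RSpace N × RSpace N, Z z ∈ setSign (u z.1 - u z.2)
  equation : ∀ φ : RSpace N → ℝ, BallTest s₁ θ p φ →
    c * (∫ z : RSpace N × RSpace N, Z z * (φ z.1 - φ z.2) / ‖z.1 - z.2‖ ^ ((N : ℝ) + s₁)) +
      ∫ z : RSpace N × RSpace N, oddPow (p - 2) (u z.1 - u z.2) * (φ z.1 - φ z.2) /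
        ‖z.1 - z.2‖ ^ ((N : ℝ) + θ) = 0

lemma measurable_oddPow (m : ℝ) : Measurable (oddPow m) := by
  unfold oddPow; fun_prop

attribute [fun_prop] measurable_oddPow

/-- The common splitting for nonlocal double integrals: when one point leaves the ball the kernel is
no longer singular and the integrand is dominated by a product, so the far part factorises. -/
lemma lintegral_prod_le_local_add_far {N : ℕ} {F A : RSpace N × RSpace N → ℝ≥0∞}
    {H G : RSpace N → ℝ≥0∞} {R : ℝ} (hA : Measurable A) (hH : Measurable H) (hG : Measurable G)
    (hloc : ∀ᵐ z : RSpace N × RSpace N, z.1 ∈ Metric.ball 0 R → z.2 ∈ Metric.ball 0 R → F z ≤ A z)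
    (hfar₂ : ∀ᵐ z : RSpace N × RSpace N, z.2 ∉ Metric.ball 0 R → F z ≤ H z.1 * G z.2)
    (hfar₁ : ∀ᵐ z : RSpace N × RSpace N, z.1 ∉ Metric.ball 0 R → F z ≤ H z.2 * G z.1) :
    ∫⁻ z, F z ≤ (∫⁻ x in Metric.ball 0 R, ∫⁻ y in Metric.ball 0 R, A (x, y)) +
      2 * ((∫⁻ x, H x) * ∫⁻ y, G y) := by
  set S : Set (RSpace N × RSpace N) := Metric.ball 0 R ×ˢ Metric.ball 0 R with hS
  have hSm : MeasurableSet S := measurableSet_ball.prod measurableSet_ball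
  have hle : ∀ᵐ z : RSpace N × RSpace N,
      F z ≤ S.indicator A z + (H z.1 * G z.2 + G z.1 * H z.2) := by
    filter_upwards [hloc, hfar₂, hfar₁] with z h1 h2 h3
    by_cases hz1 : z.1 ∈ Metric.ball (0 : RSpace N) R
    · by_cases hz2 : z.2 ∈ Metric.ball (0 : RSpace N) R
      · rw [Set.indicator_of_mem (show z ∈ S from ⟨hz1, hz2⟩)]
        exact (h1 hz1 hz2).trans le_self_add
      · exact (h2 hz2).trans (le_self_add.trans le_add_self)
    · rw [mul_comm (G z.1)]
      exact (h3 hz1).trans (le_add_self.trans le_add_self)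
  refine (lintegral_mono_ae hle).trans_eq ?_
  rw [lintegral_add_left (hA.indicator hSm), lintegral_add_left (by fun_prop),
    lintegral_indicator hSm, hS, Measure.volume_eq_prod, ← Measure.prod_restrict,
    lintegral_prod _ hA.aemeasurable, lintegral_prod_mul hH.aemeasurable hG.aemeasurable,
    lintegral_prod_mul hG.aemeasurable hH.aemeasurable, mul_comm (∫⁻ y, G y), two_mul]

/-- The affine function of |y| on the left meets |y| - r at |y| = R and has slope at most one, so it
stays below from there on. -/
lemma norm_sub_ge_far {N : ℕ} {r R : ℝ} (hr : 0 ≤ r) (hrR : r < R) {x y : RSpace N} (hx : ‖x‖ ≤ r)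
    (hy : R ≤ ‖y‖) : (R - r) / (1 + R) * (1 + ‖y‖) ≤ ‖x - y‖ := by
  have h1 : ‖y‖ - ‖x‖ ≤ ‖x - y‖ := by rw [norm_sub_rev]; exact norm_sub_norm_le y x
  rw [div_mul_eq_mul_div, div_le_iff₀ (by linarith)]
  nlinarith

lemma div_norm_rpow_far_le {N : ℕ} {r R σ a : ℝ} (hr : 0 ≤ r) (hrR : r < R) (hσ : 0 ≤ σ)
    (ha : 0 ≤ a) {x y : RSpace N} (hx : ‖x‖ ≤ r) (hy : R ≤ ‖y‖) :
    a / ‖x - y‖ ^ σ ≤ ((R - r) / (1 + R)) ^ (-σ) * (a / (1 + ‖y‖) ^ σ) := by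
  have h0 : 0 < (R - r) / (1 + R) := div_pos (by linarith) (by linarith)
  have h1 := Real.rpow_le_rpow (by positivity) (norm_sub_ge_far hr hrR hx hy) hσ
  rw [Real.mul_rpow h0.le (by positivity)] at h1
  calc a / ‖x - y‖ ^ σ ≤ a / (((R - r) / (1 + R)) ^ σ * (1 + ‖y‖) ^ σ) := by gcongr
    _ = _ := by rw [Real.rpow_neg h0.le]; field_simp

lemma lintegral_one_add_norm_lt_top (N : ℕ) {σ : ℝ} (hσ : 0 < σ) :
    ∫⁻ x : RSpace N, ENNReal.ofReal (1 / (1 + ‖x‖) ^ ((N : ℝ) + σ)) < ⊤ := by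
  have h := finite_integral_one_add_norm (μ := (volume : Measure (RSpace N))) (r := N + σ)
    (by simpa using hσ)
  refine lt_of_eq_of_lt (lintegral_congr fun x => ?_) h
  rw [Real.rpow_neg (by positivity), one_div]

/-- Globalisation of a local energy bound for a compactly supported function. -/
lemma energy_lt_top_of_local {N : ℕ} {φ : RSpace N → ℝ} (hφ : Measurable φ) {B r R q σ : ℝ}
    (hB : ∀ x, |φ x| ≤ B) (hr : 0 < r) (hrR : r < R) (hsupp : ∀ x, r ≤ ‖x‖ → φ x = 0) (hq : 0 < q)
    (hσ : 0 < σ)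
    (hloc : ∫⁻ x in Metric.ball 0 R, ∫⁻ y in Metric.ball 0 R,
      ENNReal.ofReal (|φ x - φ y| ^ q / ‖x - y‖ ^ ((N : ℝ) + σ)) < ⊤) :
    ∫⁻ z : RSpace N × RSpace N,
      ENNReal.ofReal (|φ z.1 - φ z.2| ^ q / ‖z.1 - z.2‖ ^ ((N : ℝ) + σ)) < ⊤ := by
  have hB0 : 0 ≤ B := (abs_nonneg _).trans (hB 0)
  set c := ((R - r) / (1 + R)) ^ (-((N : ℝ) + σ)) with hc
  have hc0 : 0 ≤ c := Real.rpow_nonneg (div_nonneg (by linarith) (by linarith)) _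
  have hpt : ∀ x y : RSpace N, y ∉ Metric.ball (0 : RSpace N) R →
      ENNReal.ofReal (|φ x - φ y| ^ q / ‖x - y‖ ^ ((N : ℝ) + σ)) ≤
        (Metric.ball (0 : RSpace N) r).indicator (fun _ => ENNReal.ofReal (c * B ^ q)) x *
          ENNReal.ofReal (1 / (1 + ‖y‖) ^ ((N : ℝ) + σ)) := by
    intro x y hy
    rw [mem_ball_zero_iff, not_lt] at hy
    rw [hsupp y (hrR.le.trans hy), sub_zero]
    by_cases hx : x ∈ Metric.ball (0 : RSpace N) r
    · rw [Set.indicator_of_mem hx, ← ENNReal.ofReal_mul (by positivity)]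
      apply ENNReal.ofReal_le_ofReal
      rw [mem_ball_zero_iff] at hx
      refine (div_norm_rpow_far_le hr.le hrR (by positivity) (by positivity) hx.le hy).trans ?_
      rw [← hc, mul_assoc]
      gcongr
      rw [mul_one_div]
      gcongr
      exact hB x
    · rw [mem_ball_zero_iff, not_lt] at hx
      rw [hsupp x hx, abs_zero, Real.zero_rpow hq.ne']; simp
  have hfar := lintegral_prod_le_local_add_far
    (F := fun z => ENNReal.ofReal (|φ z.1 - φ z.2| ^ q / ‖z.1 - z.2‖ ^ ((N : ℝ) + σ)))
    (A := fun z => ENNReal.ofReal (|φ z.1 - φ z.2| ^ q / ‖z.1 - z.2‖ ^ ((N : ℝ) + σ)))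
    (H := (Metric.ball (0 : RSpace N) r).indicator (fun _ => ENNReal.ofReal (c * B ^ q)))
    (G := fun y => ENNReal.ofReal (1 / (1 + ‖y‖) ^ ((N : ℝ) + σ))) (R := R)
    (by fun_prop) (measurable_const.indicator measurableSet_ball) (by fun_prop)
    (ae_of_all _ fun z _ _ => le_rfl) (ae_of_all _ fun z hz => hpt z.1 z.2 hz)
    (ae_of_all _ fun z hz => by
      rw [abs_sub_comm, norm_sub_rev]; exact hpt z.2 z.1 hz)
  refine hfar.trans_lt (ENNReal.add_lt_top.2 ⟨hloc, ENNReal.mul_lt_top (by simp)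
    (ENNReal.mul_lt_top ?_ (lintegral_one_add_norm_lt_top N hσ))⟩)
  rw [lintegral_indicator measurableSet_ball, setLIntegral_const]
  exact ENNReal.mul_lt_top ENNReal.ofReal_lt_top measure_ball_lt_top

/-- Provides invariance under the diagonal translations (h, h) and the scaling rule on the product
space. -/
instance isAddHaarMeasure_volume_prod (N : ℕ) :
    (volume : Measure (RSpace N × RSpace N)).IsAddHaarMeasure :=
  inferInstanceAs ((volume : Measure (RSpace N)).prod volume).IsAddHaarMeasure

lemma lintegral_prod_comp_add {N : ℕ} (F : RSpace N × RSpace N → ℝ≥0∞) (h : RSpace N) :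
    ∫⁻ z : RSpace N × RSpace N, F (z.1 + h, z.2 + h) = ∫⁻ z, F z :=
  lintegral_add_right_eq_self F ((h, h) : RSpace N × RSpace N)

lemma BallTest.translate {N : ℕ} {s₁ θ p : ℝ} {φ : RSpace N → ℝ} (hφ : BallTest s₁ θ p φ)
    {r : ℝ} (hr : 0 < r) (hsupp : ∀ x, r ≤ ‖x‖ → φ x = 0) {h : RSpace N} (hh : r + ‖h‖ < 1) :
    BallTest s₁ θ p fun x => φ (x - h) where
  measurable := hφ.measurable.comp (measurable_sub_const h)
  bounded := by
    obtain ⟨B, hB⟩ := hφ.bounded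
    exact ⟨B, fun x => hB _⟩
  support := ⟨r + ‖h‖, by positivity, hh, fun x hx => hsupp _ (by
    have := norm_sub_norm_le x h; linarith)⟩
  energy_one := by
    rw [← lintegral_prod_comp_add _ h]
    simpa using hφ.energy_one
  energy_p := by
    rw [← lintegral_prod_comp_add _ h]
    simpa using hφ.energy_p

lemma NormSol.integrable_sign_part {N : ℕ} {s₁ θ p T c : ℝ} {u : RSpace N → ℝ}
    {Z : RSpace N × RSpace N → ℝ} (hu : NormSol s₁ θ p T c u Z) {φ : RSpace N → ℝ}
    (hφ : BallTest s₁ θ p φ) :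
    Integrable fun z : RSpace N × RSpace N =>
      Z z * (φ z.1 - φ z.2) / ‖z.1 - z.2‖ ^ ((N : ℝ) + s₁) := by
  have hm := hφ.measurable
  have hZ := hu.measurable_sign
  refine ⟨(by fun_prop : Measurable _).aestronglyMeasurable, ?_⟩
  refine lt_of_le_of_lt (lintegral_mono_ae ?_) hφ.energy_one
  filter_upwards [hu.sign] with z hz
  rw [Real.enorm_eq_ofReal_abs, abs_div, abs_mul, Real.rpow_one,
    abs_of_nonneg (Real.rpow_nonneg (norm_nonneg _) _)]
  apply ENNReal.ofReal_le_ofReal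
  gcongr
  exact mul_le_of_le_one_left (abs_nonneg _) (abs_le_one_of_mem_setSign hz)

lemma rpow_mul_le_rpow_add_rpow {a b q : ℝ} (ha : 0 ≤ a) (hb : 0 ≤ b) (hq : 0 ≤ q) :
    a ^ q * b ≤ a ^ (q + 1) + b ^ (q + 1) := by
  rw [Real.rpow_add_of_nonneg ha hq zero_le_one, Real.rpow_add_of_nonneg hb hq zero_le_one,
    Real.rpow_one, Real.rpow_one]
  have h1 : 0 ≤ a ^ q * a := by positivity
  have h2 : 0 ≤ b ^ q * b := by positivity
  rcases le_total a b with h | h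
  · have : a ^ q * b ≤ b ^ q * b := by gcongr
    linarith
  · have : a ^ q * b ≤ a ^ q * a := by gcongr
    linarith

/-- On the unit ball, Young's inequality bounds the integrand by the p-energies of u and φ. Outside,
the support of φ keeps the points apart, and the tail of u takes over. -/
lemma NormSol.integrable_p_part {N : ℕ} {s₁ θ p T c : ℝ} {u : RSpace N → ℝ}
    {Z : RSpace N × RSpace N → ℝ} (hp : 2 ≤ p) (hθ : 0 < θ) (hu : NormSol s₁ θ p T c u Z)
    {φ : RSpace N → ℝ} (hφ : BallTest s₁ θ p φ) :
    Integrable fun z : RSpace N × RSpace N =>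
      oddPow (p - 2) (u z.1 - u z.2) * (φ z.1 - φ z.2) / ‖z.1 - z.2‖ ^ ((N : ℝ) + θ) := by
  have hm := hφ.measurable
  have hum := hu.measurable
  refine ⟨(by fun_prop : Measurable _).aestronglyMeasurable, ?_⟩
  obtain ⟨B, hB⟩ := hφ.bounded
  have hB0 : 0 ≤ B := (abs_nonneg _).trans (hB 0)
  obtain ⟨r, hr0, hr1, hsupp⟩ := hφ.support
  set κ := ((1 - r) / (1 + 1)) ^ (-((N : ℝ) + θ)) with hκ
  have hκ0 : 0 ≤ κ := Real.rpow_nonneg (div_nonneg (by linarith) (by linarith)) _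
  have habs : ∀ x y : RSpace N,
      ‖oddPow (p - 2) (u x - u y) * (φ x - φ y) / ‖x - y‖ ^ ((N : ℝ) + θ)‖ₑ =
        ENNReal.ofReal (|u x - u y| ^ (p - 1) * |φ x - φ y| / ‖x - y‖ ^ ((N : ℝ) + θ)) := by
    intro x y
    rw [Real.enorm_eq_ofReal_abs, abs_div, abs_mul, abs_oddPow (by linarith),
      abs_of_nonneg (Real.rpow_nonneg (norm_nonneg _) _)]
    rw [show p - 2 + 1 = p - 1 by ring]
  have hpt : ∀ x y : RSpace N, y ∉ Metric.ball (0 : RSpace N) 1 →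
      ENNReal.ofReal (|u x - u y| ^ (p - 1) * |φ x - φ y| / ‖x - y‖ ^ ((N : ℝ) + θ)) ≤
        (Metric.ball (0 : RSpace N) r).indicator
          (fun _ => ENNReal.ofReal (κ * (2 ^ (p - 1) * B))) x *
          (ENNReal.ofReal (1 / (1 + ‖y‖) ^ ((N : ℝ) + θ)) +
            ENNReal.ofReal (|u y| ^ (p - 1) / (1 + ‖y‖) ^ ((N : ℝ) + θ))) := by
    intro x y hy
    rw [mem_ball_zero_iff, not_lt] at hy
    rw [hsupp y (hr1.le.trans hy), sub_zero]
    by_cases hx : x ∈ Metric.ball (0 : RSpace N) r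
    · rw [Set.indicator_of_mem hx, ← ENNReal.ofReal_add (by positivity) (by positivity),
        ← ENNReal.ofReal_mul (by positivity)]
      apply ENNReal.ofReal_le_ofReal
      have hux := hu.bound x (Metric.ball_subset_ball hr1.le hx)
      rw [mem_ball_zero_iff] at hx
      refine (div_norm_rpow_far_le hr0.le hr1 (by positivity) (by positivity) hx.le hy).trans ?_
      rw [← hκ, ← add_div, mul_assoc]
      refine mul_le_mul_of_nonneg_left ?_ hκ0
      rw [mul_div_assoc']
      gcongr ?_ / _
      have h1 := abs_sub_rpow_le (by linarith : 0 ≤ p - 1) (u x) (u y)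
      have h2 : |u x| ^ (p - 1) ≤ 1 := Real.rpow_le_one (abs_nonneg _) hux (by linarith)
      calc |u x - u y| ^ (p - 1) * |φ x| ≤ (2 ^ (p - 1) * (1 + |u y| ^ (p - 1))) * B := by
            gcongr
            · exact h1.trans (by gcongr)
            · exact hB x
        _ = _ := by ring
    · rw [mem_ball_zero_iff, not_lt] at hx
      rw [hsupp x hx]; simp
  have hfar := lintegral_prod_le_local_add_far
    (F := fun z => ‖oddPow (p - 2) (u z.1 - u z.2) * (φ z.1 - φ z.2) /
      ‖z.1 - z.2‖ ^ ((N : ℝ) + θ)‖ₑ)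
    (A := fun z => ENNReal.ofReal (|u z.1 - u z.2| ^ p / ‖z.1 - z.2‖ ^ ((N : ℝ) + θ)) +
      ENNReal.ofReal (|φ z.1 - φ z.2| ^ p / ‖z.1 - z.2‖ ^ ((N : ℝ) + θ)))
    (H := (Metric.ball (0 : RSpace N) r).indicator
      (fun _ => ENNReal.ofReal (κ * (2 ^ (p - 1) * B))))
    (G := fun y => ENNReal.ofReal (1 / (1 + ‖y‖) ^ ((N : ℝ) + θ)) +
      ENNReal.ofReal (|u y| ^ (p - 1) / (1 + ‖y‖) ^ ((N : ℝ) + θ))) (R := 1)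
    (by fun_prop) (measurable_const.indicator measurableSet_ball) (by fun_prop)
    (ae_of_all _ fun z _ _ => by
      rw [habs, ← ENNReal.ofReal_add (by positivity) (by positivity), ← add_div]
      apply ENNReal.ofReal_le_ofReal
      gcongr
      have := rpow_mul_le_rpow_add_rpow (abs_nonneg (u z.1 - u z.2)) (abs_nonneg (φ z.1 - φ z.2))
        (by linarith : 0 ≤ p - 1)
      simpa using this)
    (ae_of_all _ fun z hz => by rw [habs]; exact hpt z.1 z.2 hz)
    (ae_of_all _ fun z hz => by
      rw [habs, abs_sub_comm (u z.1), abs_sub_comm (φ z.1), norm_sub_rev]; exact hpt z.2 z.1 hz)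
  refine hfar.trans_lt (ENNReal.add_lt_top.2 ⟨?_, ENNReal.mul_lt_top (by simp)
    (ENNReal.mul_lt_top ?_ ?_)⟩)
  · have e : ∀ x : RSpace N, ∫⁻ y in Metric.ball 0 1,
        (ENNReal.ofReal (|u x - u y| ^ p / ‖x - y‖ ^ ((N : ℝ) + θ)) +
        ENNReal.ofReal (|φ x - φ y| ^ p / ‖x - y‖ ^ ((N : ℝ) + θ))) =
        (∫⁻ y in Metric.ball 0 1, ENNReal.ofReal (|u x - u y| ^ p / ‖x - y‖ ^ ((N : ℝ) + θ))) +
        ∫⁻ y in Metric.ball 0 1,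
          ENNReal.ofReal (|φ x - φ y| ^ p / ‖x - y‖ ^ ((N : ℝ) + θ)) := fun x =>
      lintegral_add_left (by fun_prop) _
    simp_rw [e]
    rw [lintegral_add_left]
    · refine ENNReal.add_lt_top.2 ⟨hu.energy_p.trans_lt ENNReal.one_lt_top, ?_⟩
      refine lt_of_le_of_lt ?_ hφ.energy_p
      rw [Measure.volume_eq_prod, lintegral_prod _ (by fun_prop)]
      exact (setLIntegral_le_lintegral _ _).trans
        (lintegral_mono fun x => setLIntegral_le_lintegral _ _)
    · exact Measurable.lintegral_prod_right' (f := fun z : RSpace N × RSpace N =>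
        ENNReal.ofReal (|u z.1 - u z.2| ^ p / ‖z.1 - z.2‖ ^ ((N : ℝ) + θ))) (by fun_prop)
  · rw [lintegral_indicator measurableSet_ball, setLIntegral_const]
    exact ENNReal.mul_lt_top ENNReal.ofReal_lt_top measure_ball_lt_top
  · rw [lintegral_add_left (by fun_prop)]
    exact ENNReal.add_lt_top.2 ⟨lintegral_one_add_norm_lt_top N hθ,
      hu.tail.trans_lt ENNReal.ofReal_lt_top⟩

/-! ### Cutoffs and localised powers of finite differences. -/

/-- The radial Lipschitz cutoff equal to `1` for `‖x‖ ≤ a` and to `0` for `b ≤ ‖x‖`. -/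
noncomputable def cutoff {N : ℕ} (a b : ℝ) (x : RSpace N) : ℝ :=
  max 0 (min 1 ((b - ‖x‖) / (b - a)))

section cutoff

variable {N : ℕ} {a b : ℝ}

lemma measurable_cutoff : Measurable (cutoff a b : RSpace N → ℝ) := by
  unfold cutoff; fun_prop

lemma cutoff_nonneg (x : RSpace N) : 0 ≤ cutoff a b x := le_max_left _ _

lemma cutoff_le_one (x : RSpace N) : cutoff a b x ≤ 1 :=
  max_le zero_le_one (min_le_left _ _)

lemma cutoff_eq_one (hab : a < b) {x : RSpace N} (hx : ‖x‖ ≤ a) : cutoff a b x = 1 := by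
  have : 1 ≤ (b - ‖x‖) / (b - a) := by rw [le_div_iff₀ (by linarith)]; linarith
  rw [cutoff, min_eq_left this, max_eq_right zero_le_one]

lemma cutoff_eq_zero (hab : a < b) {x : RSpace N} (hx : b ≤ ‖x‖) : cutoff a b x = 0 := by
  have : (b - ‖x‖) / (b - a) ≤ 0 := div_nonpos_of_nonpos_of_nonneg (by linarith) (by linarith)
  rw [cutoff, min_eq_right (this.trans zero_le_one), max_eq_left this]

lemma abs_cutoff_sub_le (hab : a < b) (x y : RSpace N) :
    |cutoff a b x - cutoff a b y| ≤ (b - a)⁻¹ * ‖x - y‖ := by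
  have hb : 0 < b - a := by linarith
  unfold cutoff
  refine (abs_max_sub_max_le_max _ _ _ _).trans ?_
  rw [sub_self, abs_zero, max_eq_right (abs_nonneg _)]
  refine (abs_min_sub_min_le_max _ _ _ _).trans ?_
  rw [sub_self, abs_zero, max_eq_right (abs_nonneg _), ← sub_div, abs_div, abs_of_pos hb,
    div_eq_inv_mul]
  gcongr
  rw [sub_sub_sub_cancel_left, abs_sub_comm]
  exact abs_norm_sub_norm_le x y

end cutoff

lemma lintegral_lintegral_comp_add_le {N : ℕ} {r R : ℝ} {h : RSpace N} (hr : r + ‖h‖ ≤ R)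
    (F : RSpace N → RSpace N → ℝ≥0∞) :
    ∫⁻ x in Metric.ball 0 r, ∫⁻ y in Metric.ball 0 r, F (x + h) (y + h) ≤
      ∫⁻ x in Metric.ball 0 R, ∫⁻ y in Metric.ball 0 R, F x y := by
  have hb : ∀ x ∈ Metric.ball (0 : RSpace N) r, x + h ∈ Metric.ball (0 : RSpace N) R := by
    intro x hx
    rw [mem_ball_zero_iff] at hx ⊢
    exact (norm_add_le _ _).trans_lt (by linarith)
  calc _ ≤ ∫⁻ x in Metric.ball 0 r, ∫⁻ y in Metric.ball 0 R, F (x + h) y :=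
        lintegral_mono fun x =>
          lintegral_comp_add_le measurableSet_ball measurableSet_ball h hb (F (x + h))
    _ ≤ _ := lintegral_comp_add_le measurableSet_ball measurableSet_ball h hb
        fun x => ∫⁻ y in Metric.ball 0 R, F x y

lemma lintegral_ball_norm_sub_rpow_le {N : ℕ} (e : ℝ) {R : ℝ} {x : RSpace N}
    (hx : x ∈ Metric.ball (0 : RSpace N) R) :
    ∫⁻ y in Metric.ball (0 : RSpace N) R, ENNReal.ofReal (‖x - y‖ ^ e) ≤
      ∫⁻ z in Metric.ball (0 : RSpace N) (R + R), ENNReal.ofReal (‖z‖ ^ e) := by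
  have := lintegral_comp_add_le (measurableSet_ball (x := (0 : RSpace N)) (ε := R))
    (measurableSet_ball (x := (0 : RSpace N)) (ε := R + R)) (-x) (fun y hy => by
      rw [mem_ball_zero_iff] at hx hy ⊢
      rw [← sub_eq_add_neg]
      exact (norm_sub_le _ _).trans_lt (by linarith))
    fun z => ENNReal.ofReal (‖z‖ ^ e)
  refine le_trans (le_of_eq ?_) this
  simp_rw [← sub_eq_add_neg, norm_sub_rev]

lemma lintegral_ball_ball_norm_rpow_lt_top {N : ℕ} (hN : 1 ≤ N) {ε : ℝ} (hε : 0 < ε) (R : ℝ) :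
    ∫⁻ x in Metric.ball (0 : RSpace N) R, ∫⁻ y in Metric.ball (0 : RSpace N) R,
      ENNReal.ofReal (‖x - y‖ ^ (ε - N)) < ⊤ := by
  refine (setLIntegral_mono' measurableSet_ball fun x hx =>
    lintegral_ball_norm_sub_rpow_le (ε - N) hx).trans_lt ?_
  rw [setLIntegral_const]
  exact ENNReal.mul_lt_top (lintegral_ball_norm_rpow_lt_top hN hε _) measure_ball_lt_top

/-- The finite difference `u(x + h) - u(x)`. -/
def delta {N : ℕ} (h : RSpace N) (u : RSpace N → ℝ) (x : RSpace N) : ℝ := u (x + h) - u x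

lemma measurable_delta {N : ℕ} (h : RSpace N) {u : RSpace N → ℝ} (hu : Measurable u) :
    Measurable (delta h u) := by
  unfold delta; fun_prop

lemma NormSol.abs_delta_le {N : ℕ} {s₁ θ p T c : ℝ} {u : RSpace N → ℝ}
    {Z : RSpace N × RSpace N → ℝ} (hu : NormSol s₁ θ p T c u Z) {R : ℝ} {h : RSpace N}
    (hR : R + ‖h‖ ≤ 1) {x : RSpace N} (hx : x ∈ Metric.ball (0 : RSpace N) R) :
    |delta h u x| ≤ 2 := by
  rw [mem_ball_zero_iff] at hx
  have h1 := hu.bound (x + h) (by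
    rw [mem_ball_zero_iff]; exact (norm_add_le _ _).trans_lt (by linarith))
  have h2 := hu.bound x (by rw [mem_ball_zero_iff]; linarith [norm_nonneg h])
  have := abs_sub (u (x + h)) (u x)
  unfold delta
  linarith

/-- Equality holds off the origin; the inequality form makes it unnecessary to exclude the diagonal.
-/
lemma norm_rpow_div_rpow_le {N : ℕ} {q k : ℝ} (hq : 0 < q) (x : RSpace N) :
    ‖x‖ ^ q / ‖x‖ ^ k ≤ ‖x‖ ^ (q - k) := by
  rcases eq_or_ne x 0 with rfl | hx
  · rw [norm_zero, Real.zero_rpow hq.ne', zero_div]; positivity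
  · rw [Real.rpow_sub (norm_pos_iff.2 hx)]

/-- The localised odd power of the finite difference. -/
noncomputable def diffTest {N : ℕ} (n a b : ℝ) (h : RSpace N) (u : RSpace N → ℝ) (x : RSpace N) :
    ℝ :=
  oddPow n (delta h u x) * cutoff a b x ^ 2

/-- On arguments bounded by 2 the odd power is Lipschitz, and the squared cutoff is Lipschitz with
constant 2/(b - a); the product rule for differences does the rest. -/
lemma abs_diffTest_sub_le {N : ℕ} {n a b : ℝ} (hn : 0 ≤ n) (hab : a < b) (h : RSpace N)
    (u : RSpace N → ℝ) {x y : RSpace N} (hx : |delta h u x| ≤ 2) (hy : |delta h u y| ≤ 2) :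
    |diffTest n a b h u x - diffTest n a b h u y| ≤
      (n + 2) * (2 * 2 ^ n) * |delta h u x - delta h u y| +
        2 ^ (n + 1) * (2 * (b - a)⁻¹) * ‖x - y‖ := by
  set A := delta h u x
  set B := delta h u y
  set s := cutoff a b x with hs
  set t := cutoff a b y with ht
  have hs0 : 0 ≤ s := cutoff_nonneg x
  have hs1 : s ≤ 1 := cutoff_le_one x
  have ht0 : 0 ≤ t := cutoff_nonneg y
  have ht1 : t ≤ 1 := cutoff_le_one y
  have hst : |s - t| ≤ (b - a)⁻¹ * ‖x - y‖ := abs_cutoff_sub_le hab x y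
  have hst2 : |s ^ 2 - t ^ 2| ≤ 2 * ((b - a)⁻¹ * ‖x - y‖) := by
    rw [show s ^ 2 - t ^ 2 = (s + t) * (s - t) by ring, abs_mul, abs_of_nonneg (by linarith)]
    gcongr
    linarith
  have hg : |oddPow n A - oddPow n B| ≤ (n + 2) * (2 * 2 ^ n) * |A - B| := by
    refine (abs_oddPow_sub_le hn A B).trans ?_
    have h1 : |A| ^ n ≤ 2 ^ n := Real.rpow_le_rpow (abs_nonneg _) hx hn
    have h2 : |B| ^ n ≤ 2 ^ n := Real.rpow_le_rpow (abs_nonneg _) hy hn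
    gcongr
    linarith
  have hB : |oddPow n B| ≤ 2 ^ (n + 1) := by
    rw [abs_oddPow hn]
    exact Real.rpow_le_rpow (abs_nonneg _) hy (by linarith)
  have e : diffTest n a b h u x - diffTest n a b h u y =
      (oddPow n A - oddPow n B) * s ^ 2 + oddPow n B * (s ^ 2 - t ^ 2) := by
    unfold diffTest; ring
  rw [e]
  refine (abs_add_le _ _).trans ?_
  rw [abs_mul, abs_mul]
  have h3 : |oddPow n A - oddPow n B| * |s ^ 2| ≤ |oddPow n A - oddPow n B| * 1 := by
    gcongr
    rw [abs_of_nonneg (by positivity)]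
    exact pow_le_one₀ hs0 hs1
  have h4 : |oddPow n B| * |s ^ 2 - t ^ 2| ≤ 2 ^ (n + 1) * (2 * ((b - a)⁻¹ * ‖x - y‖)) := by
    gcongr
  linarith

/-- The part Lipschitz in `delta h u` inherits the energy of u at x and at x + h. The part Lipschitz
in x contributes |x - y|^(q - σ - N), which is integrable because σ < q. It is used with exponents 1
and p. -/
lemma NormSol.local_energy_diffTest {N : ℕ} (hN : 1 ≤ N) {s₁ θ p T c n a b R q σ : ℝ}
    {u : RSpace N → ℝ} {Z : RSpace N × RSpace N → ℝ} (hu : NormSol s₁ θ p T c u Z) (hn : 0 ≤ n)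
    (hab : a < b) {h : RSpace N} (hR : R + ‖h‖ ≤ 1) (hq : 0 < q) (hσ : σ < q)
    (hE : ∫⁻ x in Metric.ball 0 1, ∫⁻ y in Metric.ball 0 1,
      ENNReal.ofReal (|u x - u y| ^ q / ‖x - y‖ ^ ((N : ℝ) + σ)) < ⊤) :
    ∫⁻ x in Metric.ball 0 R, ∫⁻ y in Metric.ball 0 R, ENNReal.ofReal
      (|diffTest n a b h u x - diffTest n a b h u y| ^ q / ‖x - y‖ ^ ((N : ℝ) + σ)) < ⊤ := by
  have hum := hu.measurable
  set C₁ := (n + 2) * (2 * 2 ^ n) with hC₁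
  set C₂ := 2 ^ (n + 1) * (2 * (b - a)⁻¹) with hC₂
  have hba : 0 < b - a := by linarith
  have hC₁0 : 0 ≤ C₁ := by positivity
  have hC₂0 : 0 ≤ C₂ := by positivity
  set K := 2 ^ q * (C₁ ^ q * 2 ^ q + C₂ ^ q) with hK
  have hK0 : 0 ≤ K := by positivity
  set E : RSpace N → RSpace N → ℝ≥0∞ := fun x y =>
    ENNReal.ofReal (|u x - u y| ^ q / ‖x - y‖ ^ ((N : ℝ) + σ)) with hEdef
  have hEm : Measurable (Function.uncurry E) := by
    simp only [hEdef, Function.uncurry_def]; fun_prop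
  have hpt : ∀ x ∈ Metric.ball (0 : RSpace N) R, ∀ y ∈ Metric.ball (0 : RSpace N) R,
      ENNReal.ofReal (|diffTest n a b h u x - diffTest n a b h u y| ^ q /
        ‖x - y‖ ^ ((N : ℝ) + σ)) ≤
      ENNReal.ofReal K * ((E (x + h) (y + h) + E x y) +
        ENNReal.ofReal (‖x - y‖ ^ (q - σ - N))) := by
    intro x hx y hy
    have h1 := abs_diffTest_sub_le hn hab h u (hu.abs_delta_le hR hx) (hu.abs_delta_le hR hy)
    rw [← hC₁, ← hC₂] at h1
    have hk : 0 ≤ ‖x - y‖ ^ ((N : ℝ) + σ) := by positivity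
    rw [hEdef, ← ENNReal.ofReal_add (by positivity) (by positivity),
      ← ENNReal.ofReal_add (by positivity) (by positivity), ← ENNReal.ofReal_mul hK0]
    apply ENNReal.ofReal_le_ofReal
    have h2 : |delta h u x - delta h u y| ^ q ≤
        2 ^ q * (|u (x + h) - u (y + h)| ^ q + |u x - u y| ^ q) := by
      have := abs_sub_rpow_le hq.le (u (x + h) - u (y + h)) (u x - u y)
      have e : delta h u x - delta h u y = u (x + h) - u (y + h) - (u x - u y) := by
        unfold delta; ring
      rwa [e]
    have h3 : |diffTest n a b h u x - diffTest n a b h u y| ^ q ≤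
        2 ^ q * ((C₁ * |delta h u x - delta h u y|) ^ q + (C₂ * ‖x - y‖) ^ q) := by
      refine (Real.rpow_le_rpow (abs_nonneg _) h1 hq.le).trans ?_
      have := abs_add_rpow_le hq.le (C₁ * |delta h u x - delta h u y|) (C₂ * ‖x - y‖)
      rwa [abs_of_nonneg (by positivity : 0 ≤ C₁ * |delta h u x - delta h u y| + C₂ * ‖x - y‖),
        abs_of_nonneg (by positivity : 0 ≤ C₁ * |delta h u x - delta h u y|),
        abs_of_nonneg (by positivity : 0 ≤ C₂ * ‖x - y‖)] at this
    rw [Real.mul_rpow hC₁0 (abs_nonneg _), Real.mul_rpow hC₂0 (norm_nonneg _)] at h3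
    set X := |u (x + h) - u (y + h)| ^ q + |u x - u y| ^ q with hX
    have hX0 : 0 ≤ X := by positivity
    have h4 : |diffTest n a b h u x - diffTest n a b h u y| ^ q ≤ K * (X + ‖x - y‖ ^ q) := by
      have i1 : C₁ ^ q * |delta h u x - delta h u y| ^ q ≤ C₁ ^ q * (2 ^ q * X) := by gcongr
      have i2 : 0 ≤ 2 ^ q * (C₂ ^ q * X) := by positivity
      have i3 : 0 ≤ 2 ^ q * (C₁ ^ q * 2 ^ q * ‖x - y‖ ^ q) := by positivity
      have i4 : 2 ^ q * (C₁ ^ q * |delta h u x - delta h u y| ^ q) ≤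
        2 ^ q * (C₁ ^ q * (2 ^ q * X)) := by gcongr
      rw [hK]
      linarith
    have h5 := norm_rpow_div_rpow_le (k := N + σ) hq (x - y)
    have h6 : q - ((N : ℝ) + σ) = q - σ - N := by ring
    rw [h6] at h5
    rw [add_sub_add_right_eq_sub, ← add_div, ← hX]
    calc _ ≤ K * (X + ‖x - y‖ ^ q) / ‖x - y‖ ^ ((N : ℝ) + σ) := by gcongr
      _ = K * (X / ‖x - y‖ ^ ((N : ℝ) + σ) + ‖x - y‖ ^ q / ‖x - y‖ ^ ((N : ℝ) + σ)) := by ring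
      _ ≤ _ := by gcongr
  have hEm' : Measurable (Function.uncurry fun x y : RSpace N => E (x + h) (y + h)) := by
    simp only [hEdef, Function.uncurry_def]; fun_prop
  have hEx : ∀ x, Measurable (E x) := fun x => by simp only [hEdef]; fun_prop
  have hb1 : ∫⁻ x in Metric.ball 0 R, ∫⁻ y in Metric.ball 0 R, E x y ≤
      ∫⁻ x in Metric.ball 0 1, ∫⁻ y in Metric.ball 0 1, E x y := by
    have hsub : Metric.ball (0 : RSpace N) R ⊆ Metric.ball 0 1 :=
      Metric.ball_subset_ball (by linarith [norm_nonneg h])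
    exact (lintegral_mono_set hsub).trans (lintegral_mono fun x => lintegral_mono_set hsub)
  calc _ ≤ ∫⁻ x in Metric.ball 0 R, ∫⁻ y in Metric.ball 0 R,
        ENNReal.ofReal K * ((E (x + h) (y + h) + E x y) +
        ENNReal.ofReal (‖x - y‖ ^ (q - σ - N))) :=
        setLIntegral_mono' measurableSet_ball fun x hx =>
          setLIntegral_mono' measurableSet_ball fun y hy => hpt x hx y hy
    _ = ENNReal.ofReal K * ((∫⁻ x in Metric.ball 0 R, ∫⁻ y in Metric.ball 0 R, E (x + h) (y + h)) +
        (∫⁻ x in Metric.ball 0 R, ∫⁻ y in Metric.ball 0 R, E x y) +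
        ∫⁻ x in Metric.ball (0 : RSpace N) R, ∫⁻ y in Metric.ball (0 : RSpace N) R,
          ENNReal.ofReal (‖x - y‖ ^ (q - σ - N))) := by
        have e : ∀ x : RSpace N, ∫⁻ y in Metric.ball 0 R,
            ENNReal.ofReal K * ((E (x + h) (y + h) + E x y) +
              ENNReal.ofReal (‖x - y‖ ^ (q - σ - N))) =
            ENNReal.ofReal K * ((∫⁻ y in Metric.ball 0 R, E (x + h) (y + h)) +
              (∫⁻ y in Metric.ball 0 R, E x y) +
              ∫⁻ y in Metric.ball 0 R, ENNReal.ofReal (‖x - y‖ ^ (q - σ - N))) := by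
          intro x
          have m1 : Measurable fun y => E (x + h) (y + h) := (hEx _).comp (measurable_add_const h)
          have m2 := hEx x
          rw [lintegral_const_mul' _ _ ENNReal.ofReal_ne_top, lintegral_add_left (by fun_prop),
            lintegral_add_left m1]
        have m1 : Measurable fun x => ∫⁻ y in Metric.ball 0 R, E (x + h) (y + h) :=
          hEm'.lintegral_prod_right'
        have m2 : Measurable fun x => ∫⁻ y in Metric.ball 0 R, E x y := hEm.lintegral_prod_right'
        simp_rw [e]
        rw [lintegral_const_mul' _ _ ENNReal.ofReal_ne_top, lintegral_add_left (by fun_prop),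
          lintegral_add_left m1]
    _ < ⊤ := by
        refine ENNReal.mul_lt_top ENNReal.ofReal_lt_top (ENNReal.add_lt_top.2
          ⟨ENNReal.add_lt_top.2 ⟨(lintegral_lintegral_comp_add_le hR E).trans_lt hE,
            hb1.trans_lt hE⟩, lintegral_ball_ball_norm_rpow_lt_top hN (by linarith) R⟩)

lemma diffTest_eq_zero {N : ℕ} {n a b : ℝ} (hab : a < b) (h : RSpace N) (u : RSpace N → ℝ)
    {x : RSpace N} (hx : b ≤ ‖x‖) : diffTest n a b h u x = 0 := by
  rw [diffTest, cutoff_eq_zero hab hx]; ring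

lemma measurable_diffTest {N : ℕ} (n a b : ℝ) (h : RSpace N) {u : RSpace N → ℝ}
    (hu : Measurable u) : Measurable (diffTest n a b h u) :=
  ((measurable_oddPow n).comp (measurable_delta h hu)).mul (measurable_cutoff.pow_const 2)

lemma abs_diffTest_le {N : ℕ} {n a b : ℝ} (hn : 0 ≤ n) (h : RSpace N) (u : RSpace N → ℝ)
    (x : RSpace N) : |diffTest n a b h u x| ≤ |delta h u x| ^ (n + 1) := by
  rw [diffTest, abs_mul, abs_oddPow hn, abs_of_nonneg (sq_nonneg (cutoff a b x))]
  exact mul_le_of_le_one_right (by positivity) (pow_le_one₀ (cutoff_nonneg x) (cutoff_le_one x))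

/-- Admissibility of the nonlinear test function: this is where the qualitative finiteness of the
order-1 energy is consumed, and it leaves no trace in the constants. -/
lemma NormSol.ballTest_diffTest {N : ℕ} (hN : 1 ≤ N) {s₁ θ p T c n a b R : ℝ}
    {u : RSpace N → ℝ} {Z : RSpace N × RSpace N → ℝ} (hu : NormSol s₁ θ p T c u Z)
    (hs₁ : 0 < s₁) (hs₁' : s₁ < 1) (hθ : 0 < θ) (hθp : θ < p) (hn : 0 ≤ n) (hb : 0 < b)
    (hab : a < b) (hbR : b < R) {h : RSpace N} (hR : R + ‖h‖ ≤ 1) :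
    BallTest s₁ θ p (diffTest n a b h u) := by
  have hm := measurable_diffTest n a b h hu.measurable
  have hbound : ∀ x, |diffTest n a b h u x| ≤ 2 ^ (n + 1) := by
    intro x
    rcases lt_or_ge ‖x‖ b with hx | hx
    · refine (abs_diffTest_le hn h u x).trans ?_
      exact Real.rpow_le_rpow (abs_nonneg _)
        (hu.abs_delta_le hR (mem_ball_zero_iff.2 (hx.trans hbR))) (by linarith)
    · rw [diffTest_eq_zero hab h u hx, abs_zero]; positivity
  have hsupp : ∀ x, b ≤ ‖x‖ → diffTest n a b h u x = 0 := fun x hx => diffTest_eq_zero hab h u hx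
  exact
    { measurable := hm
      bounded := ⟨_, hbound⟩
      support := ⟨b, hb, by linarith [norm_nonneg h], hsupp⟩
      energy_one := energy_lt_top_of_local hm hbound hb hbR hsupp one_pos hs₁
        (hu.local_energy_diffTest hN hn hab hR one_pos hs₁' hu.energy_one)
      energy_p := energy_lt_top_of_local hm hbound hb hbR hsupp (by linarith) hθ
        (hu.local_energy_diffTest hN hn hab hR (by linarith) hθp
          (hu.energy_p.trans_lt ENNReal.one_lt_top)) }

/-! ### The differenced equation and its energy estimate. -/

/-- The integrand of the difference of the equation and its translate. -/
noncomputable def translatedIntegrand {N : ℕ} (s₁ θ p c : ℝ) (u : RSpace N → ℝ)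
    (Z : RSpace N × RSpace N → ℝ) (h : RSpace N) (φ : RSpace N → ℝ) (z : RSpace N × RSpace N) : ℝ :=
  c * ((Z (z + (h, h)) - Z z) * (φ z.1 - φ z.2) / ‖z.1 - z.2‖ ^ ((N : ℝ) + s₁)) +
    (oddPow (p - 2) (u (z.1 + h) - u (z.2 + h)) - oddPow (p - 2) (u z.1 - u z.2)) *
      (φ z.1 - φ z.2) / ‖z.1 - z.2‖ ^ ((N : ℝ) + θ)

/-- Test with φ(· - h), which still lives in the unit ball since r + |h| < 1, shift both variables
by h, and subtract the equation tested with φ. All four pieces are integrable separately, so the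
subtraction is legitimate. -/
lemma NormSol.translated_equation {N : ℕ} {s₁ θ p T c : ℝ} {u : RSpace N → ℝ}
    {Z : RSpace N × RSpace N → ℝ} (hp : 2 ≤ p) (hθ : 0 < θ) (hu : NormSol s₁ θ p T c u Z)
    {φ : RSpace N → ℝ} (hφ : BallTest s₁ θ p φ) {r : ℝ} (hr : 0 < r)
    (hsupp : ∀ x, r ≤ ‖x‖ → φ x = 0) {h : RSpace N} (hh : r + ‖h‖ < 1) :
    Integrable (translatedIntegrand s₁ θ p c u Z h φ) ∧
      ∫ z, translatedIntegrand s₁ θ p c u Z h φ z = 0 := by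
  have hφ' := hφ.translate hr hsupp hh
  have i1 := hu.integrable_sign_part hφ
  have i2 := hu.integrable_p_part hp hθ hφ
  have i3 := (hu.integrable_sign_part hφ').comp_add_right ((h, h) : RSpace N × RSpace N)
  have i4 := (hu.integrable_p_part hp hθ hφ').comp_add_right ((h, h) : RSpace N × RSpace N)
  have e1 := hu.equation φ hφ
  have e2 := hu.equation _ hφ'
  rw [← integral_add_right_eq_self _ ((h, h) : RSpace N × RSpace N),
    ← integral_add_right_eq_self (fun z : RSpace N × RSpace N =>
      oddPow (p - 2) (u z.1 - u z.2) * _ / _) ((h, h) : RSpace N × RSpace N)] at e2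
  simp only [Prod.fst_add, Prod.snd_add, add_sub_cancel_right, add_sub_add_right_eq_sub]
    at i3 i4 e2
  have e : translatedIntegrand s₁ θ p c u Z h φ = fun z =>
      (c * (Z (z + (h, h)) * (φ z.1 - φ z.2) / ‖z.1 - z.2‖ ^ ((N : ℝ) + s₁)) +
        oddPow (p - 2) (u (z.1 + h) - u (z.2 + h)) * (φ z.1 - φ z.2) /
          ‖z.1 - z.2‖ ^ ((N : ℝ) + θ)) -
      (c * (Z z * (φ z.1 - φ z.2) / ‖z.1 - z.2‖ ^ ((N : ℝ) + s₁)) +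
        oddPow (p - 2) (u z.1 - u z.2) * (φ z.1 - φ z.2) /
          ‖z.1 - z.2‖ ^ ((N : ℝ) + θ)) := by
    ext z; unfold translatedIntegrand; ring
  have j₁ := (i3.const_mul c).add i4
  have j₂ := (i1.const_mul c).add i2
  simp only [Pi.add_def] at j₁ j₂
  rw [e]
  refine ⟨j₁.sub j₂, ?_⟩
  rw [integral_sub j₁ j₂, integral_add (i3.const_mul c) i4, integral_add (i1.const_mul c) i2, integral_const_mul,
    integral_const_mul, e1, e2, sub_self]

lemma lintegral_tail_translate_le {N : ℕ} {k q : ℝ} (hk : 0 ≤ k) {h : RSpace N} (hh : ‖h‖ ≤ 1)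
    {u : RSpace N → ℝ} :
    ∫⁻ y, ENNReal.ofReal (|u (y + h)| ^ q / (1 + ‖y‖) ^ k) ≤
      ENNReal.ofReal (2 ^ k) * ∫⁻ y, ENNReal.ofReal (|u y| ^ q / (1 + ‖y‖) ^ k) := by
  rw [← lintegral_const_mul' _ _ ENNReal.ofReal_ne_top,
    ← lintegral_add_right_eq_self (fun y => _ * ENNReal.ofReal (|u y| ^ q / (1 + ‖y‖) ^ k)) h]
  refine lintegral_mono fun y => ?_
  rw [← ENNReal.ofReal_mul (by positivity)]
  apply ENNReal.ofReal_le_ofReal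
  have h1 : 1 + ‖y + h‖ ≤ 2 * (1 + ‖y‖) := by
    have := norm_add_le y h
    have := norm_nonneg y
    linarith
  have h2 : (1 + ‖y + h‖) ^ k ≤ 2 ^ k * (1 + ‖y‖) ^ k := by
    rw [← Real.mul_rpow (by norm_num) (by positivity)]
    exact Real.rpow_le_rpow (by positivity) h1 hk
  rw [mul_div_assoc', div_le_div_iff₀ (by positivity) (by positivity)]
  have h3 : 0 ≤ |u (y + h)| ^ q := by positivity
  nlinarith

/-- The tail weight appearing in the far interactions. -/
noncomputable def farWeight {N : ℕ} (s₁ θ p κ₁ κ₂ : ℝ) (h : RSpace N) (u : RSpace N → ℝ)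
    (y : RSpace N) : ℝ≥0∞ :=
  ENNReal.ofReal (κ₁ * (1 / (1 + ‖y‖) ^ ((N : ℝ) + s₁))) + ENNReal.ofReal κ₂ *
    (ENNReal.ofReal (1 / (1 + ‖y‖) ^ ((N : ℝ) + θ)) +
      (ENNReal.ofReal (|u y| ^ (p - 1) / (1 + ‖y‖) ^ ((N : ℝ) + θ)) +
        ENNReal.ofReal (|u (y + h)| ^ (p - 1) / (1 + ‖y‖) ^ ((N : ℝ) + θ))))

/-- The bound is uniform over all normalised solutions and shifts |h| ≤ 1 because u enters only
through its tail, which is bounded by T, and shifting changes the weight by a bounded factor. -/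
lemma exists_lintegral_farWeight_le (N : ℕ) {s₁ θ : ℝ} (p T κ₁ κ₂ : ℝ) (hs₁ : 0 < s₁)
    (hθ : 0 < θ) (hκ₁ : 0 ≤ κ₁) :
    ∃ Γ : ℝ, 0 ≤ Γ ∧ ∀ (c : ℝ) (u : RSpace N → ℝ) (Z : RSpace N × RSpace N → ℝ),
      NormSol s₁ θ p T c u Z → ∀ h : RSpace N, ‖h‖ ≤ 1 →
        ∫⁻ y, farWeight s₁ θ p κ₁ κ₂ h u y ≤ ENNReal.ofReal Γ := by
  set I₁ := ∫⁻ x : RSpace N, ENNReal.ofReal (1 / (1 + ‖x‖) ^ ((N : ℝ) + s₁)) with hI₁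
  set I₂ := ∫⁻ x : RSpace N, ENNReal.ofReal (1 / (1 + ‖x‖) ^ ((N : ℝ) + θ)) with hI₂
  have h1 : I₁ < ⊤ := lintegral_one_add_norm_lt_top N hs₁
  have h2 : I₂ < ⊤ := lintegral_one_add_norm_lt_top N hθ
  set Γ : ℝ≥0∞ := ENNReal.ofReal κ₁ * I₁ + ENNReal.ofReal κ₂ *
    (I₂ + (ENNReal.ofReal T + ENNReal.ofReal (2 ^ ((N : ℝ) + θ)) * ENNReal.ofReal T)) with hΓ
  have hΓt : Γ ≠ ⊤ := by
    refine (ENNReal.add_lt_top.2 ⟨ENNReal.mul_lt_top ENNReal.ofReal_lt_top h1,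
      ENNReal.mul_lt_top ENNReal.ofReal_lt_top (ENNReal.add_lt_top.2 ⟨h2,
        ENNReal.add_lt_top.2 ⟨ENNReal.ofReal_lt_top,
          ENNReal.mul_lt_top ENNReal.ofReal_lt_top ENNReal.ofReal_lt_top⟩⟩)⟩).ne
  refine ⟨Γ.toReal, ENNReal.toReal_nonneg, ?_⟩
  intro c u Z hu h hh
  have hum := hu.measurable
  rw [ENNReal.ofReal_toReal hΓt]
  unfold farWeight
  simp_rw [ENNReal.ofReal_mul hκ₁]
  rw [lintegral_add_left (by fun_prop), lintegral_const_mul' _ _ ENNReal.ofReal_ne_top,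
    lintegral_const_mul' _ _ ENNReal.ofReal_ne_top, lintegral_add_left (by fun_prop),
    lintegral_add_left (by fun_prop), hΓ]
  gcongr
  · exact hu.tail
  · exact (lintegral_tail_translate_le (by positivity) hh).trans (mul_le_mul_right hu.tail _)

/-- The test function vanishes at y, so only its value at x in the smaller ball survives. That value
is at most |δ_h u(x)|^(n+1), which keeps the smallness in h, and everything else is absorbed into an
integrable weight in y. -/
lemma NormSol.translatedIntegrand_far {N : ℕ} {s₁ θ p T c n a b R : ℝ} {u : RSpace N → ℝ}
    {Z : RSpace N × RSpace N → ℝ} (hp : 2 ≤ p) (hu : NormSol s₁ θ p T c u Z) (hs₁ : 0 < s₁)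
    (hθ : 0 < θ) (hn : 0 ≤ n) (hb : 0 < b) (hab : a < b) (hbR : b < R) {h : RSpace N}
    (hR : R + ‖h‖ ≤ 1) {x y : RSpace N} {z w : ℝ} (hz : |z| ≤ 1) (hw : |w| ≤ 1)
    (hy : y ∉ Metric.ball (0 : RSpace N) R) :
    ENNReal.ofReal |c * ((z - w) * diffTest n a b h u x / ‖x - y‖ ^ ((N : ℝ) + s₁)) +
      (oddPow (p - 2) (u (x + h) - u (y + h)) - oddPow (p - 2) (u x - u y)) *
        diffTest n a b h u x / ‖x - y‖ ^ ((N : ℝ) + θ)| ≤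
      (Metric.ball (0 : RSpace N) b).indicator (fun x => ‖delta h u x‖ₑ ^ (n + 1)) x *
        farWeight s₁ θ p (2 * ((R - b) / (1 + R)) ^ (-((N : ℝ) + s₁)))
          (2 ^ p * ((R - b) / (1 + R)) ^ (-((N : ℝ) + θ))) h u y := by
  rw [mem_ball_zero_iff, not_lt] at hy
  by_cases hx : x ∈ Metric.ball (0 : RSpace N) b
  swap
  · rw [mem_ball_zero_iff, not_lt] at hx
    rw [diffTest_eq_zero hab h u hx]; simp
  have hxR : ‖x‖ < b := mem_ball_zero_iff.1 hx
  rw [Set.indicator_of_mem hx]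
  set κ₁ := ((R - b) / (1 + R)) ^ (-((N : ℝ) + s₁)) with hκ₁
  set κ₂ := ((R - b) / (1 + R)) ^ (-((N : ℝ) + θ)) with hκ₂
  have hRb : 0 ≤ (R - b) / (1 + R) := div_nonneg (by linarith) (by linarith)
  have hκ₁0 : 0 ≤ κ₁ := Real.rpow_nonneg hRb _
  have hκ₂0 : 0 ≤ κ₂ := Real.rpow_nonneg hRb _
  set D := |delta h u x| ^ (n + 1) with hD
  have hD0 : 0 ≤ D := by positivity
  have hφ : |diffTest n a b h u x| ≤ D := abs_diffTest_le hn h u x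
  set v := |u y| ^ (p - 1) with hv
  set v' := |u (y + h)| ^ (p - 1) with hv'
  have hv0 : 0 ≤ v := by positivity
  have hv0' : 0 ≤ v' := by positivity
  have hux : |u x| ^ (p - 1) ≤ 1 := Real.rpow_le_one (abs_nonneg _)
    (hu.bound x (by rw [mem_ball_zero_iff]; linarith [norm_nonneg h])) (by linarith)
  have huxh : |u (x + h)| ^ (p - 1) ≤ 1 := Real.rpow_le_one (abs_nonneg _)
    (hu.bound _ (by rw [mem_ball_zero_iff]; exact (norm_add_le _ _).trans_lt (by linarith)))
    (by linarith)
  have hp2 : p - 2 + 1 = p - 1 := by ring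
  have hJ1 : |oddPow (p - 2) (u (x + h) - u (y + h))| ≤ 2 ^ (p - 1) * (1 + v') := by
    rw [abs_oddPow (by linarith), hp2]
    exact (abs_sub_rpow_le (by linarith) _ _).trans (by gcongr)
  have hJ2 : |oddPow (p - 2) (u x - u y)| ≤ 2 ^ (p - 1) * (1 + v) := by
    rw [abs_oddPow (by linarith), hp2]
    exact (abs_sub_rpow_le (by linarith) _ _).trans (by gcongr)
  have h2p : (2 : ℝ) ^ p = 2 ^ (p - 1) * 2 := by
    rw [← Real.rpow_add_one (by norm_num)]; congr 1; ring
  have hJ : |oddPow (p - 2) (u (x + h) - u (y + h)) - oddPow (p - 2) (u x - u y)| ≤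
      2 ^ p * (1 + v + v') := by
    refine (abs_sub _ _).trans ?_
    have hpos : (0 : ℝ) ≤ 2 ^ (p - 1) := by positivity
    rw [h2p]
    nlinarith
  have hzw : |z - w| ≤ 2 := by have := abs_sub z w; linarith
  have hk1 := div_norm_rpow_far_le (σ := N + s₁) hb.le hbR (by positivity)
    (by positivity : 0 ≤ 2 * D) hxR.le hy
  have hk2 := div_norm_rpow_far_le (σ := N + θ) hb.le hbR (by positivity)
    (by positivity : 0 ≤ 2 ^ p * (1 + v + v') * D) hxR.le hy
  rw [← hκ₁] at hk1
  rw [← hκ₂] at hk2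
  have hle : |c * ((z - w) * diffTest n a b h u x / ‖x - y‖ ^ ((N : ℝ) + s₁)) +
      (oddPow (p - 2) (u (x + h) - u (y + h)) - oddPow (p - 2) (u x - u y)) *
        diffTest n a b h u x / ‖x - y‖ ^ ((N : ℝ) + θ)| ≤
      2 * D / ‖x - y‖ ^ ((N : ℝ) + s₁) +
        2 ^ p * (1 + v + v') * D / ‖x - y‖ ^ ((N : ℝ) + θ) := by
    refine (abs_add_le _ _).trans ?_
    rw [abs_mul c, abs_div, abs_div, abs_mul, abs_mul, abs_of_nonneg hu.coeff_nonneg,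
      abs_of_nonneg (Real.rpow_nonneg (norm_nonneg (x - y)) ((N : ℝ) + s₁)),
      abs_of_nonneg (Real.rpow_nonneg (norm_nonneg (x - y)) ((N : ℝ) + θ))]
    gcongr
    refine (mul_le_of_le_one_left (by positivity) hu.coeff_le_one).trans ?_
    gcongr
  refine (ENNReal.ofReal_le_ofReal (hle.trans (add_le_add hk1 hk2))).trans ?_
  unfold farWeight
  rw [← ofReal_abs_rpow (by linarith), ← hD, ← hv, ← hv',
    ← ENNReal.ofReal_add (by positivity) (by positivity),
    ← ENNReal.ofReal_add (by positivity) (by positivity), ← ENNReal.ofReal_mul (by positivity),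
    ← ENNReal.ofReal_add (by positivity) (by positivity), ← ENNReal.ofReal_mul (by positivity)]
  apply ENNReal.ofReal_le_ofReal
  apply le_of_eq
  ring

/-- Combines the two monotonicity bounds. The localisation error is quadratic in the cutoff
difference for the order-p part and linear for the sign part, which weakens the kernels to |x -
y|^(2 - θ - N) and |x - y|^(1 - s₁ - N). -/
lemma NormSol.translatedIntegrand_local {N : ℕ} {s₁ θ p T c n a b R c₀ C₀ : ℝ} {u : RSpace N → ℝ}
    {Z : RSpace N × RSpace N → ℝ} (hu : NormSol s₁ θ p T c u Z)
    (hn : 0 ≤ n) (hab : a < b) (hc₀ : 0 ≤ c₀) (hC₀ : 0 ≤ C₀)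
    (hmono : ∀ a b A B s t : ℝ, a - b = A - B → 0 ≤ s → 0 ≤ t →
      c₀ * |a - b| ^ (p - 2 + n + 2) * (s ^ 2 + t ^ 2) -
        C₀ * (|a| ^ (p - 2) + |b| ^ (p - 2)) * (|A| ^ (n + 2) + |B| ^ (n + 2)) * (s - t) ^ 2 ≤
      (oddPow (p - 2) a - oddPow (p - 2) b) * (oddPow n A * s ^ 2 - oddPow n B * t ^ 2))
    {h : RSpace N} (hR : R + ‖h‖ ≤ 1) {x y : RSpace N} {z w : ℝ}
    (hz : z ∈ setSign (u (x + h) - u (y + h))) (hw : w ∈ setSign (u x - u y))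
    (hx : x ∈ Metric.ball (0 : RSpace N) R) (hy : y ∈ Metric.ball (0 : RSpace N) R) :
    c₀ * |delta h u x - delta h u y| ^ (p + n) * (cutoff a b x ^ 2 * cutoff a b y ^ 2) /
        ‖x - y‖ ^ ((N : ℝ) + θ) -
      (c * ((z - w) * (diffTest n a b h u x - diffTest n a b h u y) / ‖x - y‖ ^ ((N : ℝ) + s₁)) +
        (oddPow (p - 2) (u (x + h) - u (y + h)) - oddPow (p - 2) (u x - u y)) *
          (diffTest n a b h u x - diffTest n a b h u y) / ‖x - y‖ ^ ((N : ℝ) + θ)) ≤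
      (2 * C₀ * (b - a)⁻¹ ^ 2 + 2 * (b - a)⁻¹) *
        ((|delta h u x| ^ (n + 1) + |delta h u y| ^ (n + 1)) *
        ((|u (x + h) - u (y + h)| ^ (p - 2) + |u x - u y| ^ (p - 2)) * ‖x - y‖ ^ (2 - θ - N) +
          ‖x - y‖ ^ (1 - s₁ - N))) := by
  set A := delta h u x with hA
  set B := delta h u y with hB
  set s := cutoff a b x with hs
  set t := cutoff a b y with ht
  set L := (b - a)⁻¹ with hL
  have hL0 : 0 ≤ L := inv_nonneg.2 (by linarith)
  have hs0 : 0 ≤ s := cutoff_nonneg x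
  have hs1 : s ≤ 1 := cutoff_le_one x
  have ht0 : 0 ≤ t := cutoff_nonneg y
  have ht1 : t ≤ 1 := cutoff_le_one y
  have hst : |s - t| ≤ L * ‖x - y‖ := abs_cutoff_sub_le hab x y
  have hAB : u (x + h) - u (y + h) - (u x - u y) = A - B := by rw [hA, hB]; unfold delta; ring
  have hA2 : |A| ≤ 2 := hu.abs_delta_le hR hx
  have hB2 : |B| ≤ 2 := hu.abs_delta_le hR hy
  have h1 := hmono _ _ A B s t hAB hs0 ht0
  have h2 := sign_energy_lower hn hz hw hAB (sq_nonneg s) (sq_nonneg t)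
  rw [hAB, show p - 2 + n + 2 = p + n by ring] at h1
  have hφ : diffTest n a b h u x - diffTest n a b h u y = oddPow n A * s ^ 2 - oddPow n B * t ^ 2 :=
    rfl
  rw [hφ]
  set k₁ := ‖x - y‖ ^ ((N : ℝ) + s₁) with hk₁
  set k₂ := ‖x - y‖ ^ ((N : ℝ) + θ) with hk₂
  have hk₁0 : 0 ≤ k₁ := by positivity
  have hk₂0 : 0 ≤ k₂ := by positivity
  set W := |u (x + h) - u (y + h)| ^ (p - 2) + |u x - u y| ^ (p - 2) with hW
  have hW0 : 0 ≤ W := by positivity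
  set S := |A| ^ (n + 1) + |B| ^ (n + 1) with hS
  have hS0 : 0 ≤ S := by positivity
  set g := oddPow n A * s ^ 2 - oddPow n B * t ^ 2
  -- Boundedness of the differences lowers the power n + 2 to n + 1, so that both errors carry the
  -- same weight.
  have hpow : ∀ X : ℝ, |X| ≤ 2 → |X| ^ (n + 2) ≤ 2 * |X| ^ (n + 1) := by
    intro X hX
    rw [show n + 2 = n + 1 + 1 by ring, Real.rpow_add_of_nonneg (abs_nonneg X) (by linarith)
      zero_le_one, Real.rpow_one, mul_comm]
    gcongr
  have hH : |A| ^ (n + 2) + |B| ^ (n + 2) ≤ 2 * S := by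
    have := hpow A hA2
    have := hpow B hB2
    rw [hS]; linarith
  have hsq : (s - t) ^ 2 ≤ L ^ 2 * ‖x - y‖ ^ (2 : ℝ) := by
    rw [Real.rpow_two, ← mul_pow, ← sq_abs (s - t)]
    gcongr
  have hst2 : |s ^ 2 - t ^ 2| ≤ 2 * L * ‖x - y‖ ^ (1 : ℝ) := by
    rw [show s ^ 2 - t ^ 2 = (s + t) * (s - t) by ring, abs_mul, abs_of_nonneg (by linarith),
      Real.rpow_one, mul_assoc]
    gcongr
    linarith
  -- The product of the cutoffs is kept instead of their sum, so that the energy density vanishes as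
  -- soon as one of the points leaves the support.
  have hsts : s ^ 2 * t ^ 2 ≤ s ^ 2 + t ^ 2 := by
    have : t ^ 2 ≤ 1 := pow_le_one₀ ht0 ht1
    exact (mul_le_of_le_one_right (sq_nonneg s) this).trans (le_add_of_nonneg_right (sq_nonneg t))
  have e1 : c₀ * |A - B| ^ (p + n) * (s ^ 2 * t ^ 2) -
      (oddPow (p - 2) (u (x + h) - u (y + h)) - oddPow (p - 2) (u x - u y)) * g ≤
      C₀ * W * (2 * S) * (L ^ 2 * ‖x - y‖ ^ (2 : ℝ)) := by
    have i1 : c₀ * |A - B| ^ (p + n) * (s ^ 2 * t ^ 2) ≤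
      c₀ * |A - B| ^ (p + n) * (s ^ 2 + t ^ 2) := by gcongr
    have i2 : C₀ * W * (|A| ^ (n + 2) + |B| ^ (n + 2)) * (s - t) ^ 2 ≤
      C₀ * W * (2 * S) * (L ^ 2 * ‖x - y‖ ^ (2 : ℝ)) := by gcongr
    linarith only [i1, i2, h1]
  have e2 : -(c * ((z - w) * g)) ≤ S * (2 * L * ‖x - y‖ ^ (1 : ℝ)) := by
    have i1 : S * |s ^ 2 - t ^ 2| ≤ S * (2 * L * ‖x - y‖ ^ (1 : ℝ)) := by gcongr
    have i2 : 0 ≤ S * |s ^ 2 - t ^ 2| := by positivity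
    have i3 := mul_le_mul_of_nonneg_left h2 hu.coeff_nonneg
    have i4 := mul_le_of_le_one_left i2 hu.coeff_le_one
    linarith only [i1, i3, i4]
  have d1 := norm_rpow_div_rpow_le (q := 2) (k := N + θ) (by norm_num) (x - y)
  have d2 := norm_rpow_div_rpow_le (q := 1) (k := N + s₁) (by norm_num) (x - y)
  rw [show (2 : ℝ) - (N + θ) = 2 - θ - N by ring, ← hk₂] at d1
  rw [show (1 : ℝ) - (N + s₁) = 1 - s₁ - N by ring, ← hk₁] at d2
  set n₁ := ‖x - y‖ ^ (1 - s₁ - N) with hn₁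
  set n₂ := ‖x - y‖ ^ (2 - θ - N) with hn₂
  have hn₁0 : 0 ≤ n₁ := by positivity
  have hn₂0 : 0 ≤ n₂ := by positivity
  have f1 := div_le_div_of_nonneg_right e1 hk₂0
  have f2 := div_le_div_of_nonneg_right e2 hk₁0
  have g1 : C₀ * W * (2 * S) * (L ^ 2 * ‖x - y‖ ^ (2 : ℝ)) / k₂ ≤
      2 * C₀ * L ^ 2 * (S * (W * n₂)) := by
    calc _ = 2 * C₀ * L ^ 2 * (S * (W * (‖x - y‖ ^ (2 : ℝ) / k₂))) := by ring
      _ ≤ _ := by gcongr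
  have g2 : S * (2 * L * ‖x - y‖ ^ (1 : ℝ)) / k₁ ≤ 2 * L * (S * n₁) := by
    calc _ = 2 * L * (S * (‖x - y‖ ^ (1 : ℝ) / k₁)) := by ring
      _ ≤ _ := by gcongr
  have g3 : 0 ≤ 2 * C₀ * L ^ 2 * (S * n₁) := by positivity
  have g4 : 0 ≤ 2 * L * (S * (W * n₂)) := by positivity
  rw [sub_div] at f1
  have f3 : -(c * ((z - w) * g)) / k₁ = -(c * ((z - w) * g / k₁)) := by ring
  rw [f3] at f2
  have e3 : (2 * C₀ * L ^ 2 + 2 * L) * (S * (W * n₂ + n₁)) =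
      2 * C₀ * L ^ 2 * (S * (W * n₂)) + 2 * L * (S * n₁) +
      (2 * C₀ * L ^ 2 * (S * n₁) + 2 * L * (S * (W * n₂))) := by ring
  rw [e3]
  linarith only [f1, f2, g1, g2, g3, g4]

/-- Energy estimate for the finite differences of a normalised solution. -/
lemma exists_energy_estimate {N : ℕ} (hN : 1 ≤ N) {s₁ θ p T n a b R : ℝ} (hp : 2 ≤ p)
    (hs₁ : 0 < s₁) (hs₁' : s₁ < 1) (hθ : 0 < θ) (hθp : θ < p) (hn : 0 ≤ n) (hb : 0 < b)
    (hab : a < b) (hbR : b < R) :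
    ∃ C : ℝ, 0 ≤ C ∧ ∀ (c : ℝ) (u : RSpace N → ℝ) (Z : RSpace N × RSpace N → ℝ),
      NormSol s₁ θ p T c u Z → ∀ h : RSpace N, R + ‖h‖ ≤ 1 →
      ∫⁻ x in Metric.ball 0 a, ∫⁻ y in Metric.ball 0 a, ENNReal.ofReal
        (|delta h u x - delta h u y| ^ (p + n) / ‖x - y‖ ^ ((N : ℝ) + θ)) ≤
      ENNReal.ofReal C * ((∫⁻ x in Metric.ball 0 R, ∫⁻ y in Metric.ball 0 R, ENNReal.ofReal
        ((|delta h u x| ^ (n + 1) + |delta h u y| ^ (n + 1)) *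
        ((|u (x + h) - u (y + h)| ^ (p - 2) + |u x - u y| ^ (p - 2)) * ‖x - y‖ ^ (2 - θ - N) +
          ‖x - y‖ ^ (1 - s₁ - N)))) + ∫⁻ x in Metric.ball 0 b, ‖delta h u x‖ₑ ^ (n + 1)) := by
  obtain ⟨c₀, C₀, hc₀, hC₀, hmono⟩ := monotone_energy_lower (m := p - 2) (by linarith) hn
  have hRb : 0 ≤ (R - b) / (1 + R) := div_nonneg (by linarith) (by linarith)
  set κ₁ := 2 * ((R - b) / (1 + R)) ^ (-((N : ℝ) + s₁)) with hκ₁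
  set κ₂ := 2 ^ p * ((R - b) / (1 + R)) ^ (-((N : ℝ) + θ)) with hκ₂
  have hκ₁0 : 0 ≤ κ₁ := by positivity
  obtain ⟨Γ, hΓ0, hΓ⟩ := exists_lintegral_farWeight_le N p T κ₁ κ₂ hs₁ hθ hκ₁0
  set K := 2 * C₀ * (b - a)⁻¹ ^ 2 + 2 * (b - a)⁻¹ with hK
  have hba : 0 < b - a := by linarith
  have hK0 : 0 ≤ K := by positivity
  refine ⟨c₀⁻¹ * (K + 2 * Γ), by positivity, ?_⟩
  intro c u Z hu h hR
  have hum := hu.measurable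
  have hZm := hu.measurable_sign
  have hdm := measurable_delta h hum
  have hφm := measurable_diffTest n a b h hum
  have hcm : Measurable (cutoff a b : RSpace N → ℝ) := measurable_cutoff
  set φ := diffTest n a b h u with hφ
  obtain ⟨hint, hzero⟩ := hu.translated_equation hp hθ
    (hu.ballTest_diffTest hN hs₁ hs₁' hθ hθp hn hb hab hbR hR) hb
    (fun x hx => diffTest_eq_zero hab h u hx) (h := h) (by linarith)
  set Ψ := translatedIntegrand s₁ θ p c u Z h φ with hΨ
  have hΨm : Measurable Ψ := by
    rw [hΨ]; unfold translatedIntegrand; fun_prop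
  set P : RSpace N × RSpace N → ℝ := fun z =>
    c₀ * |delta h u z.1 - delta h u z.2| ^ (p + n) * (cutoff a b z.1 ^ 2 * cutoff a b z.2 ^ 2) /
      ‖z.1 - z.2‖ ^ ((N : ℝ) + θ) with hP
  have hPm : Measurable P := by rw [hP]; fun_prop
  -- With Q the positive part of P - Ψ the pointwise hypothesis is automatic, and what remains is to
  -- bound Q from above in the local and far regions.
  have hmain := lintegral_le_of_integral_eq_zero hint hzero (P := P)
    (Q := fun z => max 0 (P z - Ψ z)) (measurable_const.max (hPm.sub hΨm))
    (fun z => by rw [hP]; positivity) (fun z => le_max_left _ _)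
    (ae_of_all _ fun z => by have := le_max_right 0 (P z - Ψ z); linarith)
  have hsign := hu.sign
  have hsign' : ∀ᵐ z : RSpace N × RSpace N, Z (z + (h, h)) ∈ setSign (u (z.1 + h) - u (z.2 + h)) :=
    (measurePreserving_add_right volume ((h, h) : RSpace N × RSpace N)).quasiMeasurePreserving.ae
      hsign
  have hP0 : ∀ z : RSpace N × RSpace N, b ≤ ‖z.1‖ ∨ b ≤ ‖z.2‖ → P z = 0 := by
    rintro z (hz | hz) <;> simp only [hP] <;> rw [cutoff_eq_zero hab hz] <;> simp
  set A : RSpace N × RSpace N → ℝ≥0∞ := fun z => ENNReal.ofReal K * ENNReal.ofReal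
        ((|delta h u z.1| ^ (n + 1) + |delta h u z.2| ^ (n + 1)) *
        ((|u (z.1 + h) - u (z.2 + h)| ^ (p - 2) + |u z.1 - u z.2| ^ (p - 2)) *
          ‖z.1 - z.2‖ ^ (2 - θ - N) + ‖z.1 - z.2‖ ^ (1 - s₁ - N))) with hA
  have hAm : Measurable A := by rw [hA]; fun_prop
  have hfar := lintegral_prod_le_local_add_far (F := fun z => ENNReal.ofReal (max 0 (P z - Ψ z)))
    (A := A) (H := (Metric.ball (0 : RSpace N) b).indicator fun x => ‖delta h u x‖ₑ ^ (n + 1))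
    (G := farWeight s₁ θ p κ₁ κ₂ h u) (R := R) hAm
    (Measurable.indicator (by fun_prop) measurableSet_ball) (by unfold farWeight; fun_prop)
    (by
      filter_upwards [hsign, hsign'] with z h1 h2 hz1 hz2
      have := hu.translatedIntegrand_local (s₁ := s₁) (a := a) (b := b) hn hab hc₀.le hC₀ hmono hR
        h2 h1 hz1 hz2
      simp only [hA]
      rw [← ENNReal.ofReal_mul hK0]
      exact ENNReal.ofReal_le_ofReal (max_le (by positivity) this))
    (by
      filter_upwards [hsign, hsign'] with z h1 h2 hz
      have := hu.translatedIntegrand_far (a := a) hp hs₁ hθ hn hb hab hbR hR (x := z.1)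
        (abs_le_one_of_mem_setSign h2) (abs_le_one_of_mem_setSign h1) hz
      refine le_trans (ENNReal.ofReal_le_ofReal ?_) this
      rw [mem_ball_zero_iff, not_lt] at hz
      rw [hP0 z (Or.inr (hbR.le.trans hz)), zero_sub]
      refine max_le (abs_nonneg _) ((neg_le_abs _).trans (le_of_eq ?_))
      rw [hΨ]; unfold translatedIntegrand
      rw [hφ, diffTest_eq_zero hab h u (hbR.le.trans hz), sub_zero])
    (by
      filter_upwards [hsign, hsign'] with z h1 h2 hz
      -- The mirrored region reduces to the previous one by antisymmetry: exchanging the variables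
      -- flips the odd power and the test difference, and -Z takes the place of Z.
      have := hu.translatedIntegrand_far (a := a) hp hs₁ hθ hn hb hab hbR hR (x := z.2)
        (abs_neg (Z (z + (h, h))) ▸ abs_le_one_of_mem_setSign h2)
        (abs_neg (Z z) ▸ abs_le_one_of_mem_setSign h1) hz
      refine le_trans (ENNReal.ofReal_le_ofReal ?_) this
      rw [mem_ball_zero_iff, not_lt] at hz
      rw [hP0 z (Or.inl (hbR.le.trans hz)), zero_sub]
      refine max_le (abs_nonneg _) ((neg_le_abs _).trans (le_of_eq ?_))
      rw [hΨ]; unfold translatedIntegrand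
      have hodd : ∀ t, oddPow (p - 2) (-t) = -oddPow (p - 2) t := by
        intro t; unfold oddPow; rw [abs_neg]; ring
      rw [hφ, diffTest_eq_zero hab h u (hbR.le.trans hz), zero_sub, norm_sub_rev z.1 z.2,
        ← neg_sub (u (z.2 + h)), ← neg_sub (u z.2), hodd, hodd]
      congr 1; ring)
  have hlow : ENNReal.ofReal c₀ * ∫⁻ x in Metric.ball 0 a, ∫⁻ y in Metric.ball 0 a, ENNReal.ofReal
        (|delta h u x - delta h u y| ^ (p + n) / ‖x - y‖ ^ ((N : ℝ) + θ)) ≤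
      ∫⁻ z, ENNReal.ofReal (P z) := by
    rw [Measure.volume_eq_prod, lintegral_prod _ (by fun_prop),
      ← lintegral_const_mul' _ _ ENNReal.ofReal_ne_top]
    refine le_trans ?_ (setLIntegral_le_lintegral (Metric.ball 0 a) _)
    refine setLIntegral_mono' measurableSet_ball fun x hx => ?_
    rw [← lintegral_const_mul' _ _ ENNReal.ofReal_ne_top]
    refine le_trans ?_ (setLIntegral_le_lintegral (Metric.ball 0 a) _)
    refine setLIntegral_mono' measurableSet_ball fun y hy => ?_
    rw [mem_ball_zero_iff] at hx hy
    rw [← ENNReal.ofReal_mul hc₀.le, hP]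
    apply ENNReal.ofReal_le_ofReal
    simp only
    rw [cutoff_eq_one hab hx.le, cutoff_eq_one hab hy.le]
    apply le_of_eq; ring
  set LHS := ∫⁻ x in Metric.ball 0 a, ∫⁻ y in Metric.ball 0 a, ENNReal.ofReal
        (|delta h u x - delta h u y| ^ (p + n) / ‖x - y‖ ^ ((N : ℝ) + θ)) with hLHS
  set I := ∫⁻ x in Metric.ball 0 R, ∫⁻ y in Metric.ball 0 R, ENNReal.ofReal
        ((|delta h u x| ^ (n + 1) + |delta h u y| ^ (n + 1)) *
        ((|u (x + h) - u (y + h)| ^ (p - 2) + |u x - u y| ^ (p - 2)) * ‖x - y‖ ^ (2 - θ - N) +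
          ‖x - y‖ ^ (1 - s₁ - N))) with hI
  set J := ∫⁻ x in Metric.ball 0 b, ‖delta h u x‖ₑ ^ (n + 1) with hJ
  have hAI : ∫⁻ x in Metric.ball 0 R, ∫⁻ y in Metric.ball 0 R, A (x, y) =
      ENNReal.ofReal K * I := by
    rw [hI, ← lintegral_const_mul' _ _ ENNReal.ofReal_ne_top]
    refine lintegral_congr fun x => ?_
    rw [← lintegral_const_mul' _ _ ENNReal.ofReal_ne_top]
  have htot : ENNReal.ofReal c₀ * LHS ≤ ENNReal.ofReal (K + 2 * Γ) * (I + J) := by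
    refine (hlow.trans (hmain.trans hfar)).trans ?_
    rw [hAI, lintegral_indicator measurableSet_ball, ← hJ]
    have hG := hΓ c u Z hu h (by linarith)
    calc ENNReal.ofReal K * I + 2 * (J * ∫⁻ y, farWeight s₁ θ p κ₁ κ₂ h u y)
        ≤ ENNReal.ofReal K * I + 2 * (J * ENNReal.ofReal Γ) := by gcongr
      _ = ENNReal.ofReal K * I + ENNReal.ofReal (2 * Γ) * J := by
        rw [ENNReal.ofReal_mul (by norm_num), ENNReal.ofReal_ofNat]; ring
      _ ≤ (ENNReal.ofReal K + ENNReal.ofReal (2 * Γ)) * (I + J) := by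
        rw [add_mul, mul_add, mul_add]
        exact add_le_add le_self_add le_add_self
      _ = _ := by rw [← ENNReal.ofReal_add hK0 (by positivity)]
  have hc0 : ENNReal.ofReal c₀⁻¹ * ENNReal.ofReal c₀ = 1 := by
    rw [← ENNReal.ofReal_mul (by positivity), inv_mul_cancel₀ hc₀.ne', ENNReal.ofReal_one]
  calc LHS = ENNReal.ofReal c₀⁻¹ * (ENNReal.ofReal c₀ * LHS) := by
        rw [← mul_assoc, hc0, one_mul]
    _ ≤ ENNReal.ofReal c₀⁻¹ * (ENNReal.ofReal (K + 2 * Γ) * (I + J)) := by gcongr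
    _ = _ := by rw [← mul_assoc, ← ENNReal.ofReal_mul (by positivity)]

/-! ### Iteration of integrability and differentiability. -/

/-- Uniform control of the `L^q` norms of finite differences of order `γ`. -/
def UniformDiffBound (N : ℕ) (s₁ θ p T q γ : ℝ) : Prop :=
  ∀ ρ : ℝ, 0 < ρ → ρ < 1 → ∃ K : ℝ, 0 ≤ K ∧
    ∀ (c : ℝ) (u : RSpace N → ℝ) (Z : RSpace N × RSpace N → ℝ),
      NormSol s₁ θ p T c u Z → DiffBound q γ ρ K u

lemma DiffBound.lintegral_le {N : ℕ} {q γ ρ K : ℝ} {u : RSpace N → ℝ} (hD : DiffBound q γ ρ K u)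
    {R : ℝ} {h : RSpace N} (hR : R + ‖h‖ ≤ ρ) :
    ∫⁻ x in Metric.ball 0 R, ‖delta h u x‖ₑ ^ q ≤ ENNReal.ofReal (K * ‖h‖ ^ (γ * q)) := by
  refine le_trans (lintegral_mono_set fun x hx => ?_) (hD h)
  rw [mem_ball_zero_iff] at hx
  simp only [Set.mem_ofPred_eq, mem_ball_zero_iff]
  exact ⟨by linarith [norm_nonneg h], (norm_add_le _ _).trans_lt (by linarith)⟩

lemma lintegral_rpow_mul_rpow_le {N : ℕ} {q β m X Y : ℝ} {S : Set (RSpace N)}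
    {f g : RSpace N → ℝ} (hf : Measurable f) (hg : Measurable g) (hq : 0 < q) (hβ : 0 ≤ β)
    (hm : 0 ≤ m) (hsum : β + m = q) (hX : 0 ≤ X) (hY : 0 ≤ Y)
    (h1 : ∫⁻ x in S, ‖f x‖ₑ ^ q ≤ ENNReal.ofReal X) (h2 : ∫⁻ x in S, ‖g x‖ₑ ^ q ≤ ENNReal.ofReal Y) :
    ∫⁻ x in S, ‖f x‖ₑ ^ β * ‖g x‖ₑ ^ m ≤ ENNReal.ofReal (X ^ (β / q) * Y ^ (m / q)) := by
  have h := ENNReal.lintegral_mul_norm_pow_le (μ := volume.restrict S)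
    (f := fun x => ‖f x‖ₑ ^ q) (g := fun x => ‖g x‖ₑ ^ q) (p := β / q) (q := m / q)
    (by fun_prop) (by fun_prop) (by positivity) (by positivity)
    (by rw [← add_div, hsum, div_self hq.ne'])
  simp only [← ENNReal.rpow_mul, mul_div_cancel₀ _ hq.ne'] at h
  refine h.trans ?_
  rw [ENNReal.ofReal_mul (by positivity), ← ENNReal.ofReal_rpow_of_nonneg hX (by positivity),
    ← ENNReal.ofReal_rpow_of_nonneg hY (by positivity)]
  gcongr

lemma rpow_scaling {K t γ q β : ℝ} (hK : 0 ≤ K) (ht : 0 ≤ t) (hq : 0 < q) :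
    (K * t ^ (γ * q)) ^ (β / q) = K ^ (β / q) * t ^ (γ * β) := by
  rw [Real.mul_rpow hK (by positivity), ← Real.rpow_mul ht]
  congr 2
  field_simp

/-- Hölder's inequality, difference by difference, for the weighted local interaction. -/
lemma lintegral_local_interaction_le {N : ℕ} (hN : 2 ≤ N) {θ q γ ρ K β m R : ℝ} (hθ : 0 < θ)
    (hq : 0 < q) (hβ : 0 ≤ β) (hm : 0 ≤ m) (hsum : β + m = q) (hK : 0 ≤ K)
    {u : RSpace N → ℝ} (hu : Measurable u) (hD : DiffBound q γ ρ K u) {h k : RSpace N}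
    (hR : R + ‖h‖ ≤ ρ) (hk : R + ‖k‖ ≤ ρ) :
    ∫⁻ x in Metric.ball 0 R, ∫⁻ y in Metric.ball 0 R, ‖delta h u x‖ₑ ^ β *
      ‖u (x + k) - u (y + k)‖ₑ ^ m * ENNReal.ofReal (‖x - y‖ ^ (2 - θ - N)) ≤
    ENNReal.ofReal (K * ‖h‖ ^ (γ * β)) *
      ∫⁻ z in Metric.ball (0 : RSpace N) (R + R),
        ENNReal.ofReal (‖z‖ ^ (2 - θ + γ * m - N)) := by
  have hdm := measurable_delta h hu
  set F : RSpace N × RSpace N → ℝ≥0∞ := fun z => ‖delta h u z.1‖ₑ ^ β *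
      ‖u (z.1 + k) - u (z.2 + k)‖ₑ ^ m * ENNReal.ofReal (‖z.1 - z.2‖ ^ (2 - θ - N)) with hF
  have hFm : Measurable F := by rw [hF]; fun_prop
  set B := Metric.ball (0 : RSpace N) R with hB
  have hBm : MeasurableSet B := measurableSet_ball
  set G : RSpace N → RSpace N → ℝ≥0∞ := fun x y => (B ×ˢ B).indicator F (x, y) with hG
  have hGm : Measurable (Function.uncurry G) := by
    have : Function.uncurry G = (B ×ˢ B).indicator F := by ext p; rfl
    rw [this]
    exact hFm.indicator (hBm.prod hBm)
  have e1 : ∫⁻ x in B, ∫⁻ y in B, F (x, y) = ∫⁻ x, ∫⁻ y, G x y := by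
    rw [← lintegral_indicator hBm]
    congr 1; ext x
    by_cases hx : x ∈ B
    · rw [Set.indicator_of_mem hx, ← lintegral_indicator hBm]
      congr 1; ext y
      by_cases hy : y ∈ B
      · rw [Set.indicator_of_mem hy, hG]; simp [hx, hy]
      · rw [Set.indicator_of_notMem hy, hG]; simp [hy]
    · rw [Set.indicator_of_notMem hx, hG]; simp [hx]
  change ∫⁻ x in B, ∫⁻ y in B, F (x, y) ≤ _
  -- For each fixed z = y - x, Hölder in x with weights β/q and m/q gives one factor |h|^(γβ) and
  -- one factor |z|^(γm). The latter softens the kernel, which matters because 2 - θ may be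
  -- negative.
  rw [e1, lintegral_lintegral_eq_translate hGm, ← lintegral_const_mul' _ _ ENNReal.ofReal_ne_top,
    ← lintegral_indicator measurableSet_ball]
  refine lintegral_mono fun z => ?_
  set S : Set (RSpace N) := {x | x ∈ B ∧ x + z ∈ B} with hS
  have hSm : MeasurableSet S := measurableSet_inter_translate R z
  have hGS : ∀ x, G x (x + z) = S.indicator (fun x => F (x, x + z)) x := by
    intro x
    by_cases hx : x ∈ S
    · rw [Set.indicator_of_mem hx]
      exact Set.indicator_of_mem (show (x, x + z) ∈ B ×ˢ B from hx) F
    · rw [Set.indicator_of_notMem hx]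
      exact Set.indicator_of_notMem (show (x, x + z) ∉ B ×ˢ B from hx) F
  simp_rw [hGS]
  rw [lintegral_indicator hSm]
  by_cases hz : z ∈ Metric.ball (0 : RSpace N) (R + R)
  swap
  · rw [Set.indicator_of_notMem hz]
    have : S = ∅ := by
      ext x
      simp only [hS, Set.mem_ofPred_eq, Set.mem_empty_iff_false, iff_false]
      rintro ⟨h1, h2⟩
      apply hz
      rw [hB, mem_ball_zero_iff] at h1 h2
      rw [mem_ball_zero_iff]
      have : z = (x + z) - x := by abel
      rw [this]
      exact (norm_sub_le _ _).trans_lt (by linarith)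
    rw [this]; simp
  rw [Set.indicator_of_mem hz]
  have e2 : ∀ x, F (x, x + z) = ENNReal.ofReal (‖z‖ ^ (2 - θ - N)) *
      (‖delta h u x‖ₑ ^ β * ‖u (x + z + k) - u (x + k)‖ₑ ^ m) := by
    intro x
    simp only [hF]
    rw [show x - (x + z) = -z by abel, norm_neg, enorm_sub_rev, mul_comm]
  simp_rw [e2]
  rw [lintegral_const_mul' _ _ ENNReal.ofReal_ne_top]
  have b1 : ∫⁻ x in S, ‖delta h u x‖ₑ ^ q ≤ ENNReal.ofReal (K * ‖h‖ ^ (γ * q)) :=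
    (lintegral_mono_set fun x hx => hx.1).trans (hD.lintegral_le hR)
  have b2 : ∫⁻ x in S, ‖u (x + z + k) - u (x + k)‖ₑ ^ q ≤ ENNReal.ofReal (K * ‖z‖ ^ (γ * q)) := by
    refine le_trans ?_ (hD z)
    have := lintegral_comp_add_le hSm (measurableSet_inter_translate ρ z) k (fun x hx => by
      simp only [hS, hB, Set.mem_ofPred_eq, mem_ball_zero_iff] at hx ⊢
      refine ⟨(norm_add_le _ _).trans_lt (by linarith), ?_⟩
      rw [add_right_comm]
      exact (norm_add_le _ _).trans_lt (by linarith)) (fun x => ‖u (x + z) - u x‖ₑ ^ q)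
    simp_rw [add_right_comm _ z k]
    exact this
  have b3 := lintegral_rpow_mul_rpow_le hdm (by fun_prop) hq hβ hm hsum (by positivity)
    (by positivity) b1 b2
  refine (mul_le_mul_right b3 _).trans ?_
  rw [rpow_scaling hK (norm_nonneg h) hq, rpow_scaling hK (norm_nonneg z) hq,
    ← ENNReal.ofReal_mul (by positivity), ← ENNReal.ofReal_mul (by positivity)]
  apply ENNReal.ofReal_le_ofReal
  have hKe : K ^ (β / q) * K ^ (m / q) = K := by
    rw [← Real.rpow_add_of_nonneg hK (by positivity) (by positivity), ← add_div, hsum,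
      div_self hq.ne', Real.rpow_one]
  -- At z = 0 the exponent 2 - θ - N is nonzero, because N ≥ 2 and θ > 0, so the power of zero is
  -- zero by convention.
  rcases eq_or_ne z 0 with rfl | hz0
  · have : (2 : ℝ) - θ - N ≠ 0 := by
      have : (2 : ℝ) ≤ N := by exact_mod_cast hN
      linarith
    rw [norm_zero, Real.zero_rpow this, zero_mul]
    positivity
  · have hzp : 0 < ‖z‖ := norm_pos_iff.2 hz0
    rw [show 2 - θ + γ * m - N = (2 - θ - N) + γ * m by ring, Real.rpow_add hzp]
    apply le_of_eq
    calc _ = (K ^ (β / q) * K ^ (m / q)) * ‖h‖ ^ (γ * β) *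
          (‖z‖ ^ (2 - θ - N) * ‖z‖ ^ (γ * m)) := by ring
      _ = _ := by rw [hKe]

lemma lintegral_delta_rpow_le {N : ℕ} {q γ ρ K β m R : ℝ} (hq : 0 < q) (hβ : 0 ≤ β)
    (hm : 0 ≤ m) (hsum : β + m = q) (hK : 0 ≤ K) {u : RSpace N → ℝ} (hu : Measurable u)
    (hD : DiffBound q γ ρ K u) {h : RSpace N} (hR : R + ‖h‖ ≤ ρ) :
    ∫⁻ x in Metric.ball 0 R, ‖delta h u x‖ₑ ^ β ≤ ENNReal.ofReal
      (K ^ (β / q) * ‖h‖ ^ (γ * β) * (volume (Metric.ball (0 : RSpace N) R)).toReal ^ (m / q)) := by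
  have hdm := measurable_delta h hu
  have h1 : ∫⁻ _ in Metric.ball (0 : RSpace N) R, ‖(1 : ℝ)‖ₑ ^ q ≤
      ENNReal.ofReal (volume (Metric.ball (0 : RSpace N) R)).toReal := by
    rw [setLIntegral_const, ENNReal.ofReal_toReal measure_ball_lt_top.ne]
    simp
  have := lintegral_rpow_mul_rpow_le hdm (measurable_const (a := (1 : ℝ))) hq hβ hm hsum
    (by positivity) ENNReal.toReal_nonneg (hD.lintegral_le hR) h1
  rw [rpow_scaling hK (norm_nonneg h) hq] at this
  simpa using this

lemma lintegral_swap_ball {N : ℕ} {R : ℝ} {F : RSpace N → RSpace N → ℝ≥0∞}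
    (hF : Measurable (Function.uncurry F)) :
    ∫⁻ x in Metric.ball 0 R, ∫⁻ y in Metric.ball 0 R, F y x =
      ∫⁻ x in Metric.ball 0 R, ∫⁻ y in Metric.ball 0 R, F x y :=
  (lintegral_lintegral_swap hF.aemeasurable).symm

/-- Energy of finite differences in terms of a difference bound. -/
lemma exists_energy_bound_of_diffBound {N : ℕ} (hN : 2 ≤ N) {s₁ θ p T q γ ρ K a b R : ℝ}
    (hp : 2 ≤ p) (hs₁ : 0 < s₁) (hs₁' : s₁ < 1) (hθ : 0 < θ) (hθp : θ < p) (hq : p ≤ q)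
    (hγ : 0 < 2 - θ + γ * (p - 2)) (hK : 0 ≤ K) (hb : 0 < b) (hab : a < b) (hbR : b < R)
    (hρ : ρ ≤ 1) :
    ∃ C : ℝ, 0 ≤ C ∧ ∀ (c : ℝ) (u : RSpace N → ℝ) (Z : RSpace N × RSpace N → ℝ),
      NormSol s₁ θ p T c u Z → DiffBound q γ ρ K u → ∀ h : RSpace N, R + ‖h‖ ≤ ρ →
      ∫⁻ x in Metric.ball 0 a, ∫⁻ y in Metric.ball 0 a, ENNReal.ofReal
        (|delta h u x - delta h u y| ^ (q + 1) / ‖x - y‖ ^ ((N : ℝ) + θ)) ≤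
      ENNReal.ofReal (C * ‖h‖ ^ (γ * (q - p + 2))) := by
  -- This n makes the energy exponent p + n equal to q + 1, while the error weight n + 1 and the
  -- factor of power p - 2 together use exactly q integrable powers.
  obtain ⟨C, hC, hE⟩ := exists_energy_estimate (T := T) (n := q - p + 1) (by omega : 1 ≤ N) hp hs₁
    hs₁' hθ hθp (by linarith) hb hab hbR
  have hq0 : 0 < q := by linarith
  set β := q - p + 2 with hβ
  have hβ0 : 0 ≤ β := by linarith
  have hm0 : 0 ≤ p - 2 := by linarith
  have hsum : β + (p - 2) = q := by rw [hβ]; ring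
  have hn : q - p + 1 + 1 = β := by rw [hβ]; ring
  have hpn : p + (q - p + 1) = q + 1 := by ring
  rw [hn, hpn] at hE
  set I₁ := ∫⁻ z in Metric.ball (0 : RSpace N) (R + R),
        ENNReal.ofReal (‖z‖ ^ (2 - θ + γ * (p - 2) - N)) with hI₁
  set I₂ := ∫⁻ z in Metric.ball (0 : RSpace N) (R + R), ENNReal.ofReal (‖z‖ ^ (1 - s₁ - N)) with hI₂
  have hI₁t : I₁ ≠ ⊤ := (lintegral_ball_norm_rpow_lt_top (by omega) hγ _).ne
  have hI₂t : I₂ ≠ ⊤ := (lintegral_ball_norm_rpow_lt_top (by omega) (by linarith) _).ne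
  set V := (volume (Metric.ball (0 : RSpace N) R)).toReal ^ ((p - 2) / q) with hV
  have hV0 : 0 ≤ V := by positivity
  refine ⟨C * (4 * (K * I₁.toReal) + 2 * (K ^ (β / q) * V * I₂.toReal) + K ^ (β / q) * V),
    by positivity, ?_⟩
  intro c u Z hu hD h hR
  have hum := hu.measurable
  have hdm := measurable_delta h hum
  refine (hE c u Z hu h (hR.trans hρ)).trans ?_
  have hw := norm_nonneg h
  have hdel : ∫⁻ x in Metric.ball 0 R, ‖delta h u x‖ₑ ^ β ≤
      ENNReal.ofReal (K ^ (β / q) * ‖h‖ ^ (γ * β) * V) :=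
    lintegral_delta_rpow_le hq0 hβ0 hm0 hsum hK hum hD hR
  set w₂ : RSpace N → RSpace N → ℝ≥0∞ := fun x y => ENNReal.ofReal (‖x - y‖ ^ (1 - s₁ - N)) with hw₂
  set P : RSpace N → RSpace N → RSpace N → ℝ≥0∞ := fun k x y => ‖delta h u x‖ₑ ^ β *
      ‖u (x + k) - u (y + k)‖ₑ ^ (p - 2) * ENNReal.ofReal (‖x - y‖ ^ (2 - θ - N)) with hP
  set Q : RSpace N → RSpace N → ℝ≥0∞ := fun x y => ‖delta h u x‖ₑ ^ β * w₂ x y with hQ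
  have hPm : ∀ k, Measurable (Function.uncurry (P k)) := by
    intro k; simp only [hP, Function.uncurry_def]; fun_prop
  have hQm : Measurable (Function.uncurry Q) := by
    simp only [hQ, hw₂, Function.uncurry_def]; fun_prop
  have hPx : ∀ k x, Measurable (P k x) := fun k x => (hPm k).of_uncurry_left
  have hPy : ∀ k y, Measurable fun x => P k x y := fun k y => (hPm k).of_uncurry_right
  have hQx : ∀ x, Measurable (Q x) := fun x => hQm.of_uncurry_left
  have hQy : ∀ y, Measurable fun x => Q x y := fun y => hQm.of_uncurry_right
  have hPb : ∀ k : RSpace N, R + ‖k‖ ≤ ρ →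
      ∫⁻ x in Metric.ball 0 R, ∫⁻ y in Metric.ball 0 R, P k x y ≤
        ENNReal.ofReal (K * I₁.toReal * ‖h‖ ^ (γ * β)) := by
    intro k hk
    refine (lintegral_local_interaction_le hN hθ hq0 hβ0 hm0 hsum hK hum hD hR hk).trans_eq ?_
    rw [← hI₁, ← ENNReal.ofReal_toReal hI₁t, ← ENNReal.ofReal_mul (by positivity),
      ENNReal.toReal_ofReal ENNReal.toReal_nonneg]
    congr 1; ring
  have hQb : ∫⁻ x in Metric.ball 0 R, ∫⁻ y in Metric.ball 0 R, Q x y ≤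
      ENNReal.ofReal (K ^ (β / q) * V * I₂.toReal * ‖h‖ ^ (γ * β)) := by
    calc _ ≤ ∫⁻ x in Metric.ball 0 R, ‖delta h u x‖ₑ ^ β * I₂ := by
          refine setLIntegral_mono' measurableSet_ball fun x hx => ?_
          simp only [hQ, hw₂]
          rw [lintegral_const_mul _ (by fun_prop)]
          exact mul_le_mul_right (lintegral_ball_norm_sub_rpow_le _ hx) _
      _ = (∫⁻ x in Metric.ball 0 R, ‖delta h u x‖ₑ ^ β) * I₂ :=
          lintegral_mul_const' _ _ hI₂t
      _ ≤ ENNReal.ofReal (K ^ (β / q) * ‖h‖ ^ (γ * β) * V) * I₂ := by gcongr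
      _ = _ := by
          rw [← ENNReal.ofReal_toReal hI₂t, ← ENNReal.ofReal_mul (by positivity),
            ENNReal.toReal_ofReal ENNReal.toReal_nonneg]
          congr 1; ring
  -- The two choices k = h and k = 0 account for the translated and the original difference;
  -- exchanging x and y accounts for the second half of the weight.
  have hpt : ∀ x y : RSpace N, ENNReal.ofReal
        ((|delta h u x| ^ β + |delta h u y| ^ β) *
        ((|u (x + h) - u (y + h)| ^ (p - 2) + |u x - u y| ^ (p - 2)) * ‖x - y‖ ^ (2 - θ - N) +
          ‖x - y‖ ^ (1 - s₁ - N))) =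
      ((P h x y + P 0 x y) + (P h y x + P 0 y x)) + (Q x y + Q y x) := by
    intro x y
    simp only [hP, hQ, hw₂, add_zero]
    rw [enorm_sub_rev (u (y + h)), enorm_sub_rev (u y), norm_sub_rev y x,
      ENNReal.ofReal_mul (by positivity), ENNReal.ofReal_add (by positivity) (by positivity),
      ENNReal.ofReal_add (by positivity) (by positivity), ENNReal.ofReal_mul (by positivity),
      ENNReal.ofReal_add (by positivity) (by positivity), ofReal_abs_rpow hβ0, ofReal_abs_rpow hβ0,
      ofReal_abs_rpow hm0, ofReal_abs_rpow hm0]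
    ring
  have hloc : ∫⁻ x in Metric.ball 0 R, ∫⁻ y in Metric.ball 0 R, ENNReal.ofReal
        ((|delta h u x| ^ β + |delta h u y| ^ β) *
        ((|u (x + h) - u (y + h)| ^ (p - 2) + |u x - u y| ^ (p - 2)) * ‖x - y‖ ^ (2 - θ - N) +
          ‖x - y‖ ^ (1 - s₁ - N))) ≤
      ENNReal.ofReal ((4 * (K * I₁.toReal) + 2 * (K ^ (β / q) * V * I₂.toReal)) *
        ‖h‖ ^ (γ * β)) := by
    have e1 : ∀ x : RSpace N, ∫⁻ y in Metric.ball 0 R,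
        (((P h x y + P 0 x y) + (P h y x + P 0 y x)) + (Q x y + Q y x)) =
        (((∫⁻ y in Metric.ball 0 R, P h x y) + ∫⁻ y in Metric.ball 0 R, P 0 x y) +
          ((∫⁻ y in Metric.ball 0 R, P h y x) + ∫⁻ y in Metric.ball 0 R, P 0 y x)) +
        ((∫⁻ y in Metric.ball 0 R, Q x y) + ∫⁻ y in Metric.ball 0 R, Q y x) := by
      intro x
      have m1 := hPx h x
      have m2 := hPx 0 x
      have m3 := hPy h x
      have m4 := hPy 0 x
      rw [lintegral_add_left (by fun_prop), lintegral_add_left (by fun_prop),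
        lintegral_add_left m1, lintegral_add_left m3, lintegral_add_left (hQx x)]
    have n1 : ∀ k, Measurable fun x => ∫⁻ y in Metric.ball 0 R, P k x y :=
      fun k => (hPm k).lintegral_prod_right'
    have n2 : ∀ k, Measurable fun x => ∫⁻ y in Metric.ball 0 R, P k y x :=
      fun k => (hPm k).lintegral_prod_left'
    have n3 : Measurable fun x => ∫⁻ y in Metric.ball 0 R, Q x y := hQm.lintegral_prod_right'
    have n1h := n1 h
    have n10 := n1 0
    have n2h := n2 h
    have n20 := n2 0
    simp_rw [hpt, e1]
    rw [lintegral_add_left (by fun_prop), lintegral_add_left (by fun_prop),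
      lintegral_add_left n1h, lintegral_add_left n2h, lintegral_add_left n3,
      lintegral_swap_ball (hPm h), lintegral_swap_ball (hPm 0), lintegral_swap_ball hQm]
    have c1 := hPb h hR
    have c2 := hPb 0 (by simp; linarith)
    refine (add_le_add (add_le_add (add_le_add c1 c2) (add_le_add c1 c2))
      (add_le_add hQb hQb)).trans_eq ?_
    rw [← ENNReal.ofReal_add (by positivity) (by positivity),
      ← ENNReal.ofReal_add (by positivity) (by positivity),
      ← ENNReal.ofReal_add (by positivity) (by positivity),
      ← ENNReal.ofReal_add (by positivity) (by positivity)]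
    congr 1; ring
  have hb : ∫⁻ x in Metric.ball 0 b, ‖delta h u x‖ₑ ^ β ≤
      ENNReal.ofReal (K ^ (β / q) * ‖h‖ ^ (γ * β) * V) :=
    (lintegral_mono_set (Metric.ball_subset_ball hbR.le)).trans hdel
  refine (mul_le_mul_right (add_le_add hloc hb) _).trans_eq ?_
  rw [← ENNReal.ofReal_add (by positivity) (by positivity), ← ENNReal.ofReal_mul hC]
  congr 1; ring

lemma lintegral_ball_enorm_rpow_le {N : ℕ} {q ρ : ℝ} (hq : 0 ≤ q) {f : RSpace N → ℝ}
    {S : Set (RSpace N)} (hSm : MeasurableSet S) (hS : S ⊆ Metric.ball 0 ρ)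
    (hf : ∀ x ∈ S, |f x| ≤ 2) :
    ∫⁻ x in S, ‖f x‖ₑ ^ q ≤
      ENNReal.ofReal (2 ^ q * (volume (Metric.ball (0 : RSpace N) ρ)).toReal) := by
  calc ∫⁻ x in S, ‖f x‖ₑ ^ q ≤ ∫⁻ x in S, ENNReal.ofReal (2 ^ q) := by
        refine setLIntegral_mono' hSm fun x hx => ?_
        rw [← ofReal_abs_rpow hq]
        exact ENNReal.ofReal_le_ofReal (Real.rpow_le_rpow (abs_nonneg _) (hf x hx) hq)
    _ ≤ ENNReal.ofReal (2 ^ q) * volume (Metric.ball (0 : RSpace N) ρ) := by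
        rw [setLIntegral_const]; gcongr
    _ = _ := by
        rw [ENNReal.ofReal_mul (by positivity), ENNReal.ofReal_toReal measure_ball_lt_top.ne]

/-- A bound on small differences extends to all differences for bounded functions. -/
lemma NormSol.diffBound_of_small {N : ℕ} {s₁ θ p T c q γ ρ d K : ℝ} {u : RSpace N → ℝ}
    {Z : RSpace N × RSpace N → ℝ} (hu : NormSol s₁ θ p T c u Z) (hq : 0 ≤ q) (hγ : 0 ≤ γ)
    (hd : 0 < d) (hρ : ρ ≤ 1)
    (h : ∀ z : RSpace N, ‖z‖ < d →
      ∫⁻ x in Metric.ball 0 ρ, ‖u (x + z) - u x‖ₑ ^ q ≤ ENNReal.ofReal (K * ‖z‖ ^ (γ * q))) :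
    DiffBound q γ ρ
      (max K (2 ^ q * (volume (Metric.ball (0 : RSpace N) ρ)).toReal / d ^ (γ * q))) u := by
  intro z
  rcases lt_or_ge ‖z‖ d with hz | hz
  · refine le_trans (lintegral_mono_set fun x hx => hx.1) ((h z hz).trans ?_)
    apply ENNReal.ofReal_le_ofReal
    gcongr
    exact le_max_left _ _
  · refine (lintegral_ball_enorm_rpow_le hq (measurableSet_inter_translate ρ z)
      (fun x hx => hx.1) fun x hx => ?_).trans ?_
    · have h1 := hu.bound x (Metric.ball_subset_ball hρ hx.1)
      have h2 := hu.bound (x + z) (Metric.ball_subset_ball hρ hx.2)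
      have := abs_sub (u (x + z)) (u x)
      linarith
    · apply ENNReal.ofReal_le_ofReal
      set X := 2 ^ q * (volume (Metric.ball (0 : RSpace N) ρ)).toReal with hX
      have hX0 : 0 ≤ X := by positivity
      calc X = X / d ^ (γ * q) * d ^ (γ * q) := by field_simp
        _ ≤ X / d ^ (γ * q) * ‖z‖ ^ (γ * q) := by gcongr
        _ ≤ _ := by gcongr; exact le_max_right _ _

/-- The improvement of integrability and differentiability. -/
lemma UniformDiffBound.improve {N : ℕ} (hN : 2 ≤ N) {s₁ θ p T q γ γ' : ℝ}
    (hp : 2 ≤ p) (hs₁ : 0 < s₁) (hs₁' : s₁ < 1) (hθ : 0 < θ) (hθp : θ < p) (hq : p ≤ q)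
    (hγ : 0 < 2 - θ + γ * (p - 2)) (hγ'0 : 0 ≤ γ') (hγ'1 : γ' < 1)
    (hγ' : γ' * (q + 1) ≤ θ + γ * (q - p + 2)) (h : UniformDiffBound N s₁ θ p T q γ) :
    UniformDiffBound N s₁ θ p T (q + 1) γ' := by
  intro ρ' hρ'0 hρ'1
  -- The gap to the unit ball is divided so that the radii for energy, cutoff and locality, enlarged
  -- by shifts shorter than g, all fit into radius ρ' + 8g = (1 + ρ')/2 < 1.
  set g := (1 - ρ') / 16 with hg
  have hg0 : 0 < g := by rw [hg]; linarith
  obtain ⟨K, hK, hD⟩ := h (ρ' + 8 * g) (by linarith) (by rw [hg]; linarith)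
  obtain ⟨C, hC, hE⟩ := exists_energy_bound_of_diffBound (T := T) (a := ρ' + 2 * g)
    (b := ρ' + 3 * g) (R := ρ' + 4 * g) (ρ := ρ' + 8 * g) hN hp hs₁ hs₁' hθ hθp hq hγ hK
    (by linarith) (by linarith) (by linarith) (by rw [hg]; linarith)
  obtain ⟨C', hC', hNik⟩ := lintegral_translate_sub_le (N := N) (q := q + 1) (θ := θ)
    (by linarith) hθ.le
  obtain ⟨K', hK', hsec⟩ := lintegral_sub_le_of_second_difference (N := N) (q := q + 1) (γ := γ')
    (d := g) (A := C' * C)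
    (M := 2 ^ (q + 1) * (volume (Metric.ball (0 : RSpace N) ρ')).toReal) (by linarith) hγ'1 hg0
    (by positivity) (by positivity) hγ'0
  refine ⟨_, le_max_of_le_left hK', fun c u Z hu => hu.diffBound_of_small (by linarith) hγ'0 hg0
    hρ'1.le ?_⟩
  have hum := hu.measurable
  refine hsec u _ hum (fun k hk => ?_) (fun k hk => ?_)
  -- The Nikolskii inequality is applied to `delta k u` with the same step k, so that its left-hand
  -- side is the second difference of u.
  · have h1 := hNik (delta k u) (measurable_delta k hum) (ρ' + 2 * g) ρ' k (by linarith)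
    have h2 := hE c u Z hu (hD c u Z hu) k (by linarith)
    refine h1.trans ((mul_le_mul_right h2 _).trans ?_)
    rw [← ENNReal.ofReal_mul (by positivity)]
    apply ENNReal.ofReal_le_ofReal
    rcases eq_or_ne k 0 with rfl | hk0
    · rw [norm_zero, Real.zero_rpow hθ.ne']
      simp only [mul_zero, zero_mul]
      positivity
    · have hkp : 0 < ‖k‖ := norm_pos_iff.2 hk0
      calc C' * ‖k‖ ^ θ * (C * ‖k‖ ^ (γ * (q - p + 2)))
          = C' * C * ‖k‖ ^ (θ + γ * (q - p + 2)) := by rw [Real.rpow_add hkp]; ring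
        _ ≤ _ := by
          gcongr C' * C * ?_
          refine Real.rpow_le_rpow_of_exponent_ge hkp ?_ hγ'
          rw [hg] at hk; linarith
  · refine lintegral_ball_enorm_rpow_le (by linarith) measurableSet_ball subset_rfl fun x hx => ?_
    exact hu.abs_delta_le (by rw [hg] at hk; linarith) hx

/-- Lowering the integrability exponent. -/
lemma UniformDiffBound.lower {N : ℕ} {s₁ θ p T q q' γ : ℝ} (hq' : 0 < q') (hq : q' ≤ q)
    (h : UniformDiffBound N s₁ θ p T q γ) : UniformDiffBound N s₁ θ p T q' γ := by
  intro ρ hρ0 hρ1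
  obtain ⟨K, hK, hD⟩ := h ρ hρ0 hρ1
  have hq0 : 0 < q := hq'.trans_le hq
  set V := (volume (Metric.ball (0 : RSpace N) ρ)).toReal with hV
  refine ⟨K ^ (q' / q) * V ^ ((q - q') / q), by positivity, fun c u Z hu z => ?_⟩
  have hum := hu.measurable
  have h1 : ∫⁻ _ in {x | x ∈ Metric.ball (0 : RSpace N) ρ ∧ x + z ∈ Metric.ball 0 ρ},
      ‖(1 : ℝ)‖ₑ ^ q ≤ ENNReal.ofReal V := by
    rw [setLIntegral_const, hV, ENNReal.ofReal_toReal measure_ball_lt_top.ne, enorm_one,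
      ENNReal.one_rpow, one_mul]
    exact measure_mono fun x hx => hx.1
  have := lintegral_rpow_mul_rpow_le (f := fun x => u (x + z) - u x) (by fun_prop)
    (measurable_const (a := (1 : ℝ))) hq0 hq'.le (by linarith : 0 ≤ q - q') (by ring)
    (by positivity) ENNReal.toReal_nonneg (hD c u Z hu z) h1
  rw [rpow_scaling hK (norm_nonneg z) hq0] at this
  simp only [enorm_one, ENNReal.one_rpow, mul_one] at this
  refine this.trans (le_of_eq ?_)
  congr 1; ring

/-- The starting point: fractional differentiability from the Gagliardo energy. -/
lemma uniformDiffBound_base {N : ℕ} {s₁ θ p T : ℝ} (hp : 2 ≤ p) (hθ : 0 < θ) :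
    UniformDiffBound N s₁ θ p T p (θ / p) := by
  have hp0 : 0 < p := by linarith
  obtain ⟨C, hC, hNik⟩ := lintegral_translate_sub_le (N := N) (q := p) (θ := θ) hp0 hθ.le
  intro ρ hρ0 hρ1
  refine ⟨_, le_max_of_le_left hC, fun c u Z hu => hu.diffBound_of_small (d := (1 - ρ) / 2) hp0.le
    (by positivity) (by linarith) hρ1.le fun z hz => ?_⟩
  have h1 := hNik u hu.measurable 1 ρ z (by linarith)
  refine h1.trans ((mul_le_mul_right hu.energy_p _).trans_eq ?_)
  rw [mul_one, div_mul_cancel₀ _ hp0.ne']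

/-- Every order of differentiability below one and every integrability is reached. -/
lemma exists_uniformDiffBound {N : ℕ} (hN : 2 ≤ N) {s₁ θ p : ℝ} (T : ℝ) (hp : 2 ≤ p) (hs₁ : 0 < s₁)
    (hs₁' : s₁ < 1) (hθ : p - 1 < θ) (hθp : θ < p) {γ : ℝ} (hγ : θ / p ≤ γ) (hγ1 : γ < 1) (k : ℕ) :
    UniformDiffBound N s₁ θ p T (p + k) γ := by
  have hp0 : 0 < p := by linarith
  have hθ0 : 0 < θ := by linarith
  have hσ : 0 < θ / p := by positivity
  -- Already at σ = θ/p the value is 2(1 - θ/p) > 0, so the softened kernel is integrable throughout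
  -- the iteration.
  have hadm : ∀ σ, θ / p ≤ σ → 0 < 2 - θ + σ * (p - 2) := by
    intro σ hσ
    have h1 : θ / p * (p - 2) ≤ σ * (p - 2) := mul_le_mul_of_nonneg_right hσ (by linarith)
    have h2 : θ / p * (p - 2) = θ - 2 * (θ / p) := by field_simp
    have h3 : θ / p < 1 := (div_lt_one hp0).2 hθp
    linarith
  -- First stage: the order stays at θ/p, and the condition for a step reduces to (θ/p)(p - 1) ≤ θ.
  have hint : ∀ k : ℕ, UniformDiffBound N s₁ θ p T (p + k) (θ / p) := by
    intro k
    induction k with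
    | zero => simpa using uniformDiffBound_base hp hθ0
    | succ k ih =>
      have := ih.improve hN hp hs₁ hs₁' hθ0 hθp (by linarith [Nat.cast_nonneg (α := ℝ) k])
        (hadm _ le_rfl) hσ.le (hγ.trans_lt hγ1) (by
          have : θ / p * p = θ := div_mul_cancel₀ _ hp0.ne'
          have h3 : θ / p < 1 := (div_lt_one hp0).2 hθp
          nlinarith)
      rw [Nat.cast_succ, ← add_assoc]
      exact this
  set Q := p + k with hQ
  have hQp : p ≤ Q := by rw [hQ]; linarith [Nat.cast_nonneg (α := ℝ) k]
  -- For σ ≤ 1 one has (σ + e)(Q + 1) ≤ θ + σ(Q - p + 2), so e is an admissible gain that does not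
  -- depend on σ.
  set e := (θ - (p - 1)) / (Q + 1) with he
  have he0 : 0 < e := div_pos (by linarith) (by linarith)
  have hdiff : ∀ j : ℕ, UniformDiffBound N s₁ θ p T Q (min γ (θ / p + j * e)) := by
    intro j
    induction j with
    | zero => simpa [min_eq_right hγ] using hint k
    | succ j ih =>
      set σ := min γ (θ / p + j * e) with hσdef
      have hσ1 : θ / p ≤ σ := le_min hγ (le_add_of_nonneg_right (by positivity))
      have hσ2 : σ < 1 := (min_le_left _ _).trans_lt hγ1
      have hle : min γ (θ / p + (j + 1 : ℕ) * e) ≤ σ + e := by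
        rw [hσdef, ← min_add_add_right]
        refine min_le_min (by linarith) (le_of_eq ?_)
        push_cast; ring
      have heQ : e * (Q + 1) = θ - (p - 1) := div_mul_cancel₀ _ (by linarith)
      refine (ih.improve hN hp hs₁ hs₁' hθ0 hθp hQp (hadm _ hσ1)
        (le_min (hσ.le.trans hγ) (by positivity)) ((min_le_left _ _).trans_lt hγ1) ?_).lower
        (by linarith) (by linarith)
      calc min γ (θ / p + (j + 1 : ℕ) * e) * (Q + 1) ≤ (σ + e) * (Q + 1) := by
            gcongr
        _ ≤ θ + σ * (Q - p + 2) := by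
          rw [add_mul, heQ]
          nlinarith
  obtain ⟨j, hj⟩ := exists_nat_gt (γ / e)
  have := hdiff j
  rwa [min_eq_left] at this
  rw [div_lt_iff₀ he0] at hj
  linarith

/-- Interior Hölder estimate for normalised solutions. -/
lemma exists_holder_of_normSol {N : ℕ} (hN : 2 ≤ N) {s₁ θ p : ℝ} (T : ℝ) (hp : 2 ≤ p)
    (hs₁ : 0 < s₁) (hs₁' : s₁ < 1) (hθ : p - 1 < θ) (hθp : θ < p) {γ : ℝ} (hγ0 : 0 < γ)
    (hγ1 : γ < 1) :
    ∃ C : ℝ, 0 ≤ C ∧ ∀ (c : ℝ) (u : RSpace N → ℝ) (Z : RSpace N × RSpace N → ℝ),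
      NormSol s₁ θ p T c u Z →
      ∃ w : RSpace N → ℝ, w =ᵐ[volume.restrict (Metric.ball 0 (1 / 2))] u ∧
        ∀ x ∈ Metric.ball (0 : RSpace N) (1 / 2), ∀ y ∈ Metric.ball (0 : RSpace N) (1 / 2),
          |w x - w y| ≤ C * ‖x - y‖ ^ γ := by
  have hp0 : 0 < p := by linarith
  have hθp1 : θ / p < 1 := (div_lt_one hp0).2 hθp
  set σ := max ((1 + γ) / 2) (θ / p) with hσ
  have hσ1 : σ < 1 := max_lt (by linarith) hθp1
  -- The order σ ≥ (1 + γ)/2 splits the room above γ in half, and k makes the Morrey loss N/Q at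
  -- most the other half.
  obtain ⟨k, hk⟩ := exists_nat_gt (N / ((1 - γ) / 2))
  set Q := p + k with hQ
  have hQ1 : 1 ≤ Q := by rw [hQ]; linarith [Nat.cast_nonneg (α := ℝ) k]
  have hα : γ ≤ σ - N / Q := by
    have h1 : (N : ℝ) / Q ≤ (1 - γ) / 2 := by
      rw [div_lt_iff₀ (by linarith)] at hk
      rw [div_le_iff₀ (by linarith)]
      have : (k : ℝ) * ((1 - γ) / 2) ≤ Q * ((1 - γ) / 2) := by
        have : (k : ℝ) ≤ Q := by rw [hQ]; linarith
        exact mul_le_mul_of_nonneg_right this (by linarith)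
      linarith
    have h2 : (1 + γ) / 2 ≤ σ := le_max_left _ _
    linarith
  obtain ⟨K, hK, hD⟩ := exists_uniformDiffBound hN T hp hs₁ hs₁' hθ hθp (le_max_right _ _) hσ1 k
    (3 / 4) (by norm_num) (by norm_num)
  obtain ⟨C, hC, hH⟩ := exists_holder_of_diffBound (N := N) (q := Q) (γ := σ) hQ1 hK (by linarith)
  refine ⟨C, hC, fun c u Z hu => ?_⟩
  obtain ⟨w, hw1, hw2⟩ := hH u hu.measurable hu.bound (hD c u Z hu)
  refine ⟨w, hw1, fun x hx y hy => (hw2 x hx y hy).trans ?_⟩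
  rcases eq_or_ne x y with rfl | hxy
  · rw [sub_self, norm_zero, Real.zero_rpow (by linarith), Real.zero_rpow hγ0.ne']
  · gcongr C * ?_
    refine Real.rpow_le_rpow_of_exponent_ge (norm_pos_iff.2 (sub_ne_zero.2 hxy)) ?_ hα
    rw [mem_ball_zero_iff] at hx hy
    exact (norm_sub_le x y).trans (by linarith)

/-! ### Affine changes of variables and change of representative. -/

section affine

variable {V : Type*} [NormedAddCommGroup V] [NormedSpace ℝ V] [MeasurableSpace V] [BorelSpace V]
  [FiniteDimensional ℝ V] (μ : Measure V) [μ.IsAddHaarMeasure]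

lemma lintegral_comp_affine (F : V → ℝ≥0∞) (a : V) {r : ℝ} (hr : 0 < r) :
    ∫⁻ y, F (a + r • y) ∂μ = ENNReal.ofReal ((r ^ Module.finrank ℝ V)⁻¹) * ∫⁻ x, F x ∂μ := by
  have h1 : ∫⁻ y, F (a + r • y) ∂μ = ∫⁻ x, F (a + x) ∂(Measure.map (r • ·) μ) :=
    (lintegral_map_equiv (fun x => F (a + x))
      (Homeomorph.smul (isUnit_iff_ne_zero.2 hr.ne').unit).toMeasurableEquiv).symm
  rw [h1, Measure.map_addHaar_smul μ hr.ne', lintegral_smul_measure, smul_eq_mul,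
    lintegral_add_left_eq_self, abs_of_nonneg (by positivity)]

lemma integral_comp_affine (F : V → ℝ) (a : V) {r : ℝ} (hr : 0 < r) :
    ∫ y, F (a + r • y) ∂μ = (r ^ Module.finrank ℝ V)⁻¹ * ∫ x, F x ∂μ := by
  rw [Measure.integral_comp_smul μ (fun x => F (a + x)) r, integral_add_left_eq_self, smul_eq_mul,
    abs_of_nonneg (by positivity)]

lemma ae_comp_affine {P : V → Prop} (h : ∀ᵐ x ∂μ, P x) (a : V) {r : ℝ} (hr : 0 < r) :
    ∀ᵐ y ∂μ, P (a + r • y) := by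
  rw [ae_iff] at h ⊢
  have e : {y | ¬P (a + r • y)} = (r • ·) ⁻¹' ((a + ·) ⁻¹' {x | ¬P x}) := rfl
  rw [e, Measure.addHaar_preimage_smul μ hr.ne', measure_preimage_add, h, mul_zero]

end affine

section ball

variable {N : ℕ}

lemma lintegral_ball_comp_affine (F : RSpace N → ℝ≥0∞) (a : RSpace N) {r : ℝ} (hr : 0 < r) :
    ∫⁻ y in Metric.ball 0 1, F (a + r • y) =
      ENNReal.ofReal ((r ^ N)⁻¹) * ∫⁻ x in Metric.ball a r, F x := by
  rw [← lintegral_indicator measurableSet_ball, ← lintegral_indicator measurableSet_ball]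
  have := lintegral_comp_affine volume ((Metric.ball a r).indicator F) a hr
  rw [finrank_euclideanSpace_fin] at this
  rw [← this]
  refine lintegral_congr fun y => ?_
  have hiff : a + r • y ∈ Metric.ball a r ↔ y ∈ Metric.ball (0 : RSpace N) 1 := by
    rw [mem_ball_zero_iff, Metric.mem_ball, dist_eq_norm, add_sub_cancel_left, norm_smul,
      Real.norm_of_nonneg hr.le]
    exact mul_lt_iff_lt_one_right hr
  by_cases hy : y ∈ Metric.ball (0 : RSpace N) 1
  · rw [Set.indicator_of_mem hy, Set.indicator_of_mem (hiff.2 hy)]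
  · rw [Set.indicator_of_notMem hy, Set.indicator_of_notMem (fun h => hy (hiff.1 h))]

lemma lintegral_ball_ball_comp_affine (F : RSpace N → RSpace N → ℝ≥0∞) (a : RSpace N) {r : ℝ}
    (hr : 0 < r) :
    ∫⁻ y in Metric.ball 0 1, ∫⁻ y' in Metric.ball 0 1, F (a + r • y) (a + r • y') =
      ENNReal.ofReal ((r ^ N)⁻¹ * (r ^ N)⁻¹) *
        ∫⁻ x in Metric.ball a r, ∫⁻ x' in Metric.ball a r, F x x' := by
  simp_rw [lintegral_ball_comp_affine (F _) a hr]
  rw [lintegral_ball_comp_affine (fun x => _ * ∫⁻ x' in Metric.ball a r, F x x') a hr,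
    lintegral_const_mul' _ _ ENNReal.ofReal_ne_top, ENNReal.ofReal_mul (by positivity), mul_assoc]

lemma finrank_rspace_prod : Module.finrank ℝ (RSpace N × RSpace N) = N + N := by
  rw [Module.finrank_prod, finrank_euclideanSpace_fin]

end ball

lemma setSign_div {t M z : ℝ} (hM : 0 < M) (hz : z ∈ setSign t) : z ∈ setSign (t / M) := by
  obtain ⟨h1, h2, h3⟩ := hz
  refine ⟨fun h => h1 ?_, fun h => h2 ?_, fun h => h3 ?_⟩
  · exact (div_pos_iff_of_pos_right hM).1 h
  · by_contra hn
    exact absurd h (not_lt.2 (div_nonneg (not_lt.1 hn) hM.le))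
  · exact (div_eq_zero_iff.1 h).resolve_right hM.ne'

lemma oddPow_div {m t M : ℝ} (hM : 0 < M) : oddPow m (t / M) = oddPow m t / M ^ (m + 1) := by
  unfold oddPow
  rw [abs_div, abs_of_pos hM, Real.div_rpow (abs_nonneg t) hM.le, Real.rpow_add_one hM.ne']
  field_simp

section congr

variable {N : ℕ} {u v : RSpace N → ℝ}

lemma lintegral_lintegral_congr_ae {μ : Measure (RSpace N)} (h : u =ᵐ[μ] v)
    (F : RSpace N → RSpace N → ℝ → ℝ → ℝ≥0∞) :
    ∫⁻ x, ∫⁻ y, F x y (u x) (u y) ∂μ ∂μ = ∫⁻ x, ∫⁻ y, F x y (v x) (v y) ∂μ ∂μ := by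
  refine lintegral_congr_ae ?_
  filter_upwards [h] with x hx
  refine lintegral_congr_ae ?_
  filter_upwards [h] with y hy
  rw [hx, hy]

lemma gagliardoSeminorm_congr_ae {s q : ℝ} {A : Set (RSpace N)} (h : u =ᵐ[volume.restrict A] v) :
    gagliardoSeminorm s q A u = gagliardoSeminorm s q A v := by
  unfold gagliardoSeminorm
  rw [lintegral_lintegral_congr_ae h fun x y a b =>
    ENNReal.ofReal (|a - b| ^ q / ‖x - y‖ ^ ((N : ℝ) + s * q))]

lemma MemFracSobolevLoc.congr_ae {s q : ℝ} {Ω : Set (RSpace N)} (h : u =ᵐ[volume] v)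
    (hu : MemFracSobolevLoc s q Ω u) : MemFracSobolevLoc s q Ω v := fun U hU hc hs =>
  ⟨(hu U hU hc hs).memLp.ae_eq (ae_restrict_of_ae h),
    by rw [← gagliardoSeminorm_congr_ae (ae_restrict_of_ae h)]; exact (hu U hU hc hs).seminorm_lt_top⟩

lemma ae_eq_prod (h : u =ᵐ[volume] v) :
    ∀ᵐ z : RSpace N × RSpace N, u z.1 = v z.1 ∧ u z.2 = v z.2 := by
  have h1 := (Measure.quasiMeasurePreserving_fst (μ := (volume : Measure (RSpace N)))
    (ν := (volume : Measure (RSpace N)))).ae h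
  have h2 := (Measure.quasiMeasurePreserving_snd (μ := (volume : Measure (RSpace N)))
    (ν := (volume : Measure (RSpace N)))).ae h
  rw [Measure.volume_eq_prod]
  filter_upwards [h1, h2] with z a b using ⟨a, b⟩

/-- Allows passing to a Borel representative that is bounded everywhere on the ball, as the
normalised class requires. -/
lemma IsWeakSolution.congr_ae {s₁ sp p : ℝ} {Ω : Set (RSpace N)} (h : u =ᵐ[volume] v)
    (hu : IsWeakSolution s₁ sp p Ω u) : IsWeakSolution s₁ sp p Ω v where
  mem_one := hu.mem_one.congr_ae h
  mem_p := hu.mem_p.congr_ae h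
  mem_tail :=
    { memLp_loc := fun K hK => (hu.mem_tail.memLp_loc K hK).ae_eq (ae_restrict_of_ae h)
      lintegral_lt_top := by
        refine lt_of_eq_of_lt (lintegral_congr_ae ?_) hu.mem_tail.lintegral_lt_top
        filter_upwards [h] with x hx
        rw [hx] }
  equation := by
    obtain ⟨Z, hZ, hs, he⟩ := hu.equation
    have hp := ae_eq_prod h
    refine ⟨Z, hZ, ?_, fun φ hφ => ?_⟩
    · filter_upwards [hs, hp] with z h1 h2
      rw [← h2.1, ← h2.2]; exact h1
    · rw [he φ hφ]
      congr 1
      refine integral_congr_ae ?_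
      filter_upwards [hp] with z h2
      rw [← h2.1, ← h2.2]

end congr

lemma IsWeakSolution.locallyIntegrable {N : ℕ} {s₁ sp p : ℝ} {Ω : Set (RSpace N)}
    {u : RSpace N → ℝ} (hp : 2 ≤ p) (hu : IsWeakSolution s₁ sp p Ω u) : LocallyIntegrable u := by
  rw [locallyIntegrable_iff]
  intro K hK
  have : IsFiniteMeasure (volume.restrict K) := ⟨by
    rw [Measure.restrict_apply_univ]; exact hK.measure_lt_top⟩
  refine (hu.mem_tail.memLp_loc K hK).integrable ?_
  rw [ENNReal.one_le_ofReal]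
  linarith

/-- A measurable representative that is bounded everywhere on a given ball. -/
lemma exists_measurable_bounded_rep {N : ℕ} {u : RSpace N → ℝ} (hu : AEMeasurable u) {a : RSpace N}
    {r M : ℝ} (hM : 0 ≤ M) (hb : ∀ᵐ x, x ∈ Metric.ball a r → |u x| ≤ M) :
    ∃ v : RSpace N → ℝ, Measurable v ∧ u =ᵐ[volume] v ∧ ∀ x ∈ Metric.ball a r, |v x| ≤ M := by
  classical
  refine ⟨(Metric.ball a r).piecewise (fun x => max (-M) (min M (hu.mk u x))) (hu.mk u),
    Measurable.piecewise measurableSet_ball (by have := hu.measurable_mk; fun_prop)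
      hu.measurable_mk, ?_, ?_⟩
  · filter_upwards [hb, hu.ae_eq_mk] with x h1 h2
    by_cases hx : x ∈ Metric.ball a r
    · rw [Set.piecewise_eq_of_mem _ _ _ hx]
      have h3 := abs_le.1 (h1 hx)
      rw [← h2, min_eq_right h3.2, max_eq_right h3.1]
    · rw [Set.piecewise_eq_of_notMem _ _ _ hx, h2]
  · intro x hx
    rw [Set.piecewise_eq_of_mem _ _ _ hx]
    exact abs_le.2 ⟨le_max_left _ _, max_le (by linarith) (min_le_left _ _)⟩

/-! ### Rescaling weak solutions to the unit ball. -/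

/-- An affine change of variables multiplies each Gagliardo energy by a positive finite constant and
carries the unit ball to the given ball inside Ω. -/
lemma BallTest.isTestFunction {N : ℕ} {s₁ sp p : ℝ} (hp : 2 ≤ p) {φ : RSpace N → ℝ}
    (hφ : BallTest s₁ (sp * p) p φ) {Ω : Set (RSpace N)} {a : RSpace N} {r : ℝ} (hr : 0 < r)
    (hΩ : Metric.closedBall a r ⊆ Ω) :
    IsTestFunction s₁ sp p Ω fun x => φ (r⁻¹ • (x - a)) := by
  obtain ⟨B, hB⟩ := hφ.bounded
  obtain ⟨r', hr'0, hr'1, hsupp⟩ := hφ.support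
  have hm := hφ.measurable
  set ψ : RSpace N → ℝ := fun x => φ (r⁻¹ • (x - a)) with hψ
  have hψm : Measurable ψ := by rw [hψ]; fun_prop
  have hts : tsupport ψ ⊆ Metric.closedBall a r := by
    refine closure_minimal ?_ Metric.isClosed_closedBall
    intro x hx
    by_contra hxr
    apply hx
    rw [Metric.mem_closedBall, not_le, dist_eq_norm] at hxr
    refine hsupp _ ?_
    rw [norm_smul, norm_inv, Real.norm_of_nonneg hr.le, ← div_eq_inv_mul, le_div_iff₀ hr]
    nlinarith
  have hcs : HasCompactSupport ψ := (isCompact_closedBall a r).of_isClosed_subset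
    (isClosed_tsupport _) hts
  have hback : ∀ y, ψ (a + r • y) = φ y := by
    intro y
    simp only [hψ]
    rw [add_sub_cancel_left, smul_smul, inv_mul_cancel₀ hr.ne', one_smul]
  have henergy : ∀ (q k : ℝ),
      ∫⁻ z : RSpace N × RSpace N, ENNReal.ofReal (|φ z.1 - φ z.2| ^ q / ‖z.1 - z.2‖ ^ k) < ⊤ →
      ∫⁻ x, ∫⁻ y, ENNReal.ofReal (|ψ x - ψ y| ^ q / ‖x - y‖ ^ k) < ⊤ := by
    intro q k h
    have h1 : ∫⁻ x, ∫⁻ y, ENNReal.ofReal (|ψ x - ψ y| ^ q / ‖x - y‖ ^ k) =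
        ∫⁻ z : RSpace N × RSpace N, ENNReal.ofReal (|ψ z.1 - ψ z.2| ^ q / ‖z.1 - z.2‖ ^ k) := by
      rw [Measure.volume_eq_prod, lintegral_prod _ (by fun_prop)]
    have h2 := lintegral_comp_affine (volume : Measure (RSpace N × RSpace N))
      (fun z => ENNReal.ofReal (|ψ z.1 - ψ z.2| ^ q / ‖z.1 - z.2‖ ^ k)) (a, a) hr
    have h3 : ∀ y : RSpace N × RSpace N, ENNReal.ofReal
        (|ψ ((a, a) + r • y).1 - ψ ((a, a) + r • y).2| ^ q /
          ‖((a, a) + r • y).1 - ((a, a) + r • y).2‖ ^ k) =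
        ENNReal.ofReal ((r ^ k)⁻¹) *
          ENNReal.ofReal (|φ y.1 - φ y.2| ^ q / ‖y.1 - y.2‖ ^ k) := by
      intro y
      simp only [Prod.fst_add, Prod.snd_add, Prod.smul_fst, Prod.smul_snd, hback,
        add_sub_add_left_eq_sub]
      rw [← smul_sub, norm_smul, Real.norm_of_nonneg hr.le, Real.mul_rpow hr.le (norm_nonneg _),
        ← ENNReal.ofReal_mul (by positivity)]
      congr 1
      field_simp
    simp_rw [h3] at h2
    rw [lintegral_const_mul' _ _ ENNReal.ofReal_ne_top] at h2
    rw [h1]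
    have h4 : ENNReal.ofReal ((r ^ Module.finrank ℝ (RSpace N × RSpace N))⁻¹) ≠ 0 := by
      rw [Ne, ENNReal.ofReal_eq_zero, not_le]; positivity
    by_contra htop
    rw [not_lt, top_le_iff] at htop
    rw [htop, ENNReal.mul_top h4] at h2
    exact (ENNReal.mul_lt_top ENNReal.ofReal_lt_top h).ne h2
  have hsob : ∀ (s q : ℝ), 0 ≤ q →
      ∫⁻ z : RSpace N × RSpace N,
        ENNReal.ofReal (|φ z.1 - φ z.2| ^ q / ‖z.1 - z.2‖ ^ ((N : ℝ) + s * q)) < ⊤ →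
      MemFracSobolev s q Set.univ ψ := by
    intro s q hq h
    refine ⟨hcs.memLp_of_bound hψm.aestronglyMeasurable B (ae_of_all _ fun x => hB _), ?_⟩
    unfold gagliardoSeminorm
    refine ENNReal.rpow_lt_top_of_nonneg (by positivity) ?_
    simp only [Measure.restrict_univ]
    exact (henergy q _ h).ne
  exact
    { mem_one := hsob s₁ 1 zero_le_one (by simpa using hφ.energy_one)
      mem_p := hsob sp p (by linarith) hφ.energy_p
      hasCompactSupport := hcs
      tsupport_subset := hts.trans hΩ }

section scaling

variable {N : ℕ}

lemma integral_prod_affine_of_eq {F G : RSpace N × RSpace N → ℝ} {a : RSpace N} {r A : ℝ}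
    (hr : 0 < r) (h : ∀ y, F y = A * G ((a, a) + r • y)) :
    ∫ y, F y = A * (r ^ (N + N))⁻¹ * ∫ x, G x := by
  have := integral_comp_affine (volume : Measure (RSpace N × RSpace N)) G (a, a) hr
  rw [finrank_rspace_prod] at this
  rw [mul_assoc, ← this, ← integral_const_mul]
  exact integral_congr_ae (ae_of_all _ h)

lemma lintegral_ball_ball_affine_of_eq {F G : RSpace N → RSpace N → ℝ} {a : RSpace N} {r A : ℝ}
    (hr : 0 < r) (hA : 0 ≤ A) (h : ∀ y y', F y y' = A * G (a + r • y) (a + r • y')) :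
    ∫⁻ y in Metric.ball 0 1, ∫⁻ y' in Metric.ball 0 1, ENNReal.ofReal (F y y') =
      ENNReal.ofReal (A * ((r ^ N)⁻¹ * (r ^ N)⁻¹)) *
        ∫⁻ x in Metric.ball a r, ∫⁻ x' in Metric.ball a r, ENNReal.ofReal (G x x') := by
  rw [ENNReal.ofReal_mul hA, mul_assoc,
    ← lintegral_ball_ball_comp_affine (fun x x' => ENNReal.ofReal (G x x')) a hr,
    ← lintegral_const_mul' _ _ ENNReal.ofReal_ne_top]
  simp_rw [← lintegral_const_mul' _ _ (ENNReal.ofReal_ne_top (r := A)), h, ENNReal.ofReal_mul hA]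

/-- The powers of r and M in the tail and energy hypotheses are exactly those that scale to the
bounds T and 1. The sign selection is unaffected by division by M > 0. -/
lemma IsWeakSolution.exists_normSol {s₁ sp p T : ℝ} (hp : 2 ≤ p) (hs₁ : s₁ < 1)
    (hθ : p - 1 < sp * p) {Ω : Set (RSpace N)} {u : RSpace N → ℝ}
    (hu : IsWeakSolution s₁ sp p Ω u) {a : RSpace N} {r M : ℝ} (hr : 0 < r) (hr1 : r < 1)
    (hM : 1 ≤ M) (hΩ : Metric.closedBall a r ⊆ Ω)
    (hb : ∀ᵐ x, x ∈ Metric.ball a r → |u x| ≤ M)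
    (ht : ∫⁻ x, ENNReal.ofReal (|u x| ^ (p - 1) / (r + ‖x - a‖) ^ ((N : ℝ) + sp * p)) ≤
      ENNReal.ofReal (T * M ^ (p - 1) * r ^ (-(sp * p))))
    (he : ∫⁻ x in Metric.ball a r, ∫⁻ y in Metric.ball a r,
      ENNReal.ofReal (|u x - u y| ^ p / ‖x - y‖ ^ ((N : ℝ) + sp * p)) ≤
        ENNReal.ofReal (M ^ p * r ^ ((N : ℝ) - sp * p))) :
    ∃ (c : ℝ) (v : RSpace N → ℝ) (Z : RSpace N × RSpace N → ℝ),
      NormSol s₁ (sp * p) p T c v Z ∧ ∀ᵐ y, v y = u (a + r • y) / M := by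
  have hM0 : 0 < M := by linarith
  obtain ⟨w, hwm, huw, hwb⟩ := exists_measurable_bounded_rep
    (hu.locallyIntegrable hp).aestronglyMeasurable.aemeasurable hM0.le hb
  have hw := hu.congr_ae huw
  obtain ⟨Z₀, hZ₀, hZ₀s, hZ₀e⟩ := hw.equation
  have hZeq := hZ₀.1.ae_eq_mk
  have hZm := hZ₀.1.stronglyMeasurable_mk.measurable
  set Z := hZ₀.1.mk Z₀ with hZ
  have hnorm : ∀ y y' : RSpace N, ‖(a + r • y) - (a + r • y')‖ = r * ‖y - y'‖ := by
    intro y y'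
    rw [add_sub_add_left_eq_sub, ← smul_sub, norm_smul, Real.norm_of_nonneg hr.le]
  have hrN : r ^ (N : ℝ) = r ^ N := Real.rpow_natCast r N
  have hbm : ∀ x ∈ Metric.ball (0 : RSpace N) 1, a + r • x ∈ Metric.ball a r := by
    intro x hx
    rw [mem_ball_zero_iff] at hx
    rw [Metric.mem_ball, dist_eq_norm, add_sub_cancel_left, norm_smul, Real.norm_of_nonneg hr.le]
    exact mul_lt_of_lt_one_right hr hx
  -- The coefficient records the mismatch of scaling between the two operators. It is at most one
  -- because s_p p > p - 1 ≥ 1 > s₁, r < 1 and M ≥ 1.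
  refine ⟨r ^ (sp * p - s₁) * (M ^ (p - 1))⁻¹, fun y => w (a + r • y) / M,
    fun z => Z ((a, a) + r • z), ?_, ?_⟩
  swap
  · filter_upwards [ae_comp_affine volume huw a hr] with y hy
    rw [hy]
  have hpow : ∀ (q k : ℝ) (y y' : RSpace N),
      |w (a + r • y) / M - w (a + r • y') / M| ^ q / ‖y - y'‖ ^ k =
        (M ^ q)⁻¹ * r ^ k *
          (|w (a + r • y) - w (a + r • y')| ^ q / ‖(a + r • y) - (a + r • y')‖ ^ k) := by
    intro q k y y'
    rw [hnorm, ← sub_div, abs_div, abs_of_pos hM0, Real.div_rpow (abs_nonneg _) hM0.le,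
      Real.mul_rpow hr.le (norm_nonneg _)]
    have := (Real.rpow_pos_of_pos hr k).ne'
    have := (Real.rpow_pos_of_pos hM0 q).ne'
    field_simp
  refine ⟨by positivity, ?_, by fun_prop, by fun_prop, ?_, ?_, ?_, ?_, ?_, ?_⟩
  · refine mul_le_one₀ (Real.rpow_le_one hr.le hr1.le (by linarith)) (by positivity)
      (inv_le_one_of_one_le₀ (Real.one_le_rpow hM (by linarith)))
  · intro x hx
    rw [abs_div, abs_of_pos hM0]
    exact (div_le_one hM0).2 (hwb _ (hbm x hx))
  · have h1 : ∀ y : RSpace N,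
        ENNReal.ofReal (|w (a + r • y) / M| ^ (p - 1) / (1 + ‖y‖) ^ ((N : ℝ) + sp * p)) =
        ENNReal.ofReal ((M ^ (p - 1))⁻¹ * r ^ ((N : ℝ) + sp * p)) *
        ENNReal.ofReal (|w (a + r • y)| ^ (p - 1) /
          (r + ‖a + r • y - a‖) ^ ((N : ℝ) + sp * p)) := by
      intro y
      rw [← ENNReal.ofReal_mul (by positivity), abs_div, abs_of_pos hM0,
        Real.div_rpow (abs_nonneg _) hM0.le, add_sub_cancel_left, norm_smul,
        Real.norm_of_nonneg hr.le, show r + r * ‖y‖ = r * (1 + ‖y‖) by ring,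
        Real.mul_rpow hr.le (by positivity)]
      congr 1
      have := (Real.rpow_pos_of_pos hr ((N : ℝ) + sp * p)).ne'
      field_simp
    simp_rw [h1]
    rw [lintegral_const_mul' _ _ ENNReal.ofReal_ne_top,
      lintegral_comp_affine volume (fun x => ENNReal.ofReal (|w x| ^ (p - 1) /
          (r + ‖x - a‖) ^ ((N : ℝ) + sp * p))) a hr, finrank_euclideanSpace_fin]
    have h2 : ∫⁻ x, ENNReal.ofReal (|w x| ^ (p - 1) / (r + ‖x - a‖) ^ ((N : ℝ) + sp * p)) ≤
        ENNReal.ofReal (T * M ^ (p - 1) * r ^ (-(sp * p))) := by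
      refine le_of_eq_of_le (lintegral_congr_ae ?_) ht
      filter_upwards [huw] with x hx
      rw [hx]
    calc _ ≤ ENNReal.ofReal ((M ^ (p - 1))⁻¹ * r ^ ((N : ℝ) + sp * p)) *
          (ENNReal.ofReal (r ^ N)⁻¹ * ENNReal.ofReal (T * M ^ (p - 1) * r ^ (-(sp * p)))) := by
          gcongr
      _ = ENNReal.ofReal T := by
          rw [← ENNReal.ofReal_mul (by positivity), ← ENNReal.ofReal_mul (by positivity),
            Real.rpow_add hr, Real.rpow_neg hr.le, hrN]
          congr 1
          have := (Real.rpow_pos_of_pos hr (sp * p)).ne'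
          have := (Real.rpow_pos_of_pos hM0 (p - 1)).ne'
          field_simp
  · have h := (hw.mem_one (Metric.ball a r) Metric.isOpen_ball
      ((isCompact_closedBall a r).of_isClosed_subset isClosed_closure Metric.closure_ball_subset_closedBall)
      (Metric.closure_ball_subset_closedBall.trans hΩ)).seminorm_lt_top
    unfold gagliardoSeminorm at h
    rw [div_one, ENNReal.rpow_one, mul_one] at h
    rw [lintegral_ball_ball_affine_of_eq
      (G := fun x y => |w x - w y| ^ (1 : ℝ) / ‖x - y‖ ^ ((N : ℝ) + s₁)) hr (by positivity)
      (hpow 1 ((N : ℝ) + s₁))]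
    exact ENNReal.mul_lt_top ENNReal.ofReal_lt_top h
  · rw [lintegral_ball_ball_affine_of_eq
      (G := fun x y => |w x - w y| ^ p / ‖x - y‖ ^ ((N : ℝ) + sp * p)) hr (by positivity)
      (hpow p ((N : ℝ) + sp * p))]
    have h2 := lintegral_lintegral_congr_ae (ae_restrict_of_ae (s := Metric.ball a r) huw)
      fun x y b c => ENNReal.ofReal (|b - c| ^ p / ‖x - y‖ ^ ((N : ℝ) + sp * p))
    rw [← h2]
    refine (mul_le_mul_right he _).trans_eq ?_
    rw [← ENNReal.ofReal_mul (by positivity), Real.rpow_add hr, Real.rpow_sub hr, hrN,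
      ← ENNReal.ofReal_one]
    congr 1
    have := (Real.rpow_pos_of_pos hr (sp * p)).ne'
    have := (Real.rpow_pos_of_pos hM0 p).ne'
    field_simp
  · have h : ∀ᵐ z : RSpace N × RSpace N, Z z ∈ setSign (w z.1 - w z.2) := by
      filter_upwards [hZ₀s, hZeq] with z h1 h2
      rw [← h2]; exact h1
    filter_upwards [ae_comp_affine (volume : Measure (RSpace N × RSpace N)) h (a, a) hr] with z hz
    rw [← sub_div]
    exact setSign_div hM0 hz
  · intro φ hφ
    have heq := hZ₀e _ (hφ.isTestFunction hp hr hΩ)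
    set ψ : RSpace N → ℝ := fun x => φ (r⁻¹ • (x - a)) with hψ
    have hback : ∀ y, ψ (a + r • y) = φ y := by
      intro y
      simp only [hψ]
      rw [add_sub_cancel_left, smul_smul, inv_mul_cancel₀ hr.ne', one_smul]
    have hcongr : ∫ z : RSpace N × RSpace N,
        Z₀ z * (ψ z.1 - ψ z.2) / ‖z.1 - z.2‖ ^ ((N : ℝ) + s₁) = ∫ z : RSpace N × RSpace N,
        Z z * (ψ z.1 - ψ z.2) / ‖z.1 - z.2‖ ^ ((N : ℝ) + s₁) := by
      refine integral_congr_ae ?_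
      filter_upwards [hZeq] with z hz
      rw [hz]
    rw [hcongr] at heq
    have e1 := integral_prod_affine_of_eq (A := r ^ ((N : ℝ) + s₁)) (a := a)
      (F := fun z => Z ((a, a) + r • z) * (φ z.1 - φ z.2) / ‖z.1 - z.2‖ ^ ((N : ℝ) + s₁))
      (G := fun z => Z z * (ψ z.1 - ψ z.2) / ‖z.1 - z.2‖ ^ ((N : ℝ) + s₁)) hr (by
        intro y
        simp only [Prod.fst_add, Prod.snd_add, Prod.smul_fst, Prod.smul_snd, hback, hnorm]
        rw [Real.mul_rpow hr.le (norm_nonneg _)]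
        have := (Real.rpow_pos_of_pos hr ((N : ℝ) + s₁)).ne'
        field_simp)
    have e2 := integral_prod_affine_of_eq (A := r ^ ((N : ℝ) + sp * p) * (M ^ (p - 1))⁻¹) (a := a)
      (F := fun z => oddPow (p - 2) (w (a + r • z.1) / M - w (a + r • z.2) / M) *
        (φ z.1 - φ z.2) / ‖z.1 - z.2‖ ^ ((N : ℝ) + sp * p))
      (G := fun z => |w z.1 - w z.2| ^ (p - 2) * (w z.1 - w z.2) * (ψ z.1 - ψ z.2) /
              ‖z.1 - z.2‖ ^ ((N : ℝ) + sp * p)) hr (by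
        intro y
        simp only [Prod.fst_add, Prod.snd_add, Prod.smul_fst, Prod.smul_snd, hback, hnorm]
        rw [Real.mul_rpow hr.le (norm_nonneg _), ← sub_div, oddPow_div hM0,
          show p - 2 + 1 = p - 1 by ring]
        unfold oddPow
        have := (Real.rpow_pos_of_pos hr ((N : ℝ) + sp * p)).ne'
        field_simp)
    rw [e1, e2]
    have e3 : r ^ ((N : ℝ) + sp * p) = r ^ (sp * p - s₁) * r ^ ((N : ℝ) + s₁) := by
      rw [← Real.rpow_add hr]; congr 1; ring
    rw [e3]
    linear_combination (-(r ^ (sp * p - s₁) * r ^ ((N : ℝ) + s₁) * (M ^ (p - 1))⁻¹ *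
      (r ^ (N + N))⁻¹)) * heq

end scaling

/-! ### Hölder estimates for weak solutions on balls. -/

section local_holder

variable {N : ℕ}

/-- Interior Hölder estimate for weak solutions on a ball, in scale-invariant form. -/
lemma IsWeakSolution.exists_holder_half_ball (hN : 2 ≤ N) {s₁ sp p : ℝ} (T : ℝ) (hp : 2 ≤ p)
    (hs₁ : 0 < s₁) (hs₁' : s₁ < 1) (hθ : p - 1 < sp * p) (hθp : sp * p < p) {γ : ℝ}
    (hγ0 : 0 < γ) (hγ1 : γ < 1) :
    ∃ C : ℝ, 0 ≤ C ∧ ∀ (Ω : Set (RSpace N)) (u : RSpace N → ℝ), IsWeakSolution s₁ sp p Ω u →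
      ∀ (a : RSpace N) (r M : ℝ), 0 < r → r < 1 → 1 ≤ M → Metric.closedBall a r ⊆ Ω →
      (∀ᵐ x, x ∈ Metric.ball a r → |u x| ≤ M) →
      ∫⁻ x, ENNReal.ofReal (|u x| ^ (p - 1) / (r + ‖x - a‖) ^ ((N : ℝ) + sp * p)) ≤
        ENNReal.ofReal (T * M ^ (p - 1) * r ^ (-(sp * p))) →
      ∫⁻ x in Metric.ball a r, ∫⁻ y in Metric.ball a r,
        ENNReal.ofReal (|u x - u y| ^ p / ‖x - y‖ ^ ((N : ℝ) + sp * p)) ≤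
          ENNReal.ofReal (M ^ p * r ^ ((N : ℝ) - sp * p)) →
      ∀ x ∈ Metric.ball a (r / 2), |preciseRep u x| ≤ (1 + C) * M ∧
        ∀ y ∈ Metric.ball a (r / 2),
          |preciseRep u x - preciseRep u y| ≤ C * M * (‖x - y‖ / r) ^ γ := by
  obtain ⟨C, hC, hH⟩ := exists_holder_of_normSol hN T hp hs₁ hs₁' hθ hθp hγ0 hγ1
  refine ⟨C, hC, fun Ω u hu a r M hr hr1 hM hΩ hb ht he => ?_⟩
  have hM0 : 0 < M := by linarith
  obtain ⟨c, v, Z, hv, hvu⟩ := hu.exists_normSol hp hs₁' hθ hr hr1 hM hΩ hb ht he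
  obtain ⟨w, hwv, hw⟩ := hH c v Z hv
  set W : RSpace N → ℝ := fun x => M * w (-(r⁻¹ • a) + r⁻¹ • x) with hW
  have hmem : ∀ x ∈ Metric.ball a (r / 2),
      -(r⁻¹ • a) + r⁻¹ • x ∈ Metric.ball (0 : RSpace N) (1 / 2) := by
    intro x hx
    rw [Metric.mem_ball, dist_eq_norm] at hx
    rw [mem_ball_zero_iff, neg_add_eq_sub, ← smul_sub, norm_smul, norm_inv,
      Real.norm_of_nonneg hr.le, inv_mul_lt_iff₀ hr]
    linarith
  have hWH : ∀ x ∈ Metric.ball a (r / 2), ∀ y ∈ Metric.ball a (r / 2),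
      |W x - W y| ≤ C * M * (‖x - y‖ / r) ^ γ := by
    intro x hx y hy
    have h := hw _ (hmem x hx) _ (hmem y hy)
    rw [add_sub_add_left_eq_sub, ← smul_sub, norm_smul, norm_inv, Real.norm_of_nonneg hr.le,
      inv_mul_eq_div] at h
    simp only [hW]
    rw [← mul_sub, abs_mul, abs_of_pos hM0]
    calc M * _ ≤ M * (C * (‖x - y‖ / r) ^ γ) := by gcongr
      _ = _ := by ring
  have hWc : ContinuousOn W (Metric.ball a (r / 2)) := by
    intro x hx
    refine tendsto_iff_norm_sub_tendsto_zero.2 ?_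
    have hlim : Filter.Tendsto (fun y => C * M * (‖y - x‖ / r) ^ γ)
        (nhdsWithin x (Metric.ball a (r / 2))) (nhds 0) := by
      have : ContinuousAt (fun y => C * M * (‖y - x‖ / r) ^ γ) x := by
        refine ContinuousAt.mul continuousAt_const (ContinuousAt.rpow_const (by fun_prop)
          (Or.inr hγ0.le))
      have h := this.tendsto.mono_left (nhdsWithin_le_nhds (s := Metric.ball a (r / 2)))
      simpa [Real.zero_rpow hγ0.ne'] using h
    refine squeeze_zero' (Filter.Eventually.of_forall fun _ => norm_nonneg _) ?_ hlim
    filter_upwards [self_mem_nhdsWithin] with y hy using hWH y hy x hx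
  have hWu : u =ᵐ[volume.restrict (Metric.ball a (r / 2))] W := by
    rw [Filter.EventuallyEq, ae_restrict_iff' measurableSet_ball] at hwv ⊢
    have h : ∀ᵐ y : RSpace N, y ∈ Metric.ball (0 : RSpace N) (1 / 2) → w y = u (a + r • y) / M := by
      filter_upwards [hwv, hvu] with y h1 h2 h3
      rw [h1 h3, h2]
    filter_upwards [ae_comp_affine volume h (-(r⁻¹ • a)) (inv_pos.2 hr)] with x hx hxb
    simp only [hW]
    rw [hx (hmem x hxb), smul_add, smul_neg, smul_smul, smul_smul, mul_inv_cancel₀ hr.ne',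
      one_smul, one_smul, add_neg_cancel_left, mul_div_cancel₀ _ hM0.ne']
  have hrep : ∀ x ∈ Metric.ball a (r / 2), preciseRep u x = W x := fun x hx =>
    preciseRep_eq_of_continuousOn Metric.isOpen_ball hWu hWc hx
  intro x hx
  refine ⟨?_, fun y hy => by rw [hrep x hx, hrep y hy]; exact hWH x hx y hy⟩
  -- The bound for u holds only almost everywhere; one good point together with the oscillation
  -- bound gives a bound at every point of the half ball.
  obtain ⟨y, hy, hyu, hyM⟩ : ∃ y ∈ Metric.ball a (r / 2), u y = W y ∧ |u y| ≤ M := by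
    have hne : (ae (volume.restrict (Metric.ball a (r / 2)))).NeBot := by
      rw [ae_neBot, Ne, Measure.restrict_eq_zero]
      exact (Metric.measure_ball_pos volume a (by linarith)).ne'
    obtain ⟨y, h1, h2, h3⟩ := (((ae_restrict_mem measurableSet_ball).and
      (hWu.and (ae_restrict_of_ae hb))).exists : ∃ y, _ ∧ _ ∧ _)
    exact ⟨y, h1, h2, h3 (Metric.ball_subset_ball (by linarith) h1)⟩
  rw [hrep x hx]
  have h1 := hWH x hx y hy
  have h2 : (‖x - y‖ / r) ^ γ ≤ 1 := by
    refine Real.rpow_le_one (by positivity) ?_ hγ0.le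
    rw [div_le_one hr, ← dist_eq_norm]
    rw [Metric.mem_ball] at hx hy
    have := dist_triangle_right x y a
    linarith
  have h3 : C * M * (‖x - y‖ / r) ^ γ ≤ C * M := mul_le_of_le_one_right (by positivity) h2
  rw [← hyu] at h1
  have h4 := abs_sub_abs_le_abs_sub (W x) (u y)
  linarith

/-- Inside the large ball the weight is at most r^(-(N + θ)) and |u| ≤ m. Outside, r|x - x₀| ≤ r +
|x - x₁| because r and R are below one, so recentring the tail costs the same power of r. -/
lemma lintegral_tail_shift_le {u : RSpace N → ℝ} {x₀ x₁ : RSpace N} {R r m p θ : ℝ} (hp : 2 ≤ p)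
    (hθ : 0 < θ) (hr : 0 < r) (hrR : r < R) (hR : R < 1) (hm : 1 ≤ m)
    (hb : ∀ᵐ x, x ∈ Metric.ball x₀ R → |u x| ≤ m)
    (ht : ∫⁻ x in (Metric.ball x₀ R)ᶜ,
      ENNReal.ofReal (|u x| ^ (p - 1) / ‖x - x₀‖ ^ ((N : ℝ) + θ)) ≤
        ENNReal.ofReal (R ^ (-θ) * m ^ (p - 1)))
    (hx₁ : x₁ ∈ Metric.ball x₀ R) :
    ∫⁻ x, ENNReal.ofReal (|u x| ^ (p - 1) / (r + ‖x - x₁‖) ^ ((N : ℝ) + θ)) ≤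
      ENNReal.ofReal (((volume (Metric.ball (0 : RSpace N) 1)).toReal + 1) *
        m ^ (p - 1) * r ^ (-((N : ℝ) + θ)) * r ^ (-θ)) := by
  have hm0 : 0 < m := by linarith
  have hk : 0 ≤ (N : ℝ) + θ := by positivity
  have hrk := Real.rpow_pos_of_pos hr ((N : ℝ) + θ)
  set V := (volume (Metric.ball (0 : RSpace N) 1)).toReal with hV
  have hr1 : 1 ≤ r ^ (-θ) := Real.one_le_rpow_of_pos_of_le_one_of_nonpos hr (by linarith)
    (by linarith)
  rw [← lintegral_add_compl _ (measurableSet_ball (x := x₀) (ε := R))]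
  have h1 : ∫⁻ x in Metric.ball x₀ R,
      ENNReal.ofReal (|u x| ^ (p - 1) / (r + ‖x - x₁‖) ^ ((N : ℝ) + θ)) ≤
      ENNReal.ofReal (m ^ (p - 1) * r ^ (-((N : ℝ) + θ)) * V) := by
    calc _ ≤ ∫⁻ x in Metric.ball x₀ R, ENNReal.ofReal (m ^ (p - 1) * r ^ (-((N : ℝ) + θ))) := by
          refine lintegral_mono_ae ?_
          rw [ae_restrict_iff' measurableSet_ball]
          filter_upwards [hb] with x hx hxb
          refine ENNReal.ofReal_le_ofReal ?_
          rw [Real.rpow_neg hr.le, ← div_eq_mul_inv]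
          have := hx hxb
          have := norm_nonneg (x - x₁)
          gcongr
          · linarith
          · linarith
      _ ≤ _ := by
          rw [setLIntegral_const, ENNReal.ofReal_mul (by positivity) (q := V), hV,
            ENNReal.ofReal_toReal measure_ball_lt_top.ne]
          refine mul_le_mul_right ?_ _
          rw [Measure.addHaar_ball_center]
          exact measure_mono (Metric.ball_subset_ball hR.le)
  have h2 : ∫⁻ x in (Metric.ball x₀ R)ᶜ,
      ENNReal.ofReal (|u x| ^ (p - 1) / (r + ‖x - x₁‖) ^ ((N : ℝ) + θ)) ≤
      ENNReal.ofReal (r ^ (-((N : ℝ) + θ)) * (r ^ (-θ) * m ^ (p - 1))) := by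
    calc _ ≤ ∫⁻ x in (Metric.ball x₀ R)ᶜ, ENNReal.ofReal (r ^ (-((N : ℝ) + θ))) *
          ENNReal.ofReal (|u x| ^ (p - 1) / ‖x - x₀‖ ^ ((N : ℝ) + θ)) := by
          refine setLIntegral_mono_ae' measurableSet_ball.compl (ae_of_all _ fun x hx => ?_)
          rw [← ENNReal.ofReal_mul (by positivity)]
          refine ENNReal.ofReal_le_ofReal ?_
          rw [Set.mem_compl_iff, Metric.mem_ball, not_lt, dist_eq_norm] at hx
          rw [Metric.mem_ball, dist_eq_norm] at hx₁
          have hx0 : 0 < ‖x - x₀‖ := by linarith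
          rw [Real.rpow_neg hr.le, inv_mul_eq_div, div_div, ← Real.mul_rpow hx0.le hr.le]
          gcongr
          have := norm_sub_le_norm_sub_add_norm_sub x x₁ x₀
          have := norm_nonneg (x - x₁)
          nlinarith
      _ ≤ _ := by
          rw [lintegral_const_mul' _ _ ENNReal.ofReal_ne_top,
            ENNReal.ofReal_mul (by positivity) (p := r ^ (-((N : ℝ) + θ)))]
          gcongr
          refine ht.trans (ENNReal.ofReal_le_ofReal ?_)
          gcongr ?_ * _
          exact Real.rpow_le_rpow_of_nonpos hr hrR.le (by linarith)
  refine (add_le_add h1 h2).trans ?_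
  rw [← ENNReal.ofReal_add (by positivity) (by positivity)]
  refine ENNReal.ofReal_le_ofReal ?_
  have h3 : m ^ (p - 1) * r ^ (-((N : ℝ) + θ)) * V ≤
      m ^ (p - 1) * r ^ (-((N : ℝ) + θ)) * V * r ^ (-θ) :=
    le_mul_of_one_le_right (by positivity) hr1
  linarith

/-- Cover the inner ball by balls of radius ρ = (R - r)/2, which stay inside the outer one, and
apply the half-ball estimate to each. Nearby pairs use the Hölder bound and distant pairs the sup
bound. -/
lemma IsWeakSolution.exists_holder_of_bounds (hN : 2 ≤ N) {s₁ sp p : ℝ} (hp : 2 ≤ p)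
    (hs₁ : 0 < s₁) (hs₁' : s₁ < 1) (hθ : p - 1 < sp * p) (hθp : sp * p < p) {γ : ℝ}
    (hγ0 : 0 < γ) (hγ1 : γ < 1) :
    ∃ D : ℝ, 0 ≤ D ∧ ∀ (Ω : Set (RSpace N)) (u : RSpace N → ℝ), IsWeakSolution s₁ sp p Ω u →
      ∀ (x₀ : RSpace N) (R r m : ℝ), 0 < r → r < R → R < 1 → 1 ≤ m →
      Metric.closedBall x₀ R ⊆ Ω →
      (∀ᵐ x, x ∈ Metric.ball x₀ R → |u x| ≤ m) →
      ∫⁻ x in (Metric.ball x₀ R)ᶜ,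
        ENNReal.ofReal (|u x| ^ (p - 1) / ‖x - x₀‖ ^ ((N : ℝ) + sp * p)) ≤
          ENNReal.ofReal (R ^ (-(sp * p)) * m ^ (p - 1)) →
      ∫⁻ x in Metric.ball x₀ R, ∫⁻ y in Metric.ball x₀ R,
        ENNReal.ofReal (|u x - u y| ^ p / ‖x - y‖ ^ ((N : ℝ) + sp * p)) ≤
          ENNReal.ofReal (m ^ p) →
      ∀ x ∈ Metric.ball x₀ r, ∀ y ∈ Metric.ball x₀ r,
        |preciseRep u x - preciseRep u y| ≤
          D * m * ((R - r) / 2) ^ (-((N : ℝ) + sp * p + γ)) * ‖x - y‖ ^ γ := by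
  obtain ⟨C, hC, hH⟩ := IsWeakSolution.exists_holder_half_ball hN
    ((volume (Metric.ball (0 : RSpace N) 1)).toReal + 1) hp hs₁ hs₁' hθ hθp hγ0 hγ1
  refine ⟨4 * (1 + C), by positivity, fun Ω u hu x₀ R r m hr hrR hR hm hΩ hb ht he => ?_⟩
  set ρ := (R - r) / 2 with hρ
  have hρ0 : 0 < ρ := by rw [hρ]; linarith
  have hρR : ρ < R := by rw [hρ]; linarith
  have hρ1 : ρ < 1 := by linarith
  have hm0 : 0 < m := by linarith
  set k := (N : ℝ) + sp * p with hk
  have hθ0 : 0 < sp * p := by linarith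
  have hk0 : 0 ≤ k := by positivity
  have hA1 : 1 ≤ ρ ^ (-k) := Real.one_le_rpow_of_pos_of_le_one_of_nonpos hρ0 hρ1.le (by linarith)
  -- Since ρ^(-k) ≥ 1, M^q ≥ m^q ρ^(-k) for every q ≥ 1. Enlarging M in this way keeps the final
  -- bound linear in m and pays for the losses in tail and energy.
  set M := m * ρ ^ (-k) with hM
  have hM1 : 1 ≤ M := one_le_mul_of_one_le_of_one_le hm hA1
  have hMm : m ≤ M := le_mul_of_one_le_right hm0.le hA1
  have hMpow : ∀ q : ℝ, 1 ≤ q → m ^ q * ρ ^ (-k) ≤ M ^ q := by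
    intro q hq
    rw [hM, Real.mul_rpow hm0.le (by positivity)]
    gcongr
    exact Real.self_le_rpow_of_one_le hA1 hq
  have key : ∀ x₁ ∈ Metric.ball x₀ r, ∀ x ∈ Metric.ball x₁ (ρ / 2),
      |preciseRep u x| ≤ (1 + C) * M ∧ ∀ y ∈ Metric.ball x₁ (ρ / 2),
        |preciseRep u x - preciseRep u y| ≤ C * M * (‖x - y‖ / ρ) ^ γ := by
    intro x₁ hx₁
    have hsub : Metric.closedBall x₁ ρ ⊆ Metric.ball x₀ R := by
      refine Metric.closedBall_subset_ball' ?_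
      rw [Metric.mem_ball] at hx₁
      rw [hρ]; linarith
    have hsub' := Metric.ball_subset_closedBall.trans hsub
    refine hH Ω u hu x₁ ρ M hρ0 hρ1 hM1
      (hsub.trans (Metric.ball_subset_closedBall.trans hΩ)) ?_ ?_ ?_
    · filter_upwards [hb] with x hx hxb using (hx (hsub' hxb)).trans hMm
    · refine (lintegral_tail_shift_le hp hθ0 hρ0 hρR hR hm hb ht
        (Metric.ball_subset_ball hrR.le hx₁)).trans (ENNReal.ofReal_le_ofReal ?_)
      rw [mul_assoc (_ + 1)]
      have := hMpow (p - 1) (by linarith)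
      gcongr
    · refine ((lintegral_mono fun x => lintegral_mono_set hsub').trans
        (lintegral_mono_set hsub')).trans (he.trans (ENNReal.ofReal_le_ofReal ?_))
      calc m ^ p ≤ m ^ p * ρ ^ (-(2 * (sp * p))) := by
            refine le_mul_of_one_le_right (by positivity) ?_
            exact Real.one_le_rpow_of_pos_of_le_one_of_nonpos hρ0 hρ1.le (by linarith)
        _ = m ^ p * ρ ^ (-k) * ρ ^ ((N : ℝ) - sp * p) := by
            rw [mul_assoc, ← Real.rpow_add hρ0]
            congr 2
            rw [hk]; ring
        _ ≤ _ := by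
            have := hMpow p (by linarith)
            gcongr
  intro x hx y hy
  -- At distance at least ρ/2 the Hölder factor is at least (1/2)^γ ≥ 1/2, so the sup bound 2(1 +
  -- C)M is covered by the factor 4.
  have hmain : |preciseRep u x - preciseRep u y| ≤ 4 * (1 + C) * M * (‖x - y‖ / ρ) ^ γ := by
    by_cases hxy : ‖x - y‖ < ρ / 2
    · refine ((key x hx x (Metric.mem_ball_self (by linarith))).2 y (by
        rwa [Metric.mem_ball, dist_comm, dist_eq_norm])).trans ?_
      gcongr
      linarith
    · have h1 := (key x hx x (Metric.mem_ball_self (by linarith))).1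
      have h2 := (key y hy y (Metric.mem_ball_self (by linarith))).1
      have h3 : (1 / 2 : ℝ) ≤ (‖x - y‖ / ρ) ^ γ := by
        calc (1 / 2 : ℝ) = (1 / 2) ^ (1 : ℝ) := (Real.rpow_one _).symm
          _ ≤ (1 / 2) ^ γ := Real.rpow_le_rpow_of_exponent_ge (by norm_num) (by norm_num) hγ1.le
          _ ≤ _ := by
            refine Real.rpow_le_rpow (by norm_num) ?_ hγ0.le
            rw [le_div_iff₀ hρ0]; linarith
      have h4 : 4 * (1 + C) * M * (1 / 2) ≤ 4 * (1 + C) * M * (‖x - y‖ / ρ) ^ γ := by gcongr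
      have := abs_sub (preciseRep u x) (preciseRep u y)
      linarith
  refine hmain.trans_eq ?_
  rw [hM, Real.div_rpow (norm_nonneg _) hρ0.le, neg_add k γ, Real.rpow_add hρ0,
    Real.rpow_neg hρ0.le γ]
  ring

end local_holder

/-! ### Passage to the norms of the statement and local Hölder continuity. -/

section regularity

variable {N : ℕ}

lemma ae_abs_le_of_supNormOn_le {A : Set (RSpace N)} (hA : MeasurableSet A) {u : RSpace N → ℝ}
    {m : ℝ} (hm : 0 ≤ m) (h : supNormOn A u ≤ ENNReal.ofReal m) : ∀ᵐ x, x ∈ A → |u x| ≤ m := by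
  rw [← ae_restrict_iff' hA]
  unfold supNormOn at h
  rw [eLpNorm_exponent_top] at h
  filter_upwards [ae_le_eLpNormEssSup (f := u) (μ := volume.restrict A)] with x hx
  have := hx.trans h
  rwa [← ofReal_norm, ENNReal.ofReal_le_ofReal_iff hm, Real.norm_eq_abs] at this

lemma le_ofReal_rpow_of_rpow_one_div_le {X : ℝ≥0∞} {m q : ℝ} (hq : 0 < q) (hm : 0 ≤ m)
    (h : X ^ (1 / q) ≤ ENNReal.ofReal m) : X ≤ ENNReal.ofReal (m ^ q) := by
  rw [← ENNReal.ofReal_rpow_of_nonneg hm hq.le]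
  rw [one_div] at h
  exact (ENNReal.rpow_inv_le_iff hq).1 h

lemma lintegral_le_of_nonlocalTail_le {s p : ℝ} {u : RSpace N → ℝ} {x₀ : RSpace N} {R m : ℝ}
    (hp : 2 ≤ p) (hR : 0 < R) (hm : 0 ≤ m) (h : nonlocalTail s p u x₀ R ≤ ENNReal.ofReal m) :
    ∫⁻ x in (Metric.ball x₀ R)ᶜ,
      ENNReal.ofReal (|u x| ^ (p - 1) / ‖x - x₀‖ ^ ((N : ℝ) + s * p)) ≤
        ENNReal.ofReal (R ^ (-(s * p)) * m ^ (p - 1)) := by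
  have h1 := le_ofReal_rpow_of_rpow_one_div_le (by linarith) hm h
  have hpos := Real.rpow_pos_of_pos hR (s * p)
  rw [mul_comm, ← ENNReal.le_div_iff_mul_le (Or.inl (by simpa using hpos))
    (Or.inl ENNReal.ofReal_ne_top), ← ENNReal.ofReal_div_of_pos hpos] at h1
  rwa [Real.rpow_neg hR.le, inv_mul_eq_div]

/-- The quantity `‖u‖_{L^∞(B_R)} + Tail(u; x₀, R) + [u]_{W^{s,p}(B_R)} + 1`. -/
noncomputable def totalSize (s p : ℝ) (u : RSpace N → ℝ) (x₀ : RSpace N) (R : ℝ) : ℝ≥0∞ :=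
  supNormOn (Metric.ball x₀ R) u + nonlocalTail s p u x₀ R +
    gagliardoSeminorm s p (Metric.ball x₀ R) u + 1

lemma IsWeakSolution.exists_holder (hN : 2 ≤ N) {s₁ sp p : ℝ} (hp : 2 ≤ p)
    (hs₁ : 0 < s₁) (hs₁' : s₁ < 1) (hθ : p - 1 < sp * p) (hθp : sp * p < p) {γ : ℝ}
    (hγ0 : 0 < γ) (hγ1 : γ < 1) :
    ∃ D : ℝ, 0 ≤ D ∧ ∀ (Ω : Set (RSpace N)) (u : RSpace N → ℝ), IsWeakSolution s₁ sp p Ω u →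
      ∀ (x₀ : RSpace N) (R r : ℝ), 0 < r → r < R → R < 1 → Metric.closedBall x₀ R ⊆ Ω →
      totalSize sp p u x₀ R ≠ ⊤ →
      ∀ x ∈ Metric.ball x₀ r, ∀ y ∈ Metric.ball x₀ r,
        |preciseRep u x - preciseRep u y| ≤
          D * (totalSize sp p u x₀ R).toReal * ((R - r) / 2) ^ (-((N : ℝ) + sp * p + γ)) *
            ‖x - y‖ ^ γ := by
  obtain ⟨D, hD, hH⟩ := IsWeakSolution.exists_holder_of_bounds hN hp hs₁ hs₁' hθ hθp hγ0 hγ1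
  refine ⟨D, hD, fun Ω u hu x₀ R r hr hrR hR hΩ hE => ?_⟩
  have hm := ENNReal.ofReal_toReal hE
  -- The summand 1 in the total size gives m ≥ 1, which makes the coefficient of the order-1 part at
  -- most one after normalisation.
  have h1 : 1 ≤ (totalSize sp p u x₀ R).toReal := by
    rw [← ENNReal.toReal_one, ENNReal.toReal_le_toReal ENNReal.one_ne_top hE]
    exact le_add_self
  set m := (totalSize sp p u x₀ R).toReal
  have hm0 : 0 ≤ m := by linarith
  refine hH Ω u hu x₀ R r m hr hrR hR h1 hΩ ?_ ?_ ?_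
  · refine ae_abs_le_of_supNormOn_le measurableSet_ball hm0 ?_
    rw [hm]
    exact le_add_right (le_add_right le_self_add)
  · refine lintegral_le_of_nonlocalTail_le hp (hr.trans hrR) hm0 ?_
    rw [hm]
    exact le_add_right (le_add_right le_add_self)
  · refine le_ofReal_rpow_of_rpow_one_div_le (by linarith) hm0 ?_
    rw [hm]
    exact le_add_right le_add_self

lemma holderSeminorm_le_ofReal {γ K : ℝ} {A : Set (RSpace N)} {v : RSpace N → ℝ}
    (h : ∀ x ∈ A, ∀ y ∈ A, |v x - v y| ≤ K * ‖x - y‖ ^ γ) :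
    holderSeminorm γ A v ≤ ENNReal.ofReal K := by
  refine iSup₂_le fun x hx => iSup₂_le fun y hy => iSup_le fun hxy => ENNReal.ofReal_le_ofReal ?_
  exact (div_le_iff₀ (Real.rpow_pos_of_pos (norm_pos_iff.2 (sub_ne_zero.2 hxy)) γ)).2 (h x hx y hy)

/-- Compactness of the closed ball makes δ and L uniform for pairs closer than δ; for the other
pairs, boundedness of the continuous function v suffices. This also covers balls of radius at least
one, which the quantitative estimate does not reach. -/
lemma memHolderLoc_of_forall_exists_ball {γ : ℝ} (hγ : 0 < γ) {Ω : Set (RSpace N)}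
    {v : RSpace N → ℝ}
    (h : ∀ x ∈ Ω, ∃ δ > 0, ∃ L : ℝ, ∀ y ∈ Metric.ball x δ, ∀ z ∈ Metric.ball x δ,
      |v y - v z| ≤ L * ‖y - z‖ ^ γ) : MemHolderLoc γ Ω v := by
  intro x₀ R hR hΩ
  have hK := isCompact_closedBall x₀ R
  have hcont : ContinuousOn v (Metric.closedBall x₀ R) := by
    intro x hx
    obtain ⟨δ, hδ, L, hL⟩ := h x (hΩ hx)
    refine ContinuousAt.continuousWithinAt (tendsto_iff_norm_sub_tendsto_zero.2 ?_)
    have hlim : Filter.Tendsto (fun y => L * ‖y - x‖ ^ γ) (nhds x) (nhds 0) := by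
      have : ContinuousAt (fun y => L * ‖y - x‖ ^ γ) x :=
        continuousAt_const.mul (ContinuousAt.rpow_const (by fun_prop) (Or.inr hγ.le))
      simpa [ContinuousAt, Real.zero_rpow hγ.ne'] using this
    refine squeeze_zero' (Filter.Eventually.of_forall fun _ => norm_nonneg _) ?_ hlim
    filter_upwards [Metric.ball_mem_nhds x hδ] with y hy using hL y hy x (Metric.mem_ball_self hδ)
  obtain ⟨B, hB⟩ := hK.exists_bound_of_continuousOn hcont
  have hunif : ∃ δ > 0, ∃ L : ℝ, 0 ≤ L ∧ ∀ x ∈ Metric.closedBall x₀ R, ∀ y, dist x y < δ →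
      |v x - v y| ≤ L * ‖x - y‖ ^ γ := by
    refine hK.induction_on (p := fun s => ∃ δ > 0, ∃ L : ℝ, 0 ≤ L ∧ ∀ x ∈ s, ∀ y, dist x y < δ →
      |v x - v y| ≤ L * ‖x - y‖ ^ γ) ⟨1, one_pos, 0, le_rfl, by simp⟩ ?_ ?_ ?_
    · rintro s t hst ⟨δ, hδ, L, hL0, hL⟩
      exact ⟨δ, hδ, L, hL0, fun x hx => hL x (hst hx)⟩
    · rintro s t ⟨δ, hδ, L, hL0, hL⟩ ⟨δ', hδ', L', hL0', hL'⟩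
      refine ⟨min δ δ', lt_min hδ hδ', max L L', le_max_of_le_left hL0, ?_⟩
      rintro x (hx | hx) y hxy
      · refine (hL x hx y (hxy.trans_le (min_le_left _ _))).trans ?_
        gcongr
        exact le_max_left _ _
      · refine (hL' x hx y (hxy.trans_le (min_le_right _ _))).trans ?_
        gcongr
        exact le_max_right _ _
    · intro x hx
      obtain ⟨δ, hδ, L, hL⟩ := h x (hΩ hx)
      refine ⟨Metric.ball x (δ / 2), mem_nhdsWithin_of_mem_nhds (Metric.ball_mem_nhds x (half_pos hδ)),
        δ / 2, half_pos hδ, max L 0, le_max_right _ _, fun y hy z hyz => ?_⟩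
      rw [Metric.mem_ball] at hy
      refine (hL y (Metric.mem_ball.2 (by linarith)) z (Metric.mem_ball.2 ?_)).trans ?_
      · have := dist_triangle_left z x y
        linarith
      · gcongr
        exact le_max_left _ _
  obtain ⟨δ, hδ, L, hL0, hL⟩ := hunif
  have hB0 : 0 ≤ B := (norm_nonneg _).trans (hB x₀ (Metric.mem_closedBall_self hR.le))
  refine (holderSeminorm_le_ofReal (K := L + 2 * B / δ ^ γ) fun x hx y hy => ?_).trans_lt
    ENNReal.ofReal_lt_top
  have hx' := Metric.ball_subset_closedBall hx
  have hδγ := Real.rpow_pos_of_pos hδ γ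
  by_cases hxy : dist x y < δ
  · refine (hL x hx' y hxy).trans ?_
    gcongr
    exact le_add_of_nonneg_right (by positivity)
  · have h1 : δ ^ γ ≤ ‖x - y‖ ^ γ := by
      rw [← dist_eq_norm]
      exact Real.rpow_le_rpow hδ.le (not_lt.1 hxy) hγ.le
    have h2 := hB x hx'
    have h3 := hB y (Metric.ball_subset_closedBall hy)
    rw [Real.norm_eq_abs] at h2 h3
    calc |v x - v y| ≤ |v x| + |v y| := abs_sub _ _
      _ ≤ 2 * B / δ ^ γ * δ ^ γ := by rw [div_mul_cancel₀ _ hδγ.ne']; linarith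
      _ ≤ 2 * B / δ ^ γ * ‖x - y‖ ^ γ := by gcongr
      _ ≤ (L + 2 * B / δ ^ γ) * ‖x - y‖ ^ γ := by gcongr; linarith

/-- Outside the ball around x₀, 1 + |x| ≤ A |x - x₀|, so the two weights are comparable. -/
lemma MemTailSpace.nonlocalTail_lt_top {s p : ℝ} (hp : 2 ≤ p) (hs : 0 ≤ s * p) {u : RSpace N → ℝ}
    (hu : MemTailSpace (p - 1) (s * p) u) (x₀ : RSpace N) {R : ℝ} (hR : 0 < R) :
    nonlocalTail s p u x₀ R < ⊤ := by
  set A := (1 + ‖x₀‖) / R + 1 with hA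
  have hA0 : 0 < A := by positivity
  have hk : 0 ≤ (N : ℝ) + s * p := by positivity
  refine ENNReal.rpow_lt_top_of_nonneg (by rw [one_div_nonneg]; linarith)
    (ENNReal.mul_lt_top ENNReal.ofReal_lt_top ?_).ne
  calc _ ≤ ∫⁻ x in (Metric.ball x₀ R)ᶜ, ENNReal.ofReal (A ^ ((N : ℝ) + s * p)) *
        ENNReal.ofReal (|u x| ^ (p - 1) / (1 + ‖x‖) ^ ((N : ℝ) + s * p)) := by
        refine setLIntegral_mono_ae' measurableSet_ball.compl (ae_of_all _ fun x hx => ?_)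
        rw [← ENNReal.ofReal_mul (by positivity)]
        refine ENNReal.ofReal_le_ofReal ?_
        rw [Set.mem_compl_iff, Metric.mem_ball, not_lt, dist_eq_norm] at hx
        have hx0 : 0 < ‖x - x₀‖ := by linarith
        have h1 : 1 + ‖x‖ ≤ A * ‖x - x₀‖ := by
          have h2 := norm_le_norm_sub_add x x₀
          have h3 : (1 + ‖x₀‖) / R * R ≤ (1 + ‖x₀‖) / R * ‖x - x₀‖ := by gcongr
          rw [div_mul_cancel₀ _ hR.ne'] at h3
          rw [hA, add_mul, one_mul]
          linarith
        rw [mul_div_assoc', div_le_div_iff₀ (by positivity) (by positivity)]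
        calc |u x| ^ (p - 1) * (1 + ‖x‖) ^ ((N : ℝ) + s * p)
            ≤ |u x| ^ (p - 1) * (A * ‖x - x₀‖) ^ ((N : ℝ) + s * p) := by gcongr
          _ = _ := by rw [Real.mul_rpow hA0.le hx0.le]; ring
    _ ≤ ∫⁻ x, ENNReal.ofReal (A ^ ((N : ℝ) + s * p)) *
        ENNReal.ofReal (|u x| ^ (p - 1) / (1 + ‖x‖) ^ ((N : ℝ) + s * p)) := setLIntegral_le_lintegral _ _
    _ < ⊤ := by
        rw [lintegral_const_mul' _ _ ENNReal.ofReal_ne_top]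
        exact ENNReal.mul_lt_top ENNReal.ofReal_lt_top hu.lintegral_lt_top

lemma IsWeakSolution.totalSize_lt_top {s₁ sp p : ℝ} (hp : 2 ≤ p) (hs : 0 ≤ sp * p)
    {Ω : Set (RSpace N)} {u : RSpace N → ℝ} (hu : IsWeakSolution s₁ sp p Ω u)
    (hb : LocallyBoundedOn Ω u) {x₀ : RSpace N} {R : ℝ} (hR : 0 < R)
    (hΩ : Metric.closedBall x₀ R ⊆ Ω) : totalSize sp p u x₀ R < ⊤ := by
  have h1 : supNormOn (Metric.ball x₀ R) u < ⊤ :=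
    (eLpNorm_mono_measure u (Measure.restrict_mono Metric.ball_subset_closedBall le_rfl)).trans_lt
      (hb _ (isCompact_closedBall x₀ R) hΩ)
  have h2 := hu.mem_tail.nonlocalTail_lt_top hp hs x₀ hR
  have h3 := (hu.mem_p (Metric.ball x₀ R) Metric.isOpen_ball
    ((isCompact_closedBall x₀ R).of_isClosed_subset isClosed_closure
      Metric.closure_ball_subset_closedBall)
    (Metric.closure_ball_subset_closedBall.trans hΩ)).seminorm_lt_top
  exact ENNReal.add_lt_top.2 ⟨ENNReal.add_lt_top.2 ⟨ENNReal.add_lt_top.2 ⟨h1, h2⟩, h3⟩,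
    ENNReal.one_lt_top⟩

end regularity

theorem corollary1p5 (N : ℕ) (hN : 2 ≤ N) (p s₁ sp γ : ℝ) (hp : 2 ≤ p)
    (hs₁ : s₁ ∈ Set.Ioo (0 : ℝ) 1) (hsp : sp ∈ Set.Ioo ((p - 1) / p) 1)
    (hγ : γ ∈ Set.Ioo (0 : ℝ) 1) :
    ∃ C κ : ℝ, 0 < C ∧ 0 < κ ∧
      ∀ (Ω : Set (RSpace N)), IsOpen Ω → IsConnected Ω → Bornology.IsBounded Ω →
      ∀ (u : RSpace N → ℝ), IsWeakSolution s₁ sp p Ω u → LocallyBoundedOn Ω u →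
        ∃ v : RSpace N → ℝ, v =ᵐ[volume.restrict Ω] u ∧ MemHolderLoc γ Ω v ∧
          ∀ (x₀ : RSpace N) (R r : ℝ), R ∈ Set.Ioo (0 : ℝ) 1 → r ∈ Set.Ioo 0 R →
            Metric.closedBall x₀ R ⊆ Ω →
            holderSeminorm γ (Metric.ball x₀ r) v ≤
              ENNReal.ofReal (C / (R - r) ^ κ) *
                (supNormOn (Metric.ball x₀ R) u + nonlocalTail sp p u x₀ R +
                  gagliardoSeminorm sp p (Metric.ball x₀ R) u + 1) := by
  have hp0 : 0 < p := by linarith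
  have hθ : p - 1 < sp * p := (div_lt_iff₀ hp0).1 hsp.1
  have hθp : sp * p < p := mul_lt_of_lt_one_left hp0 hsp.2
  have hθ0 : 0 < sp * p := by linarith
  obtain ⟨D, hD, hH⟩ := IsWeakSolution.exists_holder hN hp hs₁.1 hs₁.2 hθ hθp hγ.1 hγ.2
  set κ := (N : ℝ) + sp * p + γ with hκ
  have hκ0 : 0 < κ := by have := hγ.1; positivity
  -- The factor 2^κ comes from (R - r)/2, and the summand 1 makes the constant positive even if D =
  -- 0.
  refine ⟨D * 2 ^ κ + 1, κ, by positivity, hκ0, fun Ω hΩo _ _ u hu hb =>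
    ⟨preciseRep u, ae_restrict_of_ae (preciseRep_ae_eq (hu.locallyIntegrable hp)), ?_, ?_⟩⟩
  · refine memHolderLoc_of_forall_exists_ball hγ.1 fun x hx => ?_
    obtain ⟨ε, hε, hεΩ⟩ := Metric.isOpen_iff.1 hΩo x hx
    set R := min (ε / 2) (1 / 2) with hR
    have hR0 : 0 < R := lt_min (by linarith) (by norm_num)
    have hR1 : R < 1 := (min_le_right _ _).trans_lt (by norm_num)
    have hRε : R < ε := (min_le_left _ _).trans_lt (by linarith)
    have hsub := (Metric.closedBall_subset_ball hRε).trans hεΩ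
    exact ⟨R / 2, half_pos hR0, _, hH Ω u hu x R (R / 2) (half_pos hR0) (half_lt_self hR0) hR1 hsub
      (hu.totalSize_lt_top hp hθ0.le hb hR0 hsub).ne⟩
  · intro x₀ R r hR hr hsub
    have hE := (hu.totalSize_lt_top hp hθ0.le hb hR.1 hsub).ne
    have hRr : 0 < R - r := sub_pos.2 hr.2
    refine (holderSeminorm_le_ofReal (hH Ω u hu x₀ R r hr.1 hr.2 hR.2 hsub hE)).trans ?_
    change _ ≤ _ * totalSize sp p u x₀ R
    nth_rewrite 2 [← ENNReal.ofReal_toReal hE]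
    rw [← ENNReal.ofReal_mul (by positivity)]
    refine ENNReal.ofReal_le_ofReal ?_
    rw [Real.rpow_neg (by positivity), Real.div_rpow hRr.le zero_le_two, inv_div, mul_right_comm,
      ← mul_div_assoc]
    gcongr
    exact (lt_add_one _).le
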